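/- **Theorem.** Let $\nu>0$ and $0\le\alpha\le2$, and consider on $\mathbb R$ the equation $$\partial_t\rho+\partial_x(\rho\,H\rho)=-\nu\Lambda^\alpha\rho,\qquad \rho(x,0)=\rho_0(x),\tag{1.1}$$ where $H\rho(x)=\frac1\pi\,\mathrm{p.v.}\!\int_{\mathbb R}\frac{\rho(y)}{x-y}\,dy$ is the Hilbert transform and $\Lambda^\alpha=(-\partial_{xx})^{\alpha/2}$ is the Fourier multiplier with symbol $|\xi|^\alpha$. For $s\in\mathbb R$, $H^s(\mathbb R)$ is the space of tempered distributions $f$ with $\|f\|_{H^s}:=\|(I-\partial_{xx})^{s/2}f\|_{L^2}<\infty$. For $T>0$, a nonnegative function $\rho\in L^\infty(0,T;L^1\cap H^{1/2}(\mathbb R))\cap W^{1,\infty}(0,T;H^{-m}(\mathbb R))$, for some $m>0$, is a weak solution of (1.1) on $(0,T)$ if for all $\phi\in C_c^\infty(\mathbb R\times[0,T))$ $$\int_0^T\!\!\int_{\mathbb R}\partial_t\phi\,\rho\,dx\,dt+\int_{\mathbb R}\phi(x,0)\rho_0(x)\,dx=-\frac1{2\pi}\int_0^T\!\!\int_{\mathbb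 R}\!\int_{\mathbb R}\frac{\partial_x\phi(x,t)-\partial_x\phi(y,t)}{x-y}\rho(x,t)\rho(y,t)\,dx\,dy\,dt+\nu\int_0^T\!\!\int_{\mathbb R}\rho\,\Lambda^\alpha\phi\,dx\,dt;$$ a global weak solution is a function on $\mathbb R\times(0,\infty)$ that is a weak solution on $(0,T)$ for every $T>0$. Suppose $0\le\rho_0\in L^1(\mathbb R)\cap H^{1/2}(\mathbb R)$. Then (1.1) has a global nonnegative weak solution $$\rho\in L^\infty(0,\infty;L^1(\mathbb R)\cap H^{1/2}(\mathbb R))\cap W^{1,\infty}(0,\infty;H^{-3}(\mathbb R)),$$ and, with $\rho(t)$ denoting the values of its continuous $H^{-3}$-valued representative, $$\|\rho(t)\|_{L^1}\le\|\rho_0\|_{L^1},\qquad \|\rho(t)\|_{H^{1/2}}\le\|\rho_0\|_{H^{1/2}}\qquad\text{for all }t>0.$$ -/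

import Mathlib

open MeasureTheory Set
open scoped FourierTransform ContDiff ENNReal

noncomputable section

/-- The Fourier transform `∫ e^{-2π i x ξ} f(x) dx` of a real-valued (integrable) function. In this
normalization the symbol of `-∂ₓₓ` is `(2πξ)²`. -/
def fourierReal (f : ℝ → ℝ) : ℝ → ℂ := 𝓕 (fun x : ℝ => (f x : ℂ))

/-- The measure `(1 + (2πξ)²)^s dξ` on the frequency line. -/
def sobolevMeasure (s : ℝ) : Measure ℝ :=
  volume.withDensity fun ξ : ℝ => ENNReal.ofReal ((1 + (2 * Real.pi * ξ) ^ 2) ^ s)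

/-- The Bessel potential (Sobolev) space `H^s(ℝ)`, any real `s`, realized on the Fourier side: by
Plancherel, `u ↦ 𝓕 u` is an isometric isomorphism from
`{u ∈ 𝓢'(ℝ) : (I - ∂ₓₓ)^{s/2} u ∈ L²}`, with the norm `‖(I - ∂ₓₓ)^{s/2} u‖_{L²}`, onto this Banach
space. An element is the Fourier transform of the distribution it stands for. -/
abbrev SobolevSpace (s : ℝ) : Type := Lp ℂ 2 (sobolevMeasure s)

/-- The norm `‖(I - ∂ₓₓ)^{s/2} f‖_{L²}` of an integrable function `f`, with values in `[0, ∞]`. -/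
def sobolevNorm (s : ℝ) (f : ℝ → ℝ) : ℝ≥0∞ := eLpNorm (fourierReal f) 2 (sobolevMeasure s)

/-- The integrable function `f`, as a distribution, is the element `u` of `H^s(ℝ)`. -/
def RepresentsSobolev (s : ℝ) (f : ℝ → ℝ) (u : SobolevSpace s) : Prop :=
  Integrable f ∧ (u : ℝ → ℂ) =ᵐ[sobolevMeasure s] fourierReal f

/-- `ρ ∈ L^∞(I; L¹(ℝ))`, in the sense of Bochner (`ρ t x` is the value at time `t`, position `x`). -/
def MemLInftyL1 (I : Set ℝ) (ρ : ℝ → ℝ → ℝ) : Prop :=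
  ∃ r : ℝ → Lp ℝ 1 (volume : Measure ℝ),
    (∀ᵐ t ∂(volume.restrict I), (r t : ℝ → ℝ) =ᵐ[volume] ρ t) ∧ MemLp r ∞ (volume.restrict I)

/-- `ρ ∈ L^∞(I; H^s(ℝ))`, in the sense of Bochner, for a curve `ρ` of integrable functions. -/
def MemLInftySobolev (s : ℝ) (I : Set ℝ) (ρ : ℝ → ℝ → ℝ) : Prop :=
  ∃ h : ℝ → SobolevSpace s,
    (∀ᵐ t ∂(volume.restrict I), RepresentsSobolev s (ρ t) (h t)) ∧ MemLp h ∞ (volume.restrict I)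

/-- `g` is the weak derivative of the Banach-space valued function `h` on the open set `I ⊆ ℝ`:
`∫_I ψ' h = - ∫_I ψ g` for all `ψ ∈ C_c^∞(I)`. -/
def IsWeakTimeDeriv {X : Type*} [NormedAddCommGroup X] [NormedSpace ℝ X] (I : Set ℝ)
    (h g : ℝ → X) : Prop :=
  ∀ ψ : ℝ → ℝ, ContDiff ℝ ∞ ψ → HasCompactSupport ψ → tsupport ψ ⊆ I →
    ∫ t in I, deriv ψ t • h t = -∫ t in I, ψ t • g t

/-- `ρ ∈ W^{1,∞}(I; H^s(ℝ))` for a curve `ρ` of integrable functions and an open interval `I`: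
`ρ` and its weak time derivative belong to `L^∞(I; H^s)`. A class in `W^{1,∞}(I; H^s)` has exactly
one continuous representative; it is this representative that `t ↦ ρ t` is required to be, so that
the value `ρ t` is meaningful (up to a null set of `x`) for every `t ∈ I`. -/
def MemW1InftySobolev (s : ℝ) (I : Set ℝ) (ρ : ℝ → ℝ → ℝ) : Prop :=
  ∃ h g : ℝ → SobolevSpace s,
    (∀ t ∈ I, RepresentsSobolev s (ρ t) (h t)) ∧ ContinuousOn h I ∧
    MemLp h ∞ (volume.restrict I) ∧ MemLp g ∞ (volume.restrict I) ∧ IsWeakTimeDeriv I h g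

/-- The fractional Laplacian `Λ^α f = (-∂ₓₓ)^{α/2} f`, the Fourier multiplier with symbol `|ξ|^α` in
the angular frequency, that is `|2πξ|^α` here. It is used for `f ∈ C_c^∞(ℝ)` real-valued and
`α ≥ 0`, where the inverse transform is real-valued (the real part only fixes the type). -/
def fracLaplacian (α : ℝ) (f : ℝ → ℝ) (x : ℝ) : ℝ :=
  (𝓕⁻ (fun ξ : ℝ => ((|2 * Real.pi * ξ| ^ α : ℝ) : ℂ) * fourierReal f ξ) x).re

/-- Test functions `φ(x, t)` in `C_c^∞(ℝ × [0, T))`, given by smooth compactly supported extensions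
to `t < 0` (which always exist). -/
def IsTestFunction (T : ℝ) (φ : ℝ × ℝ → ℝ) : Prop :=
  ContDiff ℝ ∞ φ ∧ HasCompactSupport φ ∧ tsupport φ ⊆ {p : ℝ × ℝ | p.2 < T}

/-- `ρ` is a nonnegative weak solution on `(0, T)` of `∂ₜρ + ∂ₓ(ρ Hρ) = -ν Λ^α ρ`, `ρ(0) = ρ₀`, where
`Hρ(x) = (1/π) p.v. ∫ ρ(y)/(x - y) dy`. The nonlinear term is symmetrized in `x` and `y`:
`∫ ∂ₓφ ρ Hρ dx = (1/(2π)) ∬ (∂ₓφ(x) - ∂ₓφ(y))/(x - y) ρ(x) ρ(y) dx dy`. -/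
structure IsWeakSolution (ν α T : ℝ) (ρ₀ : ℝ → ℝ) (ρ : ℝ → ℝ → ℝ) : Prop where
  measurable : AEStronglyMeasurable (fun p : ℝ × ℝ => ρ p.1 p.2)
    ((volume.restrict (Ioo 0 T)).prod volume)
  nonneg : ∀ t ∈ Ioo 0 T, ∀ᵐ x, 0 ≤ ρ t x
  memL1 : MemLInftyL1 (Ioo 0 T) ρ
  memSobolev : MemLInftySobolev (1 / 2) (Ioo 0 T) ρ
  memW1 : ∃ m : ℝ, 0 < m ∧ MemW1InftySobolev (-m) (Ioo 0 T) ρ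
  weak_form : ∀ φ : ℝ × ℝ → ℝ, IsTestFunction T φ →
    (∫ t in Ioo 0 T, ∫ x, deriv (fun s => φ (x, s)) t * ρ t x) + ∫ x, φ (x, 0) * ρ₀ x =
      -(1 / (2 * Real.pi)) * (∫ t in Ioo 0 T, ∫ x, ∫ y,
          (deriv (fun z => φ (z, t)) x - deriv (fun z => φ (z, t)) y) / (x - y)
            * ρ t x * ρ t y)
        + ν * ∫ t in Ioo 0 T, ∫ x, ρ t x * fracLaplacian α (fun z => φ (z, t)) x

end

open Filter Topology
open scoped ComplexConjugate

/-! The equation is solved for the characteristic functions `F(t, θ) = ∫ e^{iθx} ρ(t, x) dx`.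
Symmetrizing the Hilbert kernel and writing a difference quotient as an average of derivatives along
the segment from `y` to `x` turns it into `∂ₜF(θ) = -(θ²/2π) ∫₀¹ F(sθ) F((1-s)θ) ds - ν|θ|^α F(θ)`.
The right-hand side at `θ` samples `F` only on `[-|θ|, |θ|]`, so on each bounded frequency interval
it is Lipschitz for the sup norm on bounded sets, with no loss of derivatives. Grönwall's inequality
then gives convergence of any consistent scheme whose iterates stay bounded.

Boundedness and positivity of `ρ` come together by keeping the iterates among characteristic
functions of measures of mass at most `M = ∫ ρ₀`. A naive Euler step leaves this class. The step in
`exists_euler_step` replaces the dissipation by a killed compound Poisson generator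
(`exists_charFun_approx_abs_rpow`), mollifies the nonlinearity, and adds a small artificial jump
term `κ(k_δ - 1)F`, where `k_δ` is the transform of a density proportional to `(x² + δ²)⁻²`. By
`exists_charFun_eq_student_add_regNonlin` the gain `κ k_δ F` dominates the mollified nonlinearity:
for positive frequencies the nonlinearity is a half-line convolution, its Fourier inversion is a
product of functions analytic in a half-plane, and the domination reduces to the elementary
inequality `harnack_laplace`. The step is therefore a nonnegative combination of characteristic
functions. Lévy's theorem (`exists_charFun_eq_of_tendsto`) keeps the limit in the class
(`exists_charFun_solution`).

The `H^{1/2}` bound is a monotonicity property of the nonlinearity. Expanding one factor of `F` as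
an integral over the measure reduces the energy production to `∫ w(c) Re(P'(c) conj P(c))/c dc`,
with `P(c) = ∫₀ᶜ a u(a) da` and `u` a modulation of `F`. This is `∫ (w/2c) d|P|²`, which is
nonnegative because `w(c)/c` decreases for `w(c) = √(1 + c²)` (`integral_sqrt_weight_nonneg`). It
holds on every interval `[0, R]`, so no a priori integrability is needed, and `R → ∞` gives
`IsCharFunSolution.lintegral_energy_le`.

Finite energy makes `F(t)` square integrable, hence the measures absolutely continuous, with a
jointly measurable density `ρ`. Parseval's formula carries the equation for `F` back to the weak
formulation (`IsDensitySolution.weak_form`), and polynomial growth of `∂ₜF` in `θ` gives the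
`W^{1,∞}` bound in `H^{-3}`. -/

/-! ### Nonnegative Fourier transforms and Lévy's continuity theorem -/

theorem Real.integral_fourier_mul_eq {f g : ℝ → ℂ} (hf : Integrable f) (hg : Integrable g) :
    ∫ ξ, 𝓕 f ξ * g ξ = ∫ x, f x * 𝓕 g x := by
  have := VectorFourier.integral_fourierIntegral_smul_eq_flip (L := innerₗ ℝ) (μ := volume)
    (ν := volume) Real.continuous_fourierChar continuous_inner hf hg
  simpa only [flip_innerₗ] using! this

theorem Real.continuous_fourier {f : ℝ → ℂ} (hf : Integrable f) : Continuous (𝓕 f) :=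
  VectorFourier.fourierIntegral_continuous Real.continuous_fourierChar continuous_inner hf

/-- The transform is a Gaussian probability density for every `b`, so Gaussian regularization costs
nothing uniformly in `b`. -/
theorem integral_norm_fourier_gaussian {b : ℝ} (hb : 0 < b) :
    Integrable (𝓕 (fun x : ℝ => Complex.exp (-Real.pi * b * x ^ 2))) ∧
    ∫ ξ, ‖𝓕 (fun x : ℝ => Complex.exp (-Real.pi * b * x ^ 2)) ξ‖ = 1 := by
  have key : 𝓕 (fun x : ℝ => Complex.exp (-Real.pi * b * x ^ 2)) =
      fun t : ℝ => (((1 / Real.sqrt b) * Real.exp (-(Real.pi / b) * t ^ 2) : ℝ) : ℂ) := by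
    rw [fourier_gaussian_pi (by simpa using hb)]
    ext t
    push_cast
    have : ((b : ℂ)) ^ (1 / 2 : ℂ) = ((Real.sqrt b : ℝ) : ℂ) := by
      rw [Real.sqrt_eq_rpow, Complex.ofReal_cpow hb.le]; norm_num
    rw [this]
    congr 2
    ring
  have hpb : 0 < Real.pi / b := by positivity
  rw [key]
  refine ⟨((integrable_exp_neg_mul_sq hpb).const_mul _).ofReal, ?_⟩
  have : ∀ t : ℝ, ‖(((1 / Real.sqrt b) * Real.exp (-(Real.pi / b) * t ^ 2) : ℝ) : ℂ)‖ =
      (1 / Real.sqrt b) * Real.exp (-(Real.pi / b) * t ^ 2) := fun t => by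
    rw [Complex.norm_real, Real.norm_of_nonneg (by positivity)]
  simp_rw [this]
  rw [integral_const_mul, integral_gaussian, div_div_cancel₀ Real.pi_ne_zero]
  have : 0 < Real.sqrt b := Real.sqrt_pos.2 hb
  field_simp

/-- If the Fourier transform of a bounded integrable function is nonnegative, it is integrable. -/
theorem integrable_of_fourier_nonneg {G : ℝ → ℂ} (hi : Integrable G) {C : ℝ}
    (hC : ∀ ξ, ‖G ξ‖ ≤ C) {D : ℝ → ℝ} (hD : ∀ x, 0 ≤ D x) (h : ∀ x, 𝓕 G x = D x) :
    Integrable D := by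
  have hDc : Continuous D := by
    have : Continuous (fun x => (𝓕 G x).re) := Complex.continuous_re.comp (Real.continuous_fourier hi)
    simpa [h] using this
  -- Moving the Fourier transform from `G` onto the Gaussian bounds the regularized integral by `sup
  -- ‖G‖` times an `L¹` norm equal to 1, uniformly in `b`; Fatou's lemma as `b → 0` then concludes,
  -- and this is where `D ≥ 0` enters.
  have bound : ∀ b : ℝ, 0 < b → Integrable (fun x => D x * Real.exp (-(Real.pi * b) * x ^ 2)) ∧
      ∫ x, D x * Real.exp (-(Real.pi * b) * x ^ 2) ≤ C := by
    intro b hb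
    have hg : Integrable (fun x : ℝ => Complex.exp (-Real.pi * b * x ^ 2)) := by
      have := (integrable_exp_neg_mul_sq (b := Real.pi * b) (by positivity)).ofReal (𝕜 := ℂ)
      refine this.congr (ae_of_all _ fun x => ?_)
      simp
    have hDb : ∀ x, |D x| ≤ ∫ ξ, ‖G ξ‖ := fun x => by
      have h1 := VectorFourier.norm_fourierIntegral_le_integral_norm Real.fourierChar volume
        (innerₗ ℝ) G x
      have h2 : ‖𝓕 G x‖ = |D x| := by rw [h, Complex.norm_real, Real.norm_eq_abs]
      rw [← h2]; exact h1
    have hint : Integrable (fun x => D x * Real.exp (-(Real.pi * b) * x ^ 2)) :=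
      (integrable_exp_neg_mul_sq (b := Real.pi * b) (by positivity)).bdd_mul
        hDc.aestronglyMeasurable (ae_of_all _ hDb)
    refine ⟨hint, ?_⟩
    have e1 := Real.integral_fourier_mul_eq hi hg
    have e2 : ∫ ξ, 𝓕 G ξ * Complex.exp (-Real.pi * b * ξ ^ 2) =
        ((∫ x, D x * Real.exp (-(Real.pi * b) * x ^ 2) : ℝ) : ℂ) := by
      rw [← integral_complex_ofReal]
      refine integral_congr_ae (ae_of_all _ fun x => ?_)
      simp [h]
    have e3 : ‖∫ x, G x * 𝓕 (fun x : ℝ => Complex.exp (-Real.pi * b * x ^ 2)) x‖ ≤ C := by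
      have hC0 : 0 ≤ C := (norm_nonneg _).trans (hC 0)
      calc _ ≤ ∫ x, C * ‖𝓕 (fun x : ℝ => Complex.exp (-Real.pi * b * x ^ 2)) x‖ := by
            refine norm_integral_le_of_norm_le
              ((integral_norm_fourier_gaussian hb).1.norm.const_mul _) (ae_of_all _ fun x => ?_)
            rw [norm_mul]
            gcongr
            exact hC x
        _ = C := by rw [integral_const_mul, (integral_norm_fourier_gaussian hb).2, mul_one]
    rw [← e1, e2, Complex.norm_real] at e3
    exact (le_abs_self _).trans e3
  refine ⟨hDc.aestronglyMeasurable, ?_⟩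
  rw [hasFiniteIntegral_iff_norm]
  let b : ℕ → ℝ := fun n => 1 / ((n : ℝ) + 1)
  have hb : ∀ n, 0 < b n := fun n => by positivity
  have hb0 : Tendsto b atTop (𝓝 0) := tendsto_one_div_add_atTop_nhds_zero_nat
  have hlim : ∀ x, liminf (fun n => ENNReal.ofReal (D x * Real.exp (-(Real.pi * b n) * x ^ 2))) atTop
      = ENNReal.ofReal ‖D x‖ := fun x => by
    rw [Real.norm_of_nonneg (hD x)]
    refine Tendsto.liminf_eq (ENNReal.tendsto_ofReal ?_)
    have : Tendsto (fun n => D x * Real.exp (-(Real.pi * b n) * x ^ 2)) atTop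
        (𝓝 (D x * Real.exp (-(Real.pi * 0) * x ^ 2))) :=
      ((Real.continuous_exp.tendsto _).comp (((hb0.const_mul _).neg).mul_const _)).const_mul _
    simpa using this
  calc ∫⁻ x, ENNReal.ofReal ‖D x‖
      = ∫⁻ x, liminf (fun n => ENNReal.ofReal (D x * Real.exp (-(Real.pi * b n) * x ^ 2))) atTop := by
        simp_rw [hlim]
    _ ≤ liminf (fun n => ∫⁻ x, ENNReal.ofReal (D x * Real.exp (-(Real.pi * b n) * x ^ 2))) atTop :=
        lintegral_liminf_le fun n => by fun_prop
    _ ≤ ENNReal.ofReal C := by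
        refine liminf_le_of_frequently_le' (Frequently.of_forall fun n => ?_)
        rw [← ofReal_integral_eq_lintegral_ofReal (bound _ (hb n)).1
          (ae_of_all _ fun x => mul_nonneg (hD x) (Real.exp_nonneg _))]
        exact ENNReal.ofReal_le_ofReal (bound _ (hb n)).2
    _ < ⊤ := ENNReal.ofReal_lt_top

/-- A bounded continuous integrable function with nonnegative Fourier transform is the
characteristic function of a finite measure. -/
theorem exists_charFun_eq_of_fourier_nonneg {G : ℝ → ℂ} (hc : Continuous G) (hi : Integrable G)
    {C : ℝ} (hC : ∀ ξ, ‖G ξ‖ ≤ C) {D : ℝ → ℝ} (hD : ∀ x, 0 ≤ D x) (h : ∀ x, 𝓕 G x = D x) :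
    ∃ μ : Measure ℝ, IsFiniteMeasure μ ∧ charFun μ = G := by
  have hDi := integrable_of_fourier_nonneg hi hC hD h
  have hFi : Integrable (𝓕 G) := hDi.ofReal.congr (ae_of_all _ fun x => (h x).symm)
  have hinv := hc.fourierInv_fourier_eq hi hFi
  have hDm : Measurable D := by
    have : Continuous (fun x => (𝓕 G x).re) := Complex.continuous_re.comp (Real.continuous_fourier hi)
    exact (by simpa [h] using this : Continuous D).measurable
  let m : Measure ℝ := volume.withDensity fun x => ENNReal.ofReal (D x)
  have hm : IsFiniteMeasure m := isFiniteMeasure_withDensity_ofReal hDi.2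
  -- The dilation converts the phase `2πxξ` of `𝓕` into the phase `xθ` of `charFun`.
  refine ⟨m.map (fun x => (2 * Real.pi) * x), inferInstance, ?_⟩
  ext θ
  rw [charFun_map_mul, ← hinv, Real.fourierInv_eq', charFun_apply_real,
    integral_withDensity_eq_integral_toReal_smul (by fun_prop) (ae_of_all _ fun _ => by simp)]
  refine integral_congr_ae (ae_of_all _ fun x => ?_)
  simp only [h, ENNReal.toReal_ofReal (hD x)]
  simp only [Complex.real_smul, smul_eq_mul, mul_comm (D x : ℂ)]
  congr 2
  simp
  ring

/-- **Lévy's continuity theorem** for finite measures on the line: a pointwise limit of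
characteristic functions that is continuous at `0` is a characteristic function. -/
theorem exists_charFun_eq_of_tendsto {F : ℕ → ℝ → ℂ} {f : ℝ → ℂ}
    (hF : ∀ n, ∃ μ : Measure ℝ, IsFiniteMeasure μ ∧ charFun μ = F n)
    (hlim : ∀ t, Tendsto (fun n => F n t) atTop (𝓝 (f t))) (hf : ContinuousAt f 0) :
    ∃ μ : Measure ℝ, IsFiniteMeasure μ ∧ charFun μ = f := by
  choose μ hμ hμF using hF
  have h0 : ∀ n, F n 0 = (((μ n).real univ : ℝ) : ℂ) := fun n => by rw [← hμF]; simp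
  have hmass : Tendsto (fun n => (μ n).real univ) atTop (𝓝 (f 0).re) := by
    have := (Complex.continuous_re.tendsto _).comp (hlim 0)
    refine this.congr fun n => ?_
    simp [h0]
  have hf0 : f 0 = ((f 0).re : ℂ) := by
    refine tendsto_nhds_unique (hlim 0) ?_
    simp_rw [h0]
    exact (Complex.continuous_ofReal.tendsto _).comp hmass
  have hnn : 0 ≤ (f 0).re := ge_of_tendsto' hmass fun n => measureReal_nonneg
  -- If the masses tend to 0 they cannot be normalized, but then the limit is the zero function.
  -- Otherwise the masses are eventually positive, and tightness and compactness apply to the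
  -- normalized measures.
  rcases hnn.eq_or_lt with hz | hpos
  · refine ⟨0, inferInstance, ?_⟩
    ext t
    have h1 : ‖f t‖ ≤ (f 0).re :=
      le_of_tendsto_of_tendsto' (hlim t).norm hmass fun n => by rw [← hμF]; exact norm_charFun_le t
    rw [← hz] at h1
    rw [charFun_zero_measure, norm_le_zero_iff.1 h1]
  obtain ⟨N, hN⟩ := eventually_atTop.1 (hmass.eventually (lt_mem_nhds hpos))
  have hpos' : ∀ n, 0 < (μ (n + N)).real univ := fun n => hN _ (by omega)
  let ν : ℕ → FiniteMeasure ℝ := fun n => ⟨μ (n + N), hμ _⟩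
  have hne : ∀ n, ν n ≠ 0 := fun n hn => by
    have := hpos' n
    have h2 : μ (n + N) = 0 := congrArg Subtype.val hn
    simp [h2] at this
  let P : ℕ → ProbabilityMeasure ℝ := fun n => (ν n).normalize
  have hP : ∀ n, (P n : Measure ℝ) = (((μ (n + N)).real univ)⁻¹).toNNReal • μ (n + N) := fun n => by
    change ((ν n).normalize : Measure ℝ) = _
    rw [FiniteMeasure.toMeasure_normalize_eq_of_nonzero _ (hne n)]
    change ((ν n).mass)⁻¹ • μ (n + N) = _
    congr 1
    rw [Real.toNNReal_inv]
    congr 1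
    exact NNReal.eq (by rw [Real.coe_toNNReal _ measureReal_nonneg]; rfl)
  have hPc : ∀ n t, charFun (P n : Measure ℝ) t = (((μ (n + N)).real univ : ℝ) : ℂ)⁻¹ * F (n + N) t := by
    intro n t
    rw [hP, charFun_apply, ← hμF, charFun_apply, integral_smul_nnreal_measure, NNReal.smul_def,
      Real.coe_toNNReal _ (inv_nonneg.2 measureReal_nonneg), Complex.real_smul]
    push_cast; rfl
  have hPlim : ∀ t, Tendsto (fun n => charFun (P n : Measure ℝ) t) atTop
      (𝓝 (((f 0).re : ℂ)⁻¹ * f t)) := fun t => by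
    simp_rw [hPc]
    refine Tendsto.mul ?_ ((hlim t).comp (tendsto_add_atTop_nat N))
    exact ((Complex.continuous_ofReal.tendsto _).comp
      (hmass.comp (tendsto_add_atTop_nat N))).inv₀ (by exact_mod_cast hpos.ne')
  have ht : IsTightMeasureSet (range fun n => (P n : Measure ℝ)) :=
    isTightMeasureSet_of_tendsto_charFun (f := fun t => ((f 0).re : ℂ)⁻¹ * f t)
      (continuousAt_const.mul hf) hPlim
  have hcomp : IsCompact (closure (range P)) := by
    refine isCompact_closure_of_isTightMeasureSet ?_
    convert! ht
    ext; simp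
  obtain ⟨Q, -, φ, hφ, hQ⟩ := hcomp.tendsto_subseq (fun n => subset_closure (mem_range_self n))
  have hQc : ∀ t, charFun (Q : Measure ℝ) t = ((f 0).re : ℂ)⁻¹ * f t := fun t =>
    tendsto_nhds_unique (ProbabilityMeasure.tendsto_iff_tendsto_charFun.1 hQ t)
      ((hPlim t).comp hφ.tendsto_atTop)
  refine ⟨((f 0).re).toNNReal • (Q : Measure ℝ), inferInstance, ?_⟩
  ext t
  rw [charFun_apply, integral_smul_nnreal_measure, ← charFun_apply, hQc, NNReal.smul_def,
    Real.coe_toNNReal _ hnn, Complex.real_smul, mul_inv_cancel_left₀ (by exact_mod_cast hpos.ne')]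

/-! ### Approximation of `|θ|^α` by symbols of jump processes -/

theorem charFun_dirac_add_dirac_neg (h θ : ℝ) :
    charFun (Measure.dirac h + Measure.dirac (-h)) θ = ((2 * Real.cos (h * θ) : ℝ) : ℂ) := by
  have h1 : ∀ a : ℝ, Integrable (fun x : ℝ => Complex.exp (θ * x * Complex.I)) (Measure.dirac a) :=
    fun a => Integrable.of_bound (by fun_prop) 1
      (ae_of_all _ fun x => by
        rw [← Complex.ofReal_mul, Complex.norm_exp_ofReal_mul_I])
  rw [charFun_apply_real, integral_add_measure (h1 _) (h1 _), integral_dirac, integral_dirac]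
  push_cast
  rw [Complex.two_cos]
  congr 2 <;> ring

/-- At the origin `1 - cos y = O(y²)` and `α < 2` suffice; at infinity the cosine is bounded and `α
> 0` suffices. -/
theorem integrableOn_one_sub_cos_mul_rpow {α : ℝ} (h0 : 0 < α) (h2 : α < 2) :
    IntegrableOn (fun y : ℝ => (1 - Real.cos y) * y ^ (-1 - α)) (Ioi 0) := by
  have hm : Measurable (fun y : ℝ => (1 - Real.cos y) * y ^ (-1 - α)) := by fun_prop
  rw [← Ioc_union_Ioi_eq_Ioi zero_le_one]
  refine IntegrableOn.union ?_ ?_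
  · have : IntegrableOn (fun y : ℝ => y ^ (1 - α)) (Ioc 0 1) := by
      have := intervalIntegral.intervalIntegrable_rpow' (a := 0) (b := 1) (r := 1 - α) (by linarith)
      exact (intervalIntegrable_iff_integrableOn_Ioc_of_le zero_le_one).1 this
    refine Integrable.mono' this hm.aestronglyMeasurable ?_
    refine ae_restrict_of_forall_mem measurableSet_Ioc fun y hy => ?_
    have hy0 : 0 < y := hy.1
    rw [Real.norm_of_nonneg (mul_nonneg (by linarith [Real.cos_le_one y]) (by positivity))]
    have e : y ^ (1 - α) = y ^ 2 * y ^ (-1 - α) := by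
      rw [← Real.rpow_natCast, ← Real.rpow_add hy0]; congr 1; push_cast; ring
    rw [e]
    gcongr
    have := Real.one_sub_sq_div_two_le_cos (x := y)
    nlinarith
  · have : IntegrableOn (fun y : ℝ => 2 * y ^ (-1 - α)) (Ioi 1) :=
      (integrableOn_Ioi_rpow_of_lt (by linarith) one_pos).const_mul 2
    refine Integrable.mono' this hm.aestronglyMeasurable ?_
    refine ae_restrict_of_forall_mem measurableSet_Ioi fun y hy => ?_
    have hy0 : (0 : ℝ) < y := one_pos.trans hy
    rw [Real.norm_of_nonneg (mul_nonneg (by linarith [Real.cos_le_one y]) (by positivity))]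
    gcongr
    linarith [Real.neg_one_le_cos y]

theorem integral_one_sub_cos_mul_rpow_pos {α : ℝ} (h0 : 0 < α) (h2 : α < 2) :
    0 < ∫ y in Ioi (0 : ℝ), (1 - Real.cos y) * y ^ (-1 - α) := by
  rw [setIntegral_pos_iff_support_of_nonneg_ae]
  · have : Ioo (0 : ℝ) 1 ⊆ Function.support (fun y : ℝ => (1 - Real.cos y) * y ^ (-1 - α)) ∩ Ioi 0 := by
      intro y hy
      refine ⟨?_, hy.1⟩
      have hpi := Real.pi_gt_three
      have h1 : Real.cos y < 1 := by
        have := Real.cos_lt_cos_of_nonneg_of_le_pi le_rfl (by linarith [hy.2]) hy.1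
        simpa using this
      have : 0 < (1 - Real.cos y) * y ^ (-1 - α) :=
        mul_pos (by linarith) (Real.rpow_pos_of_pos hy.1 _)
      exact this.ne'
    refine lt_of_lt_of_le ?_ (measure_mono this)
    simp
  · refine ae_restrict_of_forall_mem measurableSet_Ioi fun y hy => ?_
    exact mul_nonneg (by linarith [Real.cos_le_one y]) (Real.rpow_nonneg (le_of_lt hy) _)
  · exact integrableOn_one_sub_cos_mul_rpow h0 h2

theorem one_sub_cos_mul_rpow_scale (α : ℝ) {θ y : ℝ} (hθ : 0 < θ) (hy : 0 < y) :
    (1 - Real.cos (θ * y)) * y ^ (-1 - α) =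
      θ ^ (1 + α) * ((1 - Real.cos (θ * y)) * (θ * y) ^ (-1 - α)) := by
  rw [Real.mul_rpow hθ.le hy.le]
  have : θ ^ (1 + α) * θ ^ (-1 - α) = 1 := by
    rw [← Real.rpow_add hθ]; ring_nf; simp
  linear_combination (-(1 - Real.cos (θ * y)) * y ^ (-1 - α)) * this

/-- The substitution `y ↦ θy` is the Lévy–Khintchine formula for the symmetric stable law: `|θ|^α`
is an average of `1 - cos(θy)`. -/
theorem integral_one_sub_cos_mul_rpow_scale {α : ℝ} {θ : ℝ} (hθ : 0 < θ) :
    ∫ y in Ioi (0 : ℝ), (1 - Real.cos (θ * y)) * y ^ (-1 - α) =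
      θ ^ α * ∫ y in Ioi (0 : ℝ), (1 - Real.cos y) * y ^ (-1 - α) := by
  have := integral_comp_mul_left_Ioi (fun y : ℝ => (1 - Real.cos y) * y ^ (-1 - α)) 0 hθ
  rw [setIntegral_congr_fun measurableSet_Ioi
    (fun y hy => one_sub_cos_mul_rpow_scale α hθ hy), integral_const_mul, this, mul_zero,
    smul_eq_mul, ← mul_assoc]
  congr 1
  rw [Real.rpow_add hθ, Real.rpow_one]
  field_simp

theorem integrableOn_one_sub_cos_mul_rpow_scale {α : ℝ} (h0 : 0 < α) (h2 : α < 2) {θ : ℝ}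
    (hθ : 0 < θ) :
    IntegrableOn (fun y : ℝ => (1 - Real.cos (θ * y)) * y ^ (-1 - α)) (Ioi 0) := by
  have h := (integrableOn_Ioi_comp_mul_left_iff
    (fun y : ℝ => (1 - Real.cos y) * y ^ (-1 - α)) 0 hθ).2
    (by simpa using integrableOn_one_sub_cos_mul_rpow h0 h2)
  exact IntegrableOn.congr_fun (h.const_mul (θ ^ (1 + α)))
    (fun y hy => (one_sub_cos_mul_rpow_scale α hθ hy).symm) measurableSet_Ioi

theorem norm_integral_one_sub_cos_near_zero {α : ℝ} (h2 : α < 2) (θ : ℝ) {δ : ℝ} (hδ : 0 < δ) :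
    |∫ y in Ioc 0 δ, (1 - Real.cos (θ * y)) * y ^ (-1 - α)| ≤ θ ^ 2 * (δ ^ (2 - α) / (2 - α)) := by
  have hi : IntervalIntegrable (fun y : ℝ => θ ^ 2 * y ^ (1 - α)) volume 0 δ :=
    (intervalIntegral.intervalIntegrable_rpow' (by linarith)).const_mul _
  have hv : ∫ y in Ioc 0 δ, θ ^ 2 * y ^ (1 - α) = θ ^ 2 * (δ ^ (2 - α) / (2 - α)) := by
    rw [← intervalIntegral.integral_of_le hδ.le, intervalIntegral.integral_const_mul,
      integral_rpow (Or.inl (by linarith)), Real.zero_rpow (by linarith)]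
    ring_nf
  rw [← hv, ← Real.norm_eq_abs]
  refine norm_integral_le_of_norm_le
    ((intervalIntegrable_iff_integrableOn_Ioc_of_le hδ.le).1 hi) ?_
  refine ae_restrict_of_forall_mem measurableSet_Ioc fun y hy => ?_
  have hy0 : 0 < y := hy.1
  rw [Real.norm_of_nonneg (mul_nonneg (by linarith [Real.cos_le_one (θ * y)]) (by positivity))]
  have e : y ^ (1 - α) = y ^ 2 * y ^ (-1 - α) := by
    rw [← Real.rpow_natCast, ← Real.rpow_add hy0]; congr 1; push_cast; ring
  rw [e, ← mul_assoc]
  gcongr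
  have := Real.one_sub_sq_div_two_le_cos (x := θ * y)
  nlinarith [sq_nonneg (θ * y)]

/-- The measure is `c|y|^{-1-α} dy` restricted to `|y| > δ`. Removing the small jumps makes it
finite, and symmetry turns exponentials into cosines. -/
theorem exists_symm_charFun_rpow (α : ℝ) (h0 : 0 < α) {c δ : ℝ} (hc : 0 < c) (hδ : 0 < δ) :
    ∃ m : Measure ℝ, IsFiniteMeasure m ∧
      ∀ θ, ((m.real univ : ℝ) : ℂ) - charFun m θ =
        ((2 * c * ∫ y in Ioi δ, (1 - Real.cos (θ * y)) * y ^ (-1 - α) : ℝ) : ℂ) := by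
  have hi : IntegrableOn (fun y : ℝ => y ^ (-1 - α)) (Ioi δ) :=
    integrableOn_Ioi_rpow_of_lt (by linarith) hδ
  let p : ℝ → ℝ := fun y => c * y ^ (-1 - α)
  have hpi : IntegrableOn p (Ioi δ) := hi.const_mul c
  have hp : ∀ y ∈ Ioi δ, 0 ≤ p y := fun y hy => by
    have : 0 < y := hδ.trans hy
    positivity
  let m₁ : Measure ℝ := (volume.restrict (Ioi δ)).withDensity fun y => ENNReal.ofReal (p y)
  have hm₁ : IsFiniteMeasure m₁ := isFiniteMeasure_withDensity_ofReal hpi.2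
  have hch : ∀ r : ℝ, charFun m₁ r = ∫ y in Ioi δ, (p y : ℂ) * Complex.exp (r * y * Complex.I) := by
    intro r
    rw [charFun_apply_real, integral_withDensity_eq_integral_toReal_smul (by fun_prop)
      (ae_of_all _ fun _ => by simp)]
    refine setIntegral_congr_fun measurableSet_Ioi fun y hy => ?_
    simp only [ENNReal.toReal_ofReal (hp y hy), Complex.real_smul]
  have hint : ∀ r : ℝ, IntegrableOn (fun y => (p y : ℂ) * Complex.exp (r * y * Complex.I)) (Ioi δ) := by
    intro r
    have h1 : IntegrableOn (fun y => (p y : ℂ)) (Ioi δ) := hpi.ofReal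
    refine h1.mul_bdd (c := 1) (by fun_prop) (ae_of_all _ fun y => ?_)
    rw [← Complex.ofReal_mul, Complex.norm_exp_ofReal_mul_I]
  refine ⟨m₁ + m₁.map (fun x => (-1) * x), inferInstance, fun θ => ?_⟩
  have hsum : ∀ r, charFun (m₁ + m₁.map (fun x => (-1) * x)) r = charFun m₁ r + charFun m₁ (-r) := by
    intro r
    have hI : ∀ (μ : Measure ℝ) [IsFiniteMeasure μ],
        Integrable (fun x : ℝ => Complex.exp (r * x * Complex.I)) μ := fun μ _ =>
      Integrable.of_bound (by fun_prop) 1 (ae_of_all _ fun x => by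
        rw [← Complex.ofReal_mul, Complex.norm_exp_ofReal_mul_I])
    rw [charFun_apply_real, integral_add_measure (hI _) (hI _), ← charFun_apply_real,
      ← charFun_apply_real, charFun_map_mul]
    simp
  have hadd : ∀ r : ℝ, IntegrableOn (fun y => (p y : ℂ) * Complex.exp (r * y * Complex.I) +
      (p y : ℂ) * Complex.exp ((-r : ℝ) * y * Complex.I)) (Ioi δ) := fun r => (hint r).add (hint (-r))
  rw [← charFun_zero, hsum, hsum, hch, hch, hch, hch, ← integral_add (hint _) (hint _),
    ← integral_add (hint _) (hint _), ← integral_sub (hadd _) (hadd _), ← integral_const_mul, ← integral_complex_ofReal]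
  refine setIntegral_congr_fun measurableSet_Ioi fun y hy => ?_
  simp only [p]
  have : Complex.exp (θ * y * Complex.I) + Complex.exp ((-θ : ℝ) * y * Complex.I) =
      2 * Complex.cos (θ * y) := by
    rw [Complex.two_cos]; congr 2; push_cast; ring
  push_cast at this ⊢
  simp only [neg_zero, zero_mul, Complex.exp_zero]
  linear_combination (-(c : ℂ) * (y ^ (-1 - α) : ℝ)) * this

/-- The symbol `|θ|^α`, `0 ≤ α ≤ 2`, is approximated on compact sets by the symbols `k - m̂(θ)` of
(killed) compound Poisson processes. -/
theorem exists_charFun_approx_abs_rpow {α : ℝ} (h0 : 0 ≤ α) (h2 : α ≤ 2) {R ε : ℝ} (hR : 0 < R)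
    (hε : 0 < ε) :
    ∃ k : ℝ, ∃ m : Measure ℝ, IsFiniteMeasure m ∧ m.real univ ≤ k ∧
      ∀ θ, |θ| ≤ R → ‖(k : ℂ) - charFun m θ - ((|θ| ^ α : ℝ) : ℂ)‖ ≤ ε := by
  rcases h0.eq_or_lt with rfl | h0
  -- For `α = 0` the symbol is 1, also at `θ = 0`: pure killing without jumps.
  · refine ⟨1, 0, inferInstance, by simp, fun θ _ => ?_⟩
    simp [hε.le]
  rcases h2.eq_or_lt with rfl | h2
  · obtain ⟨h, hh0, hhR, hhε⟩ : ∃ h : ℝ, 0 < h ∧ h * R ≤ 1 ∧ h ^ 2 * R ^ 4 ≤ ε := by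
      have t1 : Tendsto (fun h : ℝ => h * R) (𝓝[>] 0) (𝓝 0) := by
        have : Tendsto (fun h : ℝ => h * R) (𝓝 0) (𝓝 (0 * R)) := (continuous_mul_const R).tendsto 0
        rw [zero_mul] at this
        exact this.mono_left nhdsWithin_le_nhds
      have t2 : Tendsto (fun h : ℝ => h ^ 2 * R ^ 4) (𝓝[>] 0) (𝓝 0) := by
        have : Tendsto (fun h : ℝ => h ^ 2 * R ^ 4) (𝓝 0) (𝓝 (0 ^ 2 * R ^ 4)) :=
          (by fun_prop : Continuous (fun h : ℝ => h ^ 2 * R ^ 4)).tendsto 0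
        simp only [ne_eq, OfNat.ofNat_ne_zero, not_false_eq_true, zero_pow, zero_mul] at this
        exact this.mono_left nhdsWithin_le_nhds
      obtain ⟨h, ⟨a, b⟩, c⟩ := ((t1.eventually (ge_mem_nhds one_pos)).and
        (t2.eventually (ge_mem_nhds hε))).and self_mem_nhdsWithin |>.exists
      exact ⟨h, c, a, b⟩
    have hc : (0 : ℝ) ≤ 1 / h ^ 2 := by positivity
    -- For `α = 2`, jumps to `±h` form the centred second difference. Its error is of fourth order
    -- in `hθ` after division by `h²`, which explains the condition on `h ^ 2 * R ^ 4`.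
    refine ⟨2 / h ^ 2, (Real.toNNReal (1 / h ^ 2)) • (Measure.dirac h + Measure.dirac (-h)),
      inferInstance, ?_, fun θ hθ => ?_⟩
    · rw [measureReal_nnreal_smul_apply, Real.coe_toNNReal _ hc]
      have : (Measure.dirac h + Measure.dirac (-h) : Measure ℝ).real univ = 2 := by
        rw [measureReal_add_apply]; simp; norm_num
      rw [this]
      apply le_of_eq; ring
    · rw [charFun_apply, integral_smul_nnreal_measure, ← charFun_apply,
        charFun_dirac_add_dirac_neg, NNReal.smul_def, Real.coe_toNNReal _ hc, Complex.real_smul,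
        ← Complex.ofReal_mul, ← Complex.ofReal_sub, ← Complex.ofReal_sub, Complex.norm_real,
        Real.norm_eq_abs]
      have hx : |h * θ| ≤ 1 := by
        rw [abs_mul, abs_of_pos hh0]
        exact (mul_le_mul_of_nonneg_left hθ hh0.le).trans hhR
      have hcos := Real.cos_bound hx
      have e : 2 / h ^ 2 - 1 / h ^ 2 * (2 * Real.cos (h * θ)) - |θ| ^ (2 : ℝ) =
          (-2 / h ^ 2) * (Real.cos (h * θ) - (1 - (h * θ) ^ 2 / 2)) := by
        rw [Real.rpow_two, sq_abs]
        field_simp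
        ring
      rw [e, abs_mul]
      have h3 : |-2 / h ^ 2| = 2 / h ^ 2 := by
        rw [neg_div, abs_neg, abs_of_pos (by positivity)]
      rw [h3]
      have hθ4 : |h * θ| ^ 4 ≤ (h * R) ^ 4 := by
        rw [abs_mul, abs_of_pos hh0]; gcongr
      calc _ ≤ 2 / h ^ 2 * ((h * R) ^ 4 * (5 / 96)) := by
            gcongr
            exact hcos.trans (by gcongr)
        _ = (5 / 48) * (h ^ 2 * R ^ 4) := by field_simp; norm_num
        _ ≤ ε := by nlinarith [show 0 ≤ h ^ 2 * R ^ 4 by positivity]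
  · set c₀ := ∫ y in Ioi (0 : ℝ), (1 - Real.cos y) * y ^ (-1 - α) with hc₀
    have hc₀pos : 0 < c₀ := integral_one_sub_cos_mul_rpow_pos h0 h2
    obtain ⟨δ, hδ, hδε⟩ : ∃ δ : ℝ, 0 < δ ∧ R ^ 2 * (δ ^ (2 - α) / (2 - α)) / c₀ ≤ ε := by
      have t1 : Tendsto (fun δ : ℝ => R ^ 2 * (δ ^ (2 - α) / (2 - α)) / c₀) (𝓝[>] 0) (𝓝 0) := by
        have hcont : Continuous (fun δ : ℝ => R ^ 2 * (δ ^ (2 - α) / (2 - α)) / c₀) := by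
          have := Real.continuous_rpow_const (q := 2 - α) (by linarith)
          fun_prop
        have := hcont.tendsto 0
        rw [Real.zero_rpow (by linarith)] at this
        simp only [zero_div, mul_zero] at this
        exact this.mono_left nhdsWithin_le_nhds
      obtain ⟨δ, a, b⟩ := ((t1.eventually (ge_mem_nhds hε)).and self_mem_nhdsWithin).exists
      exact ⟨δ, b, a⟩
    -- The factor `1 / (2 * c₀)` normalizes the untruncated symbol to `|θ|^α`; the error is then the
    -- contribution of the removed jumps `|y| ≤ δ`.
    obtain ⟨m, hm, hmθ⟩ := exists_symm_charFun_rpow α h0 (c := 1 / (2 * c₀)) (by positivity) hδ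
    refine ⟨m.real univ, m, hm, le_rfl, fun θ hθ => ?_⟩
    rw [hmθ, ← Complex.ofReal_sub, Complex.norm_real, Real.norm_eq_abs]
    rcases eq_or_ne θ 0 with rfl | hne
    · simp [Real.zero_rpow h0.ne', hε.le]
    have hθ0 : 0 < |θ| := abs_pos.2 hne
    have hcos : ∀ y, Real.cos (θ * y) = Real.cos (|θ| * y) := fun y => by
      rcases abs_choice θ with h | h <;> rw [h]
      rw [neg_mul, Real.cos_neg]
    simp_rw [hcos]
    have hI := integrableOn_one_sub_cos_mul_rpow_scale h0 h2 hθ0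
    have hsplit : ∫ y in Ioi (0 : ℝ), (1 - Real.cos (|θ| * y)) * y ^ (-1 - α) =
        (∫ y in Ioc 0 δ, (1 - Real.cos (|θ| * y)) * y ^ (-1 - α)) +
        ∫ y in Ioi δ, (1 - Real.cos (|θ| * y)) * y ^ (-1 - α) := by
      rw [← Ioc_union_Ioi_eq_Ioi hδ.le]
      exact setIntegral_union (Ioc_disjoint_Ioi le_rfl) measurableSet_Ioi
        (hI.mono_set Ioc_subset_Ioi_self) (hI.mono_set (Ioi_subset_Ioi hδ.le))
    have hsc := integral_one_sub_cos_mul_rpow_scale (α := α) hθ0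
    rw [← hc₀, hsplit] at hsc
    have e : 2 * (1 / (2 * c₀)) * (∫ y in Ioi δ, (1 - Real.cos (|θ| * y)) * y ^ (-1 - α)) - |θ| ^ α =
        -(∫ y in Ioc 0 δ, (1 - Real.cos (|θ| * y)) * y ^ (-1 - α)) / c₀ := by
      field_simp
      linarith
    rw [e, abs_div, abs_neg, abs_of_pos hc₀pos]
    refine le_trans ?_ hδε
    gcongr
    refine (norm_integral_one_sub_cos_near_zero h2 |θ| hδ).trans ?_
    have : 0 < 2 - α := by linarith
    gcongr

/-! ### Half-line Laplace transforms -/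

theorem integral_mul_charFun {μ : Measure ℝ} [IsFiniteMeasure μ] {lam : Measure ℝ} [SFinite lam]
    {g : ℝ → ℂ} (hg : Integrable g lam) :
    ∫ θ, g θ * charFun μ θ ∂lam = ∫ s, ∫ θ, g θ * Complex.exp (θ * s * Complex.I) ∂lam ∂μ := by
  have hi : Integrable (Function.uncurry fun (θ s : ℝ) => g θ * Complex.exp (θ * s * Complex.I))
      (lam.prod μ) := by
    have h1 : Integrable (fun z : ℝ × ℝ => g z.1 * (1 : ℂ)) (lam.prod μ) :=
      hg.mul_prod (integrable_const _)
    have h2 := h1.mul_bdd (c := 1) (g := fun z : ℝ × ℝ => Complex.exp (z.1 * z.2 * Complex.I))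
      (by fun_prop)
      (ae_of_all _ fun z => by rw [← Complex.ofReal_mul, Complex.norm_exp_ofReal_mul_I])
    refine h2.congr (ae_of_all _ fun z => ?_)
    simp [Function.uncurry]
  rw [← integral_integral_swap hi]
  simp_rw [charFun_apply_real, integral_const_mul]

theorem integrable_integral_mul_exp {μ : Measure ℝ} [IsFiniteMeasure μ] {lam : Measure ℝ} [SFinite lam]
    {g : ℝ → ℂ} (hg : Integrable g lam) :
    Integrable (fun s : ℝ => ∫ θ, g θ * Complex.exp (θ * s * Complex.I) ∂lam) μ := by
  refine Integrable.of_bound (C := ∫ θ, ‖g θ‖ ∂lam) ?_ (ae_of_all _ fun s => ?_)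
  · have hm : AEStronglyMeasurable (fun z : ℝ × ℝ => g z.2 * Complex.exp (z.2 * z.1 * Complex.I))
        (μ.prod lam) :=
      (hg.aestronglyMeasurable.comp_snd).mul (by fun_prop)
    exact hm.integral_prod_right'
  · refine norm_integral_le_of_norm_le hg.norm (ae_of_all _ fun θ => ?_)
    rw [norm_mul, ← Complex.ofReal_mul, Complex.norm_exp_ofReal_mul_I, mul_one]

theorem integrableOn_pow_mul_exp_neg (n : ℕ) {δ : ℝ} (hδ : 0 < δ) :
    IntegrableOn (fun x : ℝ => x ^ n * Real.exp (-δ * x)) (Ioi 0) := by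
  have := integrableOn_rpow_mul_exp_neg_mul_rpow (p := 1) (s := n) (b := δ)
    (by have : (0 : ℝ) ≤ n := n.cast_nonneg
        linarith) one_pos hδ
  simpa using this

theorem tendsto_pow_mul_cexp_neg (n : ℕ) {z : ℂ} (hz : 0 < z.re) :
    Tendsto (fun θ : ℝ => (θ : ℂ) ^ n * Complex.exp (-z * θ)) atTop (𝓝 0) := by
  rw [tendsto_zero_iff_norm_tendsto_zero]
  have h := tendsto_rpow_mul_exp_neg_mul_atTop_nhds_zero n z.re hz
  refine h.congr' ?_
  filter_upwards [eventually_ge_atTop 0] with θ hθ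
  rw [norm_mul, norm_pow, Complex.norm_real, Real.norm_of_nonneg hθ, Complex.norm_exp,
    Real.rpow_natCast]
  simp

theorem integrableOn_quadratic_mul_cexp_neg (a b c : ℂ) {z : ℂ} (hz : 0 < z.re) :
    IntegrableOn (fun θ : ℝ => (a + b * θ + c * θ ^ 2) * Complex.exp (-z * θ)) (Ioi 0) := by
  have h : ∀ n : ℕ, IntegrableOn (fun θ : ℝ => (θ : ℂ) ^ n * Complex.exp (-z * θ)) (Ioi 0) := by
    intro n
    refine Integrable.mono' (integrableOn_pow_mul_exp_neg n hz) (by fun_prop) ?_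
    refine ae_restrict_of_forall_mem measurableSet_Ioi fun θ hθ => ?_
    rw [norm_mul, norm_pow, Complex.norm_real, Real.norm_of_nonneg (le_of_lt hθ), Complex.norm_exp]
    simp
  have := (((h 0).const_mul a).add ((h 1).const_mul b)).add ((h 2).const_mul c)
  refine IntegrableOn.congr_fun this (fun θ _ => ?_) measurableSet_Ioi
  simp; ring

/-- An explicit antiderivative decays at infinity. Degree two covers the weights `1`, `1 + δθ` and
`θ(1 + δθ)` of the mollified equation. -/
theorem integral_quadratic_mul_cexp_neg (a b c : ℂ) {z : ℂ} (hz : 0 < z.re) :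
    ∫ θ in Ioi (0 : ℝ), (a + b * θ + c * θ ^ 2) * Complex.exp (-z * θ) =
      a / z + b / z ^ 2 + 2 * c / z ^ 3 := by
  have hz0 : z ≠ 0 := fun h => by simp [h] at hz
  have hderiv : ∀ θ ∈ Ici (0 : ℝ), HasDerivAt (fun θ : ℝ => -((a + b * θ + c * θ ^ 2) / z +
      (b + 2 * c * θ) / z ^ 2 + 2 * c / z ^ 3) * Complex.exp (-z * θ))
      ((a + b * θ + c * θ ^ 2) * Complex.exp (-z * θ)) θ := by
    intro θ _
    have h1 : HasDerivAt (fun w : ℂ => -((a + b * w + c * w ^ 2) / z +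
      (b + 2 * c * w) / z ^ 2 + 2 * c / z ^ 3) * Complex.exp (-z * w))
      ((a + b * θ + c * θ ^ 2) * Complex.exp (-z * θ)) (θ : ℂ) := by
      have hp : HasDerivAt (fun w : ℂ => -((a + b * w + c * w ^ 2) / z +
          (b + 2 * c * w) / z ^ 2 + 2 * c / z ^ 3))
          (-((b + c * (2 * θ)) / z + 2 * c / z ^ 2)) (θ : ℂ) := by
        have i1 := (hasDerivAt_id (θ : ℂ)).const_mul b
        have i2 := ((hasDerivAt_id (θ : ℂ)).pow 2).const_mul c
        have i3 := (hasDerivAt_id (θ : ℂ)).const_mul (2 * c)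
        have := (((((i1.const_add a).add i2).div_const z).add
          ((i3.const_add b).div_const (z ^ 2))).add_const (2 * c / z ^ 3)).neg
        convert! this using 1
        simp
      have he : HasDerivAt (fun w : ℂ => Complex.exp (-z * w)) (Complex.exp (-z * θ) * (-z)) (θ : ℂ) := by
        have := ((hasDerivAt_id (θ : ℂ)).const_mul (-z)).cexp
        simpa using this
      refine (hp.mul he).congr_deriv ?_
      field_simp
      ring
    exact h1.comp_ofReal
  have hlim : Tendsto (fun θ : ℝ => -((a + b * θ + c * θ ^ 2) / z +
      (b + 2 * c * θ) / z ^ 2 + 2 * c / z ^ 3) * Complex.exp (-z * θ)) atTop (𝓝 0) := by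
    have t := ((((tendsto_pow_mul_cexp_neg 0 hz).const_mul (-(a / z + b / z ^ 2 + 2 * c / z ^ 3))).add
      ((tendsto_pow_mul_cexp_neg 1 hz).const_mul (-(b / z + 2 * c / z ^ 2)))).add
      ((tendsto_pow_mul_cexp_neg 2 hz).const_mul (-(c / z))))
    simp only [mul_zero, add_zero] at t
    refine t.congr fun θ => ?_
    ring
  have := integral_Ioi_of_hasDerivAt_of_tendsto' hderiv
    (integrableOn_quadratic_mul_cexp_neg a b c hz) hlim
  rw [this]
  simp

/-! ### The mollified nonlinearity and its domination by a jump term -/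

/-- For `z` in the right half-plane the Laplace transforms of `1 + δ θ` and `θ (1 + δ θ)` satisfy
a Harnack type inequality. -/
theorem harnack_laplace {δ η M κ y : ℝ} (hδ : 0 < δ) (hη : 0 < η) (hM : 0 ≤ M)
    (hκ : κ = 7 * M / (2 * Real.pi * η * δ)) {B : ℂ} (hB : 0 ≤ B.re) (hBn : ‖B‖ ≤ M / η) :
    0 ≤ ((κ : ℂ) * (1 / ((δ : ℂ) + y * Complex.I) + δ / ((δ : ℂ) + y * Complex.I) ^ 2) -
      (1 / Real.pi : ℝ) * ((1 / ((δ : ℂ) + y * Complex.I) ^ 2 +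
        2 * δ / ((δ : ℂ) + y * Complex.I) ^ 3) * B)).re := by
  set n : ℝ := δ ^ 2 + y ^ 2 with hn
  have hn0 : 0 < n := by positivity
  set w : ℂ := ⟨δ / n, -y / n⟩ with hw
  set z : ℂ := (δ : ℂ) + y * Complex.I with hz
  have hwz : w * z = 1 := by
    apply Complex.ext
    · simp [hw, hz]; field_simp; linarith
    · simp [hw, hz]; field_simp; ring
  have hz0 : z ≠ 0 := right_ne_zero_of_mul_eq_one hwz
  have hwi : w = 1 / z := by field_simp; exact hwz
  have e1 : 1 / z + δ / z ^ 2 = w + δ * w ^ 2 := by rw [hwi]; field_simp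
  have e2 : 1 / z ^ 2 + 2 * δ / z ^ 3 = w ^ 2 + 2 * δ * w ^ 3 := by rw [hwi]; field_simp
  rw [e1, e2]
  obtain ⟨p, q⟩ := B
  have hq : |q| ≤ M / η := (Complex.abs_im_le_norm ⟨p, q⟩).trans hBn
  have hp : |p| ≤ M / η := (Complex.abs_re_le_norm ⟨p, q⟩).trans hBn
  have hp0 : 0 ≤ p := hB
  have rA : (w + δ * w ^ 2).re = 2 * δ ^ 3 / n ^ 2 := by
    simp [hw, pow_succ]
    field_simp
    rw [hn]; ring
  have rC : (w ^ 2 + 2 * δ * w ^ 3).re = (3 * δ ^ 4 - 6 * δ ^ 2 * y ^ 2 - y ^ 4) / n ^ 3 := by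
    simp [hw, pow_succ]
    field_simp
    rw [hn]; ring
  have iC : (w ^ 2 + 2 * δ * w ^ 3).im = -8 * δ ^ 3 * y / n ^ 3 := by
    simp [hw, pow_succ]
    field_simp
    rw [hn]; ring
  -- The jump term has size `n⁻²`, whereas `-y⁴/n³` decays only like `n⁻¹`. That slow part is
  -- multiplied by `p = Re B ≥ 0` and has the favourable sign, so it is discarded. What remains is
  -- bounded by `3δ²n` for the real part and `4δ²n` for the imaginary part, whence the constant 7.
  have key : (3 * δ ^ 4 - 6 * δ ^ 2 * y ^ 2 - y ^ 4) / n ^ 3 * p - (-8 * δ ^ 3 * y / n ^ 3) * q ≤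
      7 * δ ^ 2 * (M / η) / n ^ 2 := by
    have h1 : (3 * δ ^ 4 - 6 * δ ^ 2 * y ^ 2 - y ^ 4) * p ≤ 3 * δ ^ 2 * n * (M / η) := by
      have a1 : p ≤ M / η := (le_abs_self p).trans hp
      have a2 : (3 * δ ^ 4 - 6 * δ ^ 2 * y ^ 2 - y ^ 4) * p ≤ 3 * δ ^ 2 * n * p := by
        refine mul_le_mul_of_nonneg_right ?_ hp0
        rw [hn]; nlinarith [sq_nonneg (δ * y), sq_nonneg (y ^ 2)]
      exact a2.trans (mul_le_mul_of_nonneg_left a1 (by positivity))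
    have h2 : 8 * δ ^ 3 * y * q ≤ 4 * δ ^ 2 * n * (M / η) := by
      have a1 : 8 * δ ^ 3 * y * q ≤ 8 * δ ^ 3 * (|y| * |q|) := by
        have : y * q ≤ |y| * |q| := by rw [← abs_mul]; exact le_abs_self _
        nlinarith [pow_pos hδ 3]
      have a2 : 8 * δ ^ 3 * (|y| * |q|) ≤ 8 * δ ^ 3 * |y| * (M / η) := by
        rw [← mul_assoc]; gcongr
      have a3 : 8 * δ ^ 3 * |y| ≤ 4 * δ ^ 2 * n := by
        have : 2 * δ * |y| ≤ n := by rw [hn, ← sq_abs y]; nlinarith [sq_nonneg (δ - |y|)]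
        nlinarith [pow_pos hδ 2]
      have : 0 ≤ M / η := by positivity
      nlinarith
    have : (3 * δ ^ 4 - 6 * δ ^ 2 * y ^ 2 - y ^ 4) / n ^ 3 * p - (-8 * δ ^ 3 * y / n ^ 3) * q =
        ((3 * δ ^ 4 - 6 * δ ^ 2 * y ^ 2 - y ^ 4) * p + 8 * δ ^ 3 * y * q) / n ^ 3 := by
      field_simp; ring
    rw [this, div_le_div_iff₀ (by positivity) (by positivity)]
    have : ((3 * δ ^ 4 - 6 * δ ^ 2 * y ^ 2 - y ^ 4) * p + 8 * δ ^ 3 * y * q) ≤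
      7 * δ ^ 2 * n * (M / η) := by linarith
    calc _ ≤ (7 * δ ^ 2 * n * (M / η)) * n ^ 2 := by gcongr
      _ = _ := by ring
  have hpi := Real.pi_pos
  rw [Complex.sub_re, Complex.re_ofReal_mul, Complex.re_ofReal_mul, Complex.mul_re, rA, rC, iC]
  have hfin : κ * (2 * δ ^ 3 / n ^ 2) = 1 / Real.pi * (7 * δ ^ 2 * (M / η) / n ^ 2) := by
    rw [hκ]; field_simp
  rw [hfin, sub_nonneg]
  exact mul_le_mul_of_nonneg_left key (by positivity)

/-- The right-hand side of the equation `∂ₜF = …` satisfied by the characteristic functions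
`F(t, θ) = ∫ e^{iθx} ρ(t, x) dx` of a solution. -/
noncomputable def fourierField (ν α : ℝ) (F : ℝ → ℂ) (θ : ℝ) : ℂ :=
  -((θ ^ 2 / (2 * Real.pi) : ℝ) : ℂ) * (∫ s in (0 : ℝ)..1, F (s * θ) * F ((1 - s) * θ)) -
    ((ν * |θ| ^ α : ℝ) : ℂ) * F θ

/-- The Fourier transform of the density proportional to `(x² + δ²)⁻²`. -/
noncomputable def studentSymbol (δ θ : ℝ) : ℝ := (1 + δ * |θ|) * Real.exp (-δ * |θ|)

/-- The nonlinearity of `fourierField` with mollifiers inserted. -/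
noncomputable def regNonlin (δ η : ℝ) (F : ℝ → ℂ) (θ : ℝ) : ℂ :=
  -((θ ^ 2 / Real.pi : ℝ) : ℂ) * ∫ s in (0 : ℝ)..1,
    ((s * studentSymbol δ (s * θ) * Real.exp (-η * |(1 - s) * θ|) : ℝ) : ℂ) *
      (F (s * θ) * F ((1 - s) * θ))

theorem continuous_studentSymbol (δ : ℝ) : Continuous (studentSymbol δ) := by
  unfold studentSymbol; fun_prop

theorem studentSymbol_neg (δ θ : ℝ) : studentSymbol δ (-θ) = studentSymbol δ θ := by
  simp [studentSymbol]

theorem continuous_regNonlin (δ η : ℝ) {F : ℝ → ℂ} (hF : Continuous F) :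
    Continuous (regNonlin δ η F) := by
  unfold regNonlin
  have := continuous_studentSymbol δ
  refine Continuous.mul (by fun_prop) ?_
  refine intervalIntegral.continuous_parametric_intervalIntegral_of_continuous' ?_ _ _
  simp only [Function.uncurry_def]
  fun_prop

theorem regNonlin_neg (δ η : ℝ) {F : ℝ → ℂ} (hF : ∀ θ, F (-θ) = conj (F θ)) (θ : ℝ) :
    regNonlin δ η F (-θ) = conj (regNonlin δ η F θ) := by
  unfold regNonlin
  rw [map_mul, intervalIntegral.integral_of_le zero_le_one,
    intervalIntegral.integral_of_le zero_le_one, ← integral_conj]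
  congr 1
  · simp
  · refine integral_congr_ae (ae_of_all _ fun s => ?_)
    simp only [mul_neg, hF, studentSymbol_neg, abs_neg, map_mul, Complex.conj_ofReal]

/-- Since `δ ≤ η`, the decay rates `δ` on `sθ` and `η` on `(1-s)θ` combine to at least `δ` on `θ`;
this is what makes `regNonlin` integrable in `θ`. -/
theorem studentSymbol_mul_exp_le {δ η : ℝ} (hδ : 0 < δ) (hη : δ ≤ η) {s : ℝ} (hs : s ∈ Icc (0 : ℝ) 1)
    (θ : ℝ) : s * studentSymbol δ (s * θ) * Real.exp (-η * |(1 - s) * θ|) ≤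
      (1 + δ * |θ|) * Real.exp (-δ * |θ|) := by
  obtain ⟨h0, h1⟩ := hs
  have h1' : 0 ≤ 1 - s := by linarith
  rw [studentSymbol, abs_mul, abs_mul, abs_of_nonneg h0, abs_of_nonneg h1']
  have e1 : 1 + δ * (s * |θ|) ≤ 1 + δ * |θ| := by
    have : s * |θ| ≤ |θ| := mul_le_of_le_one_left (abs_nonneg _) h1
    gcongr
  have e2 : Real.exp (-δ * (s * |θ|)) * Real.exp (-η * ((1 - s) * |θ|)) ≤ Real.exp (-δ * |θ|) := by
    rw [← Real.exp_add]
    apply Real.exp_le_exp.2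
    have : 0 ≤ (1 - s) * |θ| := by positivity
    nlinarith
  calc s * ((1 + δ * (s * |θ|)) * Real.exp (-δ * (s * |θ|))) * Real.exp (-η * ((1 - s) * |θ|))
      = s * ((1 + δ * (s * |θ|)) * (Real.exp (-δ * (s * |θ|)) * Real.exp (-η * ((1 - s) * |θ|)))) := by
        ring
    _ ≤ 1 * ((1 + δ * |θ|) * Real.exp (-δ * |θ|)) := by gcongr
    _ = _ := one_mul _

theorem norm_regNonlin_le {δ η M : ℝ} (hδ : 0 < δ) (hη : δ ≤ η) {F : ℝ → ℂ}
    (hF : ∀ θ, ‖F θ‖ ≤ M) (θ : ℝ) :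
    ‖regNonlin δ η F θ‖ ≤ θ ^ 2 / Real.pi * ((1 + δ * |θ|) * Real.exp (-δ * |θ|) * M ^ 2) := by
  have hM : 0 ≤ M := (norm_nonneg _).trans (hF 0)
  have hpi := Real.pi_pos
  rw [regNonlin, norm_mul, norm_neg, Complex.norm_real, Real.norm_of_nonneg (by positivity)]
  gcongr
  have := intervalIntegral.norm_integral_le_of_norm_le_const (a := 0) (b := 1)
    (C := (1 + δ * |θ|) * Real.exp (-δ * |θ|) * M ^ 2)
    (f := fun s => ((s * studentSymbol δ (s * θ) * Real.exp (-η * |(1 - s) * θ|) : ℝ) : ℂ) *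
      (F (s * θ) * F ((1 - s) * θ))) ?_
  · simpa using this
  · intro s hs
    rw [uIoc_of_le zero_le_one] at hs
    have hs' : s ∈ Icc (0 : ℝ) 1 := ⟨hs.1.le, hs.2⟩
    rw [norm_mul, norm_mul, Complex.norm_real, Real.norm_of_nonneg]
    · refine mul_le_mul (studentSymbol_mul_exp_le hδ hη hs' θ) ?_ (by positivity) (by positivity)
      rw [pow_two]
      exact mul_le_mul (hF _) (hF _) (norm_nonneg _) hM
    · have := hs.1
      unfold studentSymbol
      positivity

/-- Hermitian symmetry reduces Fourier inversion to twice a real part over the positive half-line,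
where the absolute values in the mollifiers disappear. -/
theorem integral_of_hermitian {h : ℝ → ℂ} (hh : ∀ v, h (-v) = conj (h v))
    (hi : IntegrableOn h (Ioi 0)) :
    Integrable h ∧ ∫ v, h v = ((2 * (∫ v in Ioi 0, h v).re : ℝ) : ℂ) := by
  have hneg : IntegrableOn (fun v => h (-v)) (Ioi 0) := by
    simp_rw [hh]
    exact (Complex.conjLIE : ℂ ≃ₗᵢ[ℝ] ℂ).toContinuousLinearEquiv.toContinuousLinearMap.integrable_comp hi
  have hiic : IntegrableOn h (Iic 0) := by
    have := (IntegrableOn.comp_neg_Iio (c := 0) (f := fun v => h (-v)) (by simpa using hneg))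
    rw [integrableOn_Iic_iff_integrableOn_Iio]
    simpa using this
  have hInt : Integrable h := by
    rw [← integrableOn_univ, ← Iic_union_Ioi (a := (0 : ℝ))]
    exact hiic.union hi
  refine ⟨hInt, ?_⟩
  rw [← intervalIntegral.integral_Iic_add_Ioi hiic hi]
  have : ∫ v in Iic 0, h v = conj (∫ v in Ioi 0, h v) := by
    rw [← integral_conj, ← neg_zero, ← integral_comp_neg_Ioi]
    simp [hh]
  rw [this, add_comm, Complex.add_conj]

/-- With `b = sθ` one has `θ² s ds = b db`, and both the modulation and the mollifiers split between
`b` and `θ - b`. Thus the nonlinearity is a half-line convolution whose integral over `θ > 0`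
factorizes. The asymmetric weight `s` in `regNonlin` serves this factorization. -/
theorem cexp_mul_regNonlin {δ η : ℝ} (F : ℝ → ℂ) (X : ℝ) {θ : ℝ} (hθ : 0 < θ) :
    Complex.exp (-(θ * X * Complex.I)) * regNonlin δ η F θ =
      -((1 / Real.pi : ℝ) : ℂ) * ∫ b in (0 : ℝ)..θ,
        (((b * studentSymbol δ b : ℝ) : ℂ) * Complex.exp (-(b * X * Complex.I)) * F b) *
        (((Real.exp (-η * (θ - b)) : ℝ) : ℂ) * Complex.exp (-(((θ - b : ℝ) : ℂ) * X * Complex.I)) *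
          F (θ - b)) := by
  have hsub := intervalIntegral.integral_comp_mul_right (a := 0) (b := 1) (c := θ)
    (fun b : ℝ => (((b * studentSymbol δ b : ℝ) : ℂ) * Complex.exp (-(b * X * Complex.I)) * F b) *
        (((Real.exp (-η * (θ - b)) : ℝ) : ℂ) * Complex.exp (-(((θ - b : ℝ) : ℂ) * X * Complex.I)) *
          F (θ - b))) hθ.ne'
  rw [zero_mul, one_mul] at hsub
  have hsub' : ∫ b in (0 : ℝ)..θ,
        (((b * studentSymbol δ b : ℝ) : ℂ) * Complex.exp (-(b * X * Complex.I)) * F b) *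
        (((Real.exp (-η * (θ - b)) : ℝ) : ℂ) * Complex.exp (-(((θ - b : ℝ) : ℂ) * X * Complex.I)) *
          F (θ - b)) = (θ : ℂ) * ∫ x in (0 : ℝ)..1, (fun b : ℝ =>
          (((b * studentSymbol δ b : ℝ) : ℂ) * Complex.exp (-(b * X * Complex.I)) * F b) *
        (((Real.exp (-η * (θ - b)) : ℝ) : ℂ) * Complex.exp (-(((θ - b : ℝ) : ℂ) * X * Complex.I)) *
          F (θ - b))) (x * θ) := by
    rw [hsub, Complex.real_smul, ← mul_assoc, ← Complex.ofReal_mul, mul_inv_cancel₀ hθ.ne']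
    simp
  rw [hsub', regNonlin, ← intervalIntegral.integral_const_mul, ← intervalIntegral.integral_const_mul,
    ← intervalIntegral.integral_const_mul, ← intervalIntegral.integral_const_mul]
  refine intervalIntegral.integral_congr fun s hs => ?_
  rw [uIcc_of_le zero_le_one] at hs
  have h1 : 0 ≤ (1 - s) * θ := mul_nonneg (by linarith [hs.2]) hθ.le
  have h2 : θ - s * θ = (1 - s) * θ := by ring
  simp only [h2]
  rw [abs_of_nonneg h1]
  have h3 : Complex.exp (-(θ * X * Complex.I)) = Complex.exp (-(((s * θ : ℝ) : ℂ) * X * Complex.I)) *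
      Complex.exp (-((((1 - s) * θ : ℝ) : ℂ) * X * Complex.I)) := by
    rw [← Complex.exp_add]; congr 1; push_cast; ring
  rw [h3]
  push_cast
  ring

/-- A diffusive jump term dominates the mollified nonlinearity: the sum is a positive definite
function. -/
theorem exists_charFun_eq_student_add_regNonlin {μ : Measure ℝ} [IsFiniteMeasure μ] {M δ η κ : ℝ}
    (hM : μ.real univ ≤ M) (hδ : 0 < δ) (hη : δ ≤ η) (hκ : κ = 7 * M / (2 * Real.pi * η * δ)) :
    ∃ lam : Measure ℝ, IsFiniteMeasure lam ∧ charFun lam =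
      fun θ => ((κ * studentSymbol δ θ : ℝ) : ℂ) * charFun μ θ + regNonlin δ η (charFun μ) θ := by
  set F := charFun μ with hF
  have hη0 : 0 < η := hδ.trans_le hη
  have hpi := Real.pi_pos
  have hFc : Continuous F := continuous_charFun
  have hFb : ∀ θ, ‖F θ‖ ≤ M := fun θ => (norm_charFun_le θ).trans hM
  have hFh : ∀ θ, F (-θ) = conj (F θ) := fun θ => charFun_neg θ
  have hM0 : 0 ≤ M := measureReal_nonneg.trans hM
  have hκ0 : 0 ≤ κ := by rw [hκ]; positivity
  have hkc := continuous_studentSymbol δ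
  have hNc := continuous_regNonlin δ η hFc
  set G : ℝ → ℂ := fun θ => ((κ * studentSymbol δ θ : ℝ) : ℂ) * F θ + regNonlin δ η F θ with hG
  have hGc : Continuous G := by fun_prop
  have hGh : ∀ θ, G (-θ) = conj (G θ) := fun θ => by
    simp only [hG, map_add, map_mul, Complex.conj_ofReal, regNonlin_neg δ η hFh, hFh,
      studentSymbol_neg]
  have hGb : ∀ θ, ‖G θ‖ ≤ (κ * M + θ ^ 2 / Real.pi * M ^ 2) * ((1 + δ * |θ|) * Real.exp (-δ * |θ|)) := by
    intro θ
    have h1 := norm_regNonlin_le hδ hη hFb θ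
    have h2 : ‖((κ * studentSymbol δ θ : ℝ) : ℂ) * F θ‖ ≤ κ * ((1 + δ * |θ|) * Real.exp (-δ * |θ|)) * M := by
      have : 0 ≤ studentSymbol δ θ := by unfold studentSymbol; positivity
      rw [norm_mul, Complex.norm_real, Real.norm_of_nonneg (by positivity)]
      have h3 := hFb θ
      unfold studentSymbol
      gcongr
    refine (norm_add_le _ _).trans ((add_le_add h2 h1).trans (le_of_eq ?_))
    ring
  have hGiOn : IntegrableOn G (Ioi 0) := by
    have h := integrableOn_pow_mul_exp_neg (δ := δ)
    have hmaj : IntegrableOn (fun θ : ℝ => (κ * M) * (θ ^ 0 * Real.exp (-δ * θ)) +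
        (κ * M * δ) * (θ ^ 1 * Real.exp (-δ * θ)) + (M ^ 2 / Real.pi) * (θ ^ 2 * Real.exp (-δ * θ)) +
        (M ^ 2 / Real.pi * δ) * (θ ^ 3 * Real.exp (-δ * θ))) (Ioi 0) :=
      ((((h 0 hδ).const_mul _).add ((h 1 hδ).const_mul _)).add ((h 2 hδ).const_mul _)).add
        ((h 3 hδ).const_mul _)
    refine Integrable.mono' hmaj hGc.aestronglyMeasurable ?_
    refine ae_restrict_of_forall_mem measurableSet_Ioi fun θ hθ => ?_
    refine (hGb θ).trans (le_of_eq ?_)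
    rw [abs_of_pos hθ]
    ring
  have hGi : Integrable G := (integral_of_hermitian hGh hGiOn).1
  -- boundedness
  obtain ⟨C, hC⟩ : ∃ C, ∀ θ, ‖G θ‖ ≤ C := by
    have hcont : Continuous (fun θ : ℝ => (κ * M + θ ^ 2 / Real.pi * M ^ 2) *
      ((1 + δ * |θ|) * Real.exp (-δ * |θ|))) := by fun_prop
    have hlim : Tendsto (fun x : ℝ => (κ * M + x ^ 2 / Real.pi * M ^ 2) *
        ((1 + δ * x) * Real.exp (-δ * x))) atTop (𝓝 0) := by
      have t : ∀ n : ℕ, Tendsto (fun x : ℝ => x ^ n * Real.exp (-δ * x)) atTop (𝓝 0) := fun n => by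
        simpa using tendsto_rpow_mul_exp_neg_mul_atTop_nhds_zero n δ hδ
      have := ((((t 0).const_mul (κ * M)).add ((t 1).const_mul (κ * M * δ))).add
        ((t 2).const_mul (M ^ 2 / Real.pi))).add ((t 3).const_mul (M ^ 2 / Real.pi * δ))
      simp only [mul_zero, add_zero] at this
      refine this.congr fun x => ?_
      ring
    obtain ⟨A, hA⟩ := eventually_atTop.1 (hlim.eventually (ge_mem_nhds one_pos))
    obtain ⟨C, hC⟩ := (isCompact_Icc (a := -A) (b := A)).exists_bound_of_continuousOn hGc.continuousOn
    refine ⟨max C 1, fun θ => ?_⟩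
    by_cases h : |θ| ≤ A
    · exact (hC θ (abs_le.1 h)).trans (le_max_left _ _)
    · refine ((hGb θ).trans ?_).trans (le_max_right _ _)
      have := hA |θ| (not_le.1 h).le
      rwa [sq_abs] at this
  let D : ℝ → ℝ := fun x => 2 * (∫ v in Ioi (0 : ℝ),
    Complex.exp (-(v * (2 * Real.pi * x : ℝ) * Complex.I)) * G v).re
  have hFour : ∀ x, 𝓕 G x = D x := by
    intro x
    have hh : ∀ v : ℝ, Complex.exp (-(((-v : ℝ) : ℂ) * (2 * Real.pi * x : ℝ) * Complex.I)) * G (-v) =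
        conj (Complex.exp (-(v * (2 * Real.pi * x : ℝ) * Complex.I)) * G v) := by
      intro v
      rw [map_mul, ← Complex.exp_conj, hGh]
      simp [map_ofNat]
    have hi : IntegrableOn (fun v : ℝ => Complex.exp (-(v * (2 * Real.pi * x : ℝ) * Complex.I)) * G v)
        (Ioi 0) := by
      refine hGiOn.bdd_mul (c := 1) (by fun_prop) (ae_of_all _ fun v => ?_)
      rw [show -((v : ℂ) * (2 * Real.pi * x : ℝ) * Complex.I) =
        ((-(v * (2 * Real.pi * x)) : ℝ) : ℂ) * Complex.I by push_cast; ring,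
        Complex.norm_exp_ofReal_mul_I]
    rw [Real.fourier_real_eq_integral_exp_smul]
    rw [← (integral_of_hermitian hh hi).2]
    refine integral_congr_ae (ae_of_all _ fun v => ?_)
    simp only [smul_eq_mul]
    congr 2
    push_cast; ring
  refine exists_charFun_eq_of_fourier_nonneg hGc hGi hC (D := D) (fun x => ?_) hFour
  -- positivity
  refine mul_nonneg zero_le_two ?_
  set X : ℝ := 2 * Real.pi * x
  let a : ℝ → ℂ := fun v => ((studentSymbol δ v : ℝ) : ℂ) * Complex.exp (-(v * X * Complex.I))
  let c : ℝ → ℂ := fun v => ((v * studentSymbol δ v : ℝ) : ℂ) * Complex.exp (-(v * X * Complex.I))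
  let b : ℝ → ℂ := fun v => ((Real.exp (-η * v) : ℝ) : ℂ) * Complex.exp (-(v * X * Complex.I))
  -- For a point mass at `s` observed from `X`, the half-line integrals below are Laplace transforms
  -- evaluated at `z s` and `zη s`.
  let z : ℝ → ℂ := fun s => (δ : ℂ) + (X - s : ℝ) * Complex.I
  let zη : ℝ → ℂ := fun s => (η : ℂ) + (X - s : ℝ) * Complex.I
  have hz : ∀ s, 0 < (z s).re := fun s => by simp [z, hδ]
  have hzη : ∀ s, 0 < (zη s).re := fun s => by simp [zη, hη0]
  have ea : ∀ s, ∀ v ∈ Ioi (0 : ℝ), (1 + δ * v + 0 * v ^ 2) * Complex.exp (-z s * v) =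
      a v * Complex.exp (v * s * Complex.I) := by
    intro s v hv
    simp only [a, studentSymbol, abs_of_pos (show (0 : ℝ) < v from hv)]
    push_cast
    rw [mul_assoc ((1 : ℂ) + δ * v), mul_assoc ((1 : ℂ) + δ * v), ← Complex.exp_add, ← Complex.exp_add,
      zero_mul, add_zero]
    congr 2
    simp only [z]; push_cast; ring
  have ec : ∀ s, ∀ v ∈ Ioi (0 : ℝ), (0 + 1 * v + δ * v ^ 2) * Complex.exp (-z s * v) =
      c v * Complex.exp (v * s * Complex.I) := by
    intro s v hv
    simp only [c, studentSymbol, abs_of_pos (show (0 : ℝ) < v from hv)]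
    push_cast
    rw [show ((v : ℂ) * ((1 + δ * v) * Complex.exp (-δ * v)) * Complex.exp (-(v * X * Complex.I))) *
      Complex.exp (v * s * Complex.I) = (v * (1 + δ * v)) * (Complex.exp (-δ * v) *
      Complex.exp (-(v * X * Complex.I)) * Complex.exp (v * s * Complex.I)) by ring,
      ← Complex.exp_add, ← Complex.exp_add]
    rw [show (0 + 1 * (v : ℂ) + δ * v ^ 2) = v * (1 + δ * v) by ring]
    congr 2
    simp only [z]; push_cast; ring
  have eb : ∀ s, ∀ v ∈ Ioi (0 : ℝ), (1 + 0 * (v : ℂ) + 0 * v ^ 2) * Complex.exp (-zη s * v) =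
      b v * Complex.exp (v * s * Complex.I) := by
    intro s v _
    simp only [b]
    push_cast
    rw [← Complex.exp_add, ← Complex.exp_add, zero_mul, zero_mul, add_zero, add_zero, one_mul]
    congr 1
    simp only [zη]; push_cast; ring
  have ia : IntegrableOn a (Ioi 0) := by
    have := integrableOn_quadratic_mul_cexp_neg 1 δ 0 (hz 0)
    refine IntegrableOn.congr_fun this (fun v hv => ?_) measurableSet_Ioi
    simpa using ea 0 v hv
  have ic : IntegrableOn c (Ioi 0) := by
    have := integrableOn_quadratic_mul_cexp_neg 0 1 δ (hz 0)
    refine IntegrableOn.congr_fun this (fun v hv => ?_) measurableSet_Ioi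
    simpa using ec 0 v hv
  have ib : IntegrableOn b (Ioi 0) := by
    have := integrableOn_quadratic_mul_cexp_neg 1 0 0 (hzη 0)
    refine IntegrableOn.congr_fun this (fun v hv => ?_) measurableSet_Ioi
    simpa using eb 0 v hv
  have mulF : ∀ g : ℝ → ℂ, IntegrableOn g (Ioi 0) → IntegrableOn (fun v => g v * F v) (Ioi 0) :=
    fun g hg => hg.mul_bdd (c := M) hFc.aestronglyMeasurable (ae_of_all _ hFb)
  have hA : ∫ v in Ioi (0 : ℝ), a v * F v = ∫ s, (1 / z s + δ / z s ^ 2) ∂μ := by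
    rw [integral_mul_charFun ia]
    refine integral_congr_ae (ae_of_all _ fun s => ?_)
    simp only
    rw [← setIntegral_congr_fun measurableSet_Ioi (ea s), integral_quadratic_mul_cexp_neg _ _ _ (hz s)]
    ring
  have hCc : ∫ v in Ioi (0 : ℝ), c v * F v = ∫ s, (1 / z s ^ 2 + 2 * δ / z s ^ 3) ∂μ := by
    rw [integral_mul_charFun ic]
    refine integral_congr_ae (ae_of_all _ fun s => ?_)
    simp only
    rw [← setIntegral_congr_fun measurableSet_Ioi (ec s), integral_quadratic_mul_cexp_neg _ _ _ (hz s)]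
    ring
  have hAi : Integrable (fun s => 1 / z s + δ / z s ^ 2) μ := by
    refine (integrable_integral_mul_exp ia).congr (ae_of_all _ fun s => ?_)
    simp only
    rw [← setIntegral_congr_fun measurableSet_Ioi (ea s), integral_quadratic_mul_cexp_neg _ _ _ (hz s)]
    ring
  have hCi : Integrable (fun s => 1 / z s ^ 2 + 2 * δ / z s ^ 3) μ := by
    refine (integrable_integral_mul_exp ic).congr (ae_of_all _ fun s => ?_)
    simp only
    rw [← setIntegral_congr_fun measurableSet_Ioi (ec s), integral_quadratic_mul_cexp_neg _ _ _ (hz s)]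
    ring
  set B := ∫ v in Ioi (0 : ℝ), b v * F v with hB
  -- `B` is the integral of `1/(η + i(X - s))` over `μ`, so its real part is a Poisson-type integral
  -- of a positive measure.
  have hBre : 0 ≤ B.re := by
    have hBi : Integrable (fun s => 1 / zη s) μ := by
      refine (integrable_integral_mul_exp ib).congr (ae_of_all _ fun s => ?_)
      simp only
      rw [← setIntegral_congr_fun measurableSet_Ioi (eb s),
        integral_quadratic_mul_cexp_neg _ _ _ (hzη s)]
      ring
    have hB' : B = ∫ s, 1 / zη s ∂μ := by
      rw [hB, integral_mul_charFun ib]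
      refine integral_congr_ae (ae_of_all _ fun s => ?_)
      simp only
      rw [← setIntegral_congr_fun measurableSet_Ioi (eb s),
        integral_quadratic_mul_cexp_neg _ _ _ (hzη s)]
      ring
    rw [hB']
    have := integral_re hBi
    simp only [RCLike.re_eq_complex_re] at this
    rw [← this]
    refine integral_nonneg fun s => ?_
    simp only [one_div, Complex.inv_re, Pi.zero_apply]
    exact div_nonneg (hzη s).le (Complex.normSq_nonneg _)
  have hBn : ‖B‖ ≤ M / η := by
    have hmaj : IntegrableOn (fun v : ℝ => M * Real.exp (-η * v)) (Ioi 0) := by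
      simpa using! (integrableOn_pow_mul_exp_neg 0 hη0).const_mul M
    have hv : ∫ v in Ioi (0 : ℝ), M * Real.exp (-η * v) = M / η := by
      rw [integral_const_mul, integral_exp_mul_Ioi (by linarith)]
      simp
      rw [div_eq_mul_inv]
    rw [← hv]
    refine norm_integral_le_of_norm_le hmaj (ae_of_all _ fun v => ?_)
    simp only [b]
    rw [norm_mul, norm_mul, Complex.norm_real, Real.norm_of_nonneg (Real.exp_nonneg _),
      show -((v : ℂ) * X * Complex.I) = ((-(v * X) : ℝ) : ℂ) * Complex.I by push_cast; ring,
      Complex.norm_exp_ofReal_mul_I, mul_one, mul_comm]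
    gcongr
    exact hFb v
  -- The integral of the convolution is a product. Only one factor is expanded over `μ`; the other
  -- stays as the constant `B`, so positivity can be checked for each `s` separately.
  have hsplit : ∫ v in Ioi (0 : ℝ), Complex.exp (-(v * X * Complex.I)) * G v =
      ∫ s, ((κ : ℂ) * (1 / z s + δ / z s ^ 2) -
        (1 / Real.pi : ℝ) * ((1 / z s ^ 2 + 2 * δ / z s ^ 3) * B)) ∂μ := by
    have conv := integral_posConvolution (mulF c ic) (mulF b ib) (ContinuousLinearMap.mul ℝ ℂ)
    simp only [ContinuousLinearMap.mul_apply'] at conv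
    rw [integral_sub (hAi.const_mul _) ((hCi.mul_const B).const_mul _), integral_const_mul,
      integral_const_mul, integral_mul_const, ← hA, ← hCc, ← conv, ← integral_const_mul,
      ← integral_const_mul, ← integral_sub]
    · refine setIntegral_congr_fun measurableSet_Ioi fun v hv => ?_
      simp only [hG, mul_add]
      rw [cexp_mul_regNonlin F X hv]
      simp only [a, b, c]
      push_cast
      ring
    · exact (mulF a ia).const_mul _
    · have : IntegrableOn (fun v => (κ : ℂ) * (a v * F v) - Complex.exp (-(v * X * Complex.I)) * G v)
          (Ioi 0) := by
        refine ((mulF a ia).const_mul _).sub ?_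
        refine hGiOn.bdd_mul (c := 1) (by fun_prop) (ae_of_all _ fun v => ?_)
        rw [show -((v : ℂ) * X * Complex.I) =
          ((-(v * X) : ℝ) : ℂ) * Complex.I by push_cast; ring, Complex.norm_exp_ofReal_mul_I]
      refine IntegrableOn.congr_fun this (fun v hv => ?_) measurableSet_Ioi
      simp only [hG, mul_add]
      rw [cexp_mul_regNonlin F X hv]
      simp only [a, b, c]
      push_cast
      ring
  rw [hsplit]
  have hint : Integrable (fun s => ((κ : ℂ) * (1 / z s + δ / z s ^ 2) -
        (1 / Real.pi : ℝ) * ((1 / z s ^ 2 + 2 * δ / z s ^ 3) * B))) μ :=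
    (hAi.const_mul _).sub ((hCi.mul_const B).const_mul _)
  have := integral_re hint
  simp only [RCLike.re_eq_complex_re] at this
  rw [← this]
  exact integral_nonneg fun s => harnack_laplace hδ hη0 hM0 hκ hBre hBn

/-! ### A positivity-preserving, consistent Euler step -/

/-- Characteristic functions of finite measures on the line of total mass at most `M`. -/
def charFunClass (M : ℝ) : Set (ℝ → ℂ) :=
  {F | ∃ μ : Measure ℝ, IsFiniteMeasure μ ∧ μ.real univ ≤ M ∧ charFun μ = F}

theorem charFunClass.continuous {M : ℝ} {F : ℝ → ℂ} (hF : F ∈ charFunClass M) : Continuous F := by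
  obtain ⟨μ, _, -, rfl⟩ := hF
  exact continuous_charFun

theorem charFunClass.norm_le {M : ℝ} {F : ℝ → ℂ} (hF : F ∈ charFunClass M) (θ : ℝ) : ‖F θ‖ ≤ M := by
  obtain ⟨μ, _, h, rfl⟩ := hF
  exact (norm_charFun_le θ).trans h

theorem charFun_add_measure (μ lam : Measure ℝ) [IsFiniteMeasure μ] [IsFiniteMeasure lam] (θ : ℝ) :
    charFun (μ + lam) θ = charFun μ θ + charFun lam θ := by
  have hI : ∀ (μ : Measure ℝ) [IsFiniteMeasure μ],
      Integrable (fun x : ℝ => Complex.exp (θ * x * Complex.I)) μ := fun μ _ =>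
    Integrable.of_bound (by fun_prop) 1 (ae_of_all _ fun x => by
      rw [← Complex.ofReal_mul, Complex.norm_exp_ofReal_mul_I])
  simp_rw [charFun_apply_real]
  exact integral_add_measure (hI _) (hI _)

theorem charFun_toNNReal_smul_measure (μ : Measure ℝ) {c : ℝ} (hc : 0 ≤ c) (θ : ℝ) :
    charFun (c.toNNReal • μ) θ = c * charFun μ θ := by
  rw [charFun_apply, integral_smul_nnreal_measure, ← charFun_apply, NNReal.smul_def,
    Real.coe_toNNReal _ hc, Complex.real_smul]

/-- Averaging over `s ↔ 1 - s` replaces the weight by its mean `1/2`. This identifies the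
unmollified form of `regNonlin` with the true nonlinearity, and reappears in the energy estimate. -/
theorem integral_id_mul_of_symm {g : ℝ → ℂ} (hg : Continuous g) (hs : ∀ s, g (1 - s) = g s) :
    ∫ s in (0 : ℝ)..1, (s : ℂ) * g s = (1 / 2 : ℂ) * ∫ s in (0 : ℝ)..1, g s := by
  have h1 : ∫ s in (0 : ℝ)..1, (s : ℂ) * g s = ∫ s in (0 : ℝ)..1, ((1 - s : ℝ) : ℂ) * g s := by
    have := intervalIntegral.integral_comp_sub_left (a := 0) (b := 1) (fun s : ℝ => (s : ℂ) * g s) 1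
    simp only [sub_self, sub_zero, hs] at this
    exact this.symm
  have i1 : IntervalIntegrable (fun s : ℝ => (s : ℂ) * g s) volume 0 1 :=
    (by fun_prop : Continuous fun s : ℝ => (s : ℂ) * g s).intervalIntegrable _ _
  have i2 : IntervalIntegrable (fun s : ℝ => ((1 - s : ℝ) : ℂ) * g s) volume 0 1 :=
    (by fun_prop : Continuous fun s : ℝ => ((1 - s : ℝ) : ℂ) * g s).intervalIntegrable _ _
  have h2 : (∫ s in (0 : ℝ)..1, (s : ℂ) * g s) + ∫ s in (0 : ℝ)..1, ((1 - s : ℝ) : ℂ) * g s =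
      ∫ s in (0 : ℝ)..1, g s := by
    rw [← intervalIntegral.integral_add i1 i2]
    refine intervalIntegral.integral_congr fun s _ => ?_
    push_cast; ring
  rw [← h1] at h2
  linear_combination h2 / 2

/-- With `x = δ|θ|`, the last bound is `(1 + x)e^{-x} ≥ (1 + x)(1 - x)`. The factor `1 + x` cancels
the linear term at 0; a first-order error would not be beaten by `κ`, which is of order `1/(ηδ)`. -/
theorem studentSymbol_mem {δ : ℝ} (hδ : 0 ≤ δ) (θ : ℝ) :
    0 ≤ studentSymbol δ θ ∧ studentSymbol δ θ ≤ 1 ∧ 1 - studentSymbol δ θ ≤ (δ * |θ|) ^ 2 := by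
  unfold studentSymbol
  have hx : 0 ≤ δ * |θ| := by positivity
  set x := δ * |θ|
  have e : Real.exp (-δ * |θ|) = Real.exp (-x) := by simp [x]
  rw [e]
  have h1 := Real.add_one_le_exp (-x)
  have h2 : (1 + x) * Real.exp (-x) ≤ 1 := by
    have := Real.add_one_le_exp x
    rw [Real.exp_neg, ← div_eq_mul_inv, div_le_one (Real.exp_pos _)]; linarith
  refine ⟨by positivity, h2, ?_⟩
  nlinarith

theorem norm_regNonlin_sub_le {δ η M R : ℝ} (hδ : 0 ≤ δ) (hη : 0 ≤ η) {F : ℝ → ℂ}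
    (hc : Continuous F) (hF : ∀ θ, ‖F θ‖ ≤ M) {θ : ℝ} (hθ : |θ| ≤ R) :
    ‖regNonlin δ η F θ + ((θ ^ 2 / (2 * Real.pi) : ℝ) : ℂ) *
      ∫ s in (0 : ℝ)..1, F (s * θ) * F ((1 - s) * θ)‖ ≤
      R ^ 2 / Real.pi * (((δ * R) ^ 2 + η * R) * M ^ 2) := by
  have hM : 0 ≤ M := (norm_nonneg _).trans (hF 0)
  have hR : 0 ≤ R := (abs_nonneg _).trans hθ
  have hpi := Real.pi_pos
  have hkc := continuous_studentSymbol δ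
  have hsym := integral_id_mul_of_symm (g := fun s : ℝ => F (s * θ) * F ((1 - s) * θ))
    (by fun_prop) (fun s => by simp [mul_comm])
  have e : regNonlin δ η F θ + ((θ ^ 2 / (2 * Real.pi) : ℝ) : ℂ) *
      ∫ s in (0 : ℝ)..1, F (s * θ) * F ((1 - s) * θ) =
      ((θ ^ 2 / Real.pi : ℝ) : ℂ) * ∫ s in (0 : ℝ)..1,
        ((s * (1 - studentSymbol δ (s * θ) * Real.exp (-η * |(1 - s) * θ|)) : ℝ) : ℂ) *
        (F (s * θ) * F ((1 - s) * θ)) := by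
    have h1 : ∫ s in (0 : ℝ)..1,
        ((s * (1 - studentSymbol δ (s * θ) * Real.exp (-η * |(1 - s) * θ|)) : ℝ) : ℂ) *
        (F (s * θ) * F ((1 - s) * θ)) =
        (∫ s in (0 : ℝ)..1, (s : ℂ) * (F (s * θ) * F ((1 - s) * θ))) -
        ∫ s in (0 : ℝ)..1, ((s * studentSymbol δ (s * θ) * Real.exp (-η * |(1 - s) * θ|) : ℝ) : ℂ) *
      (F (s * θ) * F ((1 - s) * θ)) := by
      rw [← intervalIntegral.integral_sub]
      · refine intervalIntegral.integral_congr fun s _ => ?_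
        push_cast; ring
      · exact Continuous.intervalIntegrable (by fun_prop) _ _
      · exact Continuous.intervalIntegrable (by fun_prop) _ _
    rw [h1, hsym, regNonlin]
    generalize (∫ s in (0 : ℝ)..1, F (s * θ) * F ((1 - s) * θ)) = A
    generalize (∫ s in (0 : ℝ)..1,
      ((s * studentSymbol δ (s * θ) * Real.exp (-η * |(1 - s) * θ|) : ℝ) : ℂ) *
        (F (s * θ) * F ((1 - s) * θ))) = B
    push_cast
    field_simp
    ring
  rw [e, norm_mul, Complex.norm_real, Real.norm_of_nonneg (by positivity)]
  have hθ2 : θ ^ 2 ≤ R ^ 2 := by rw [← sq_abs]; gcongr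
  have hb : ‖∫ s in (0 : ℝ)..1,
        ((s * (1 - studentSymbol δ (s * θ) * Real.exp (-η * |(1 - s) * θ|)) : ℝ) : ℂ) *
        (F (s * θ) * F ((1 - s) * θ))‖ ≤ ((δ * R) ^ 2 + η * R) * M ^ 2 := by
    have := intervalIntegral.norm_integral_le_of_norm_le_const (a := 0) (b := 1)
      (C := ((δ * R) ^ 2 + η * R) * M ^ 2) (f := fun s : ℝ =>
        ((s * (1 - studentSymbol δ (s * θ) * Real.exp (-η * |(1 - s) * θ|)) : ℝ) : ℂ) *
        (F (s * θ) * F ((1 - s) * θ))) ?_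
    · simpa using this
    intro s hs
    rw [uIoc_of_le zero_le_one] at hs
    obtain ⟨k0, k1, k2⟩ := studentSymbol_mem hδ (s * θ)
    have hs0 := hs.1.le
    have hs1 := hs.2
    have h1s : 0 ≤ 1 - s := by linarith
    have hsθ : |s * θ| ≤ R := by
      rw [abs_mul, abs_of_nonneg hs0]
      calc s * |θ| ≤ 1 * R := by gcongr
        _ = R := one_mul R
    have hsθ' : |(1 - s) * θ| ≤ R := by
      rw [abs_mul, abs_of_nonneg h1s]
      calc (1 - s) * |θ| ≤ 1 * R := by gcongr; linarith
        _ = R := one_mul R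
    set E := Real.exp (-η * |(1 - s) * θ|) with hE
    have E0 : 0 < E := Real.exp_pos _
    have E1 : E ≤ 1 := Real.exp_le_one_iff.2 (by nlinarith [abs_nonneg ((1 - s) * θ)])
    have E2 : 1 - E ≤ η * R := by
      have := Real.add_one_le_exp (-η * |(1 - s) * θ|)
      have : η * |(1 - s) * θ| ≤ η * R := by gcongr
      linarith
    have K2 : 1 - studentSymbol δ (s * θ) ≤ (δ * R) ^ 2 := k2.trans (by gcongr)
    set k := studentSymbol δ (s * θ)
    have hkE : k * E ≤ 1 := by nlinarith
    have hfin : 1 - k * E ≤ (δ * R) ^ 2 + η * R := by nlinarith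
    rw [norm_mul, norm_mul, Complex.norm_real, Real.norm_of_nonneg (mul_nonneg hs0 (by linarith))]
    have : s * (1 - k * E) ≤ (δ * R) ^ 2 + η * R := by nlinarith
    refine mul_le_mul this ?_ (by positivity) (by positivity)
    rw [pow_two]
    exact mul_le_mul (hF _) (hF _) (norm_nonneg _) hM
  gcongr

/-- One step of a consistent explicit scheme for `∂ₜF = fourierField ν α F` that preserves the class
of characteristic functions. -/
theorem exists_euler_step {ν α M R ε : ℝ} (hν : 0 ≤ ν) (h0 : 0 ≤ α) (h2 : α ≤ 2) (hM : 0 ≤ M)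
    (hR : 0 < R) (hε : 0 < ε) :
    ∃ τ : ℝ, 0 < τ ∧ τ ≤ ε ∧ ∃ S : (ℝ → ℂ) → ℝ → ℂ, ∀ F ∈ charFunClass M,
      S F ∈ charFunClass M ∧
      ∀ θ, |θ| ≤ R → ‖S F θ - F θ - τ * fourierField ν α F θ‖ ≤ ε * τ := by
  have hpi := Real.pi_pos
  -- Half of the error budget `ε` goes to the dissipation; the rest goes to the artificial jumps and
  -- the mollification, whose errors are `η` times the constant `K` below.
  obtain ⟨k, m, hm, hmk, hsym⟩ := exists_charFun_approx_abs_rpow h0 h2 hR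
    (ε := ε / (2 * (ν * M + 1))) (by positivity)
  have hk : 0 ≤ k := measureReal_nonneg.trans hmk
  set K := 7 * M ^ 2 * R ^ 2 / (2 * Real.pi) + R ^ 2 / Real.pi * ((R ^ 2 + R) * M ^ 2) with hK
  have hK0 : 0 ≤ K := by positivity
  set η := min 1 (ε / (2 * (K + 1))) with hη
  have hη0 : 0 < η := lt_min one_pos (by positivity)
  have hη1 : η ≤ 1 := min_le_left _ _
  have hηK : η * K ≤ ε / 2 := by
    have : η ≤ ε / (2 * (K + 1)) := min_le_right _ _
    calc η * K ≤ ε / (2 * (K + 1)) * (K + 1) := by gcongr; linarith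
      _ = ε / 2 := by field_simp
  -- The artificial jumps contribute an error of order `κδ² ∼ δ/η`, so `δ` has to be small compared
  -- with `η`.
  set δ := η ^ 2 with hδ
  have hδ0 : 0 < δ := by positivity
  have hδη : δ ≤ η := by rw [hδ]; nlinarith
  set κ := 7 * M / (2 * Real.pi * η * δ) with hκ
  have hκ0 : 0 ≤ κ := by positivity
  have hκδ : κ * δ ^ 2 = 7 * M * η / (2 * Real.pi) := by
    rw [hκ, hδ]; field_simp
  -- A stability condition: the coefficient `1 - τ(κ + νk)` of `F` in the step must stay
  -- nonnegative.
  set τ := min ε (1 / (κ + ν * k + 1)) with hτ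
  have hden : 0 < κ + ν * k + 1 := by positivity
  have hτ0 : 0 < τ := lt_min hε (by positivity)
  have hτ1 : τ * (κ + ν * k) ≤ 1 := by
    have : τ ≤ 1 / (κ + ν * k + 1) := min_le_right _ _
    calc τ * (κ + ν * k) ≤ 1 / (κ + ν * k + 1) * (κ + ν * k + 1) :=
          mul_le_mul this (by linarith) (by positivity) (by positivity)
      _ = 1 := by field_simp
  refine ⟨τ, hτ0, min_le_left _ _, fun F θ => F θ + τ * (((κ * studentSymbol δ θ : ℝ) : ℂ) * F θ +
    regNonlin δ η F θ - ((κ + ν * k : ℝ) : ℂ) * F θ + ν * (charFun m θ * F θ)), fun F hF => ⟨?_, ?_⟩⟩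
  · obtain ⟨μ, hμ, hμM, rfl⟩ := hF
    obtain ⟨lam, hlam, hlamF⟩ := exists_charFun_eq_student_add_regNonlin hμM hδ0 hδη hκ
    have c1 : 0 ≤ 1 - τ * (κ + ν * k) := by linarith
    have c3 : 0 ≤ τ * ν := by positivity
    set res : Measure ℝ := (1 - τ * (κ + ν * k)).toNNReal • μ + τ.toNNReal • lam +
      (τ * ν).toNNReal • (m ∗ μ) with hres
    have hch : charFun res = fun θ => charFun μ θ + τ * (((κ * studentSymbol δ θ : ℝ) : ℂ) * charFun μ θ +
        regNonlin δ η (charFun μ) θ - ((κ + ν * k : ℝ) : ℂ) * charFun μ θ +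
        ν * (charFun m θ * charFun μ θ)) := by
      ext θ
      rw [hres, charFun_add_measure, charFun_add_measure, charFun_toNNReal_smul_measure _ c1,
        charFun_toNNReal_smul_measure _ hτ0.le, charFun_toNNReal_smul_measure _ c3, charFun_conv, hlamF]
      push_cast
      ring
    refine ⟨res, inferInstance, ?_, hch⟩
    -- The value at frequency 0 gives the mass: the nonlinearity vanishes there, the artificial
    -- jumps conserve mass, and `m.real univ ≤ k` leaves at most killing.
    have h := congrFun hch 0
    have hs0 : studentSymbol δ 0 = 1 := by simp [studentSymbol]
    have hr0 : regNonlin δ η (charFun μ) 0 = 0 := by simp [regNonlin]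
    simp only [hs0, hr0, charFun_zero, mul_one, add_zero] at h
    have h' : res.real univ = μ.real univ + τ * (κ * μ.real univ - (κ + ν * k) * μ.real univ +
      ν * (m.real univ * μ.real univ)) := by exact_mod_cast h
    have hle : m.real univ * μ.real univ ≤ k * μ.real univ :=
      mul_le_mul_of_nonneg_right hmk measureReal_nonneg
    have : ν * (m.real univ * μ.real univ) ≤ ν * (k * μ.real univ) := by gcongr
    rw [h']
    nlinarith
  · intro θ hθ
    have hFc := charFunClass.continuous hF
    have hFb := charFunClass.norm_le hF
    have e : F θ + τ * (((κ * studentSymbol δ θ : ℝ) : ℂ) * F θ +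
        regNonlin δ η F θ - ((κ + ν * k : ℝ) : ℂ) * F θ + ν * (charFun m θ * F θ)) - F θ -
        τ * fourierField ν α F θ =
        τ * (-((κ * (1 - studentSymbol δ θ) : ℝ) : ℂ) * F θ + (regNonlin δ η F θ +
          ((θ ^ 2 / (2 * Real.pi) : ℝ) : ℂ) * ∫ s in (0 : ℝ)..1, F (s * θ) * F ((1 - s) * θ)) -
          ν * (((k : ℂ) - charFun m θ - ((|θ| ^ α : ℝ) : ℂ)) * F θ)) := by
      rw [fourierField]; push_cast; ring
    rw [e, norm_mul, Complex.norm_real, Real.norm_of_nonneg hτ0.le, mul_comm ε]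
    refine mul_le_mul_of_nonneg_left ?_ hτ0.le
    obtain ⟨k0, k1, k2⟩ := studentSymbol_mem hδ0.le θ
    have b1 : ‖-((κ * (1 - studentSymbol δ θ) : ℝ) : ℂ) * F θ‖ ≤ η * (7 * M ^ 2 * R ^ 2 / (2 * Real.pi)) := by
      rw [norm_mul, norm_neg, Complex.norm_real,
        Real.norm_of_nonneg (mul_nonneg hκ0 (by linarith))]
      calc κ * (1 - studentSymbol δ θ) * ‖F θ‖ ≤ κ * (δ * R) ^ 2 * M := by
            have := hFb θ
            have : 1 - studentSymbol δ θ ≤ (δ * R) ^ 2 := k2.trans (by gcongr)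
            gcongr
        _ = κ * δ ^ 2 * R ^ 2 * M := by ring
        _ = _ := by rw [hκδ]; field_simp
    have b2 := norm_regNonlin_sub_le hδ0.le hη0.le hFc hFb hθ
    have b2' : R ^ 2 / Real.pi * (((δ * R) ^ 2 + η * R) * M ^ 2) ≤
        η * (R ^ 2 / Real.pi * ((R ^ 2 + R) * M ^ 2)) := by
      have : δ ^ 2 ≤ η := by
        calc δ ^ 2 = δ * δ := pow_two δ
          _ ≤ η * 1 := by gcongr; exact hδη.trans hη1
          _ = η := mul_one η
      have h1 : (δ * R) ^ 2 + η * R ≤ η * (R ^ 2 + R) := by nlinarith [sq_nonneg R]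
      calc _ ≤ R ^ 2 / Real.pi * ((η * (R ^ 2 + R)) * M ^ 2) := by gcongr
        _ = _ := by ring
    have b3 : ‖(ν : ℂ) * (((k : ℂ) - charFun m θ - ((|θ| ^ α : ℝ) : ℂ)) * F θ)‖ ≤ ε / 2 := by
      rw [norm_mul, norm_mul, Complex.norm_real, Real.norm_of_nonneg hν]
      calc ν * (‖(k : ℂ) - charFun m θ - ((|θ| ^ α : ℝ) : ℂ)‖ * ‖F θ‖)
          ≤ ν * (ε / (2 * (ν * M + 1)) * M) := by
            have a1 := hsym θ hθ
            have a2 := hFb θ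
            gcongr
        _ = (ν * M) * (ε / (2 * (ν * M + 1))) := by ring
        _ ≤ (ν * M + 1) * (ε / (2 * (ν * M + 1))) := by gcongr; linarith
        _ = ε / 2 := by field_simp
    calc _ ≤ η * (7 * M ^ 2 * R ^ 2 / (2 * Real.pi)) + η * (R ^ 2 / Real.pi * ((R ^ 2 + R) * M ^ 2)) +
          ε / 2 := (norm_sub_le _ _).trans (add_le_add ((norm_add_le _ _).trans
            (add_le_add b1 (b2.trans b2'))) b3)
      _ = η * K + ε / 2 := by rw [hK]; ring
      _ ≤ ε := by linarith

/-! ### Convergence of the scheme -/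

/-- A form of Grönwall's inequality for families: a bound that improves under integration. -/
theorem gronwall_of_improving {ι : Type*} {S : Set ι} {D : ℝ → ι → ℝ} {T A L K : ℝ}
    (hL : 0 ≤ L) (hK : 0 ≤ K) (hDK : ∀ t ∈ Icc 0 T, ∀ i ∈ S, D t i ≤ K)
    (hA : 0 ≤ A)
    (h : ∀ b : ℝ → ℝ, Continuous b → (∀ t ∈ Icc 0 T, ∀ i ∈ S, D t i ≤ b t) →
      ∀ t ∈ Icc 0 T, ∀ i ∈ S, D t i ≤ A + L * ∫ s in (0 : ℝ)..t, b s) :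
    ∀ t ∈ Icc 0 T, ∀ i ∈ S, D t i ≤ A * Real.exp (L * t) := by
  -- Only continuous majorants are integrated, so `D` needs no regularity in time. The first term
  -- reproduces itself, and the rate `2L` makes each integration halve the second: `L ∫₀ᵗ e^{2Ls} ds
  -- ≤ e^{2Lt}/2`.
  have step : ∀ n : ℕ, ∀ t ∈ Icc 0 T, ∀ i ∈ S,
      D t i ≤ A * Real.exp (L * t) + K / 2 ^ n * Real.exp (2 * L * t) := by
    intro n
    induction n with
    | zero =>
      intro t ht i hi
      have h1 : 1 ≤ Real.exp (2 * L * t) := Real.one_le_exp (by have := ht.1; positivity)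
      have h2 : 0 ≤ A * Real.exp (L * t) := by positivity
      have := hDK t ht i hi
      have h3 : K ≤ K * Real.exp (2 * L * t) := le_mul_of_one_le_right hK h1
      simpa using by linarith
    | succ n ih =>
      intro t ht i hi
      have := h (fun t => A * Real.exp (L * t) + K / 2 ^ n * Real.exp (2 * L * t)) (by fun_prop) ih t ht i hi
      refine this.trans ?_
      have hderiv : ∀ s ∈ uIcc 0 t, HasDerivAt
          (fun s : ℝ => A * Real.exp (L * s) + K / 2 ^ (n + 1) * Real.exp (2 * L * s))
          (L * (A * Real.exp (L * s) + K / 2 ^ n * Real.exp (2 * L * s))) s := by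
        intro s _
        have e1 := ((hasDerivAt_id s).const_mul L).exp.const_mul A
        have e2 := ((hasDerivAt_id s).const_mul (2 * L)).exp.const_mul (K / 2 ^ (n + 1))
        refine (e1.add e2).congr_deriv ?_
        simp only [id, mul_one]
        rw [pow_succ]
        field_simp
      have hint := intervalIntegral.integral_eq_sub_of_hasDerivAt hderiv
        (Continuous.intervalIntegrable (by fun_prop) _ _)
      rw [intervalIntegral.integral_const_mul] at hint
      rw [hint]
      simp only [mul_zero, Real.exp_zero, mul_one]
      have : 0 ≤ K / 2 ^ (n + 1) := by positivity
      linarith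
  intro t ht i hi
  have hlim : Tendsto (fun n : ℕ => A * Real.exp (L * t) + K / 2 ^ n * Real.exp (2 * L * t)) atTop
      (𝓝 (A * Real.exp (L * t) + 0 * Real.exp (2 * L * t))) := by
    refine Tendsto.const_add _ (Tendsto.mul_const _ ?_)
    have := (tendsto_pow_atTop_nhds_zero_of_lt_one (r := (1 / 2 : ℝ)) (by norm_num) (by norm_num)).const_mul K
    rw [mul_zero] at this
    refine this.congr fun n => ?_
    rw [one_div, inv_pow, div_eq_mul_inv]
  rw [zero_mul, add_zero] at hlim
  exact ge_of_tendsto' hlim fun n => step n t ht i hi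

/-- For `|θ| ≤ R` and `0 ≤ s ≤ 1` both `sθ` and `(1-s)θ` stay in `[-R, R]`, so the estimate closes
on that interval. The product is split by telescoping, with the undifferenced factor bounded by the
mass. -/
theorem norm_fourierField_sub_le {ν α M R B : ℝ} (hν : 0 ≤ ν) (h0 : 0 ≤ α) {F G : ℝ → ℂ}
    (hF : F ∈ charFunClass M) (hG : G ∈ charFunClass M) (hB : ∀ θ, |θ| ≤ R → ‖F θ - G θ‖ ≤ B)
    {θ : ℝ} (hθ : |θ| ≤ R) :
    ‖fourierField ν α F θ - fourierField ν α G θ‖ ≤ (R ^ 2 * M / Real.pi + ν * R ^ α) * B := by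
  have hpi := Real.pi_pos
  have hFc := charFunClass.continuous hF
  have hGc := charFunClass.continuous hG
  have hFb := charFunClass.norm_le hF
  have hGb := charFunClass.norm_le hG
  have hM : 0 ≤ M := (norm_nonneg _).trans (hFb 0)
  have hR : 0 ≤ R := (abs_nonneg _).trans hθ
  have hB0 : 0 ≤ B := (norm_nonneg _).trans (hB θ hθ)
  have e : fourierField ν α F θ - fourierField ν α G θ =
      -((θ ^ 2 / (2 * Real.pi) : ℝ) : ℂ) * (∫ s in (0 : ℝ)..1,
        ((F (s * θ) - G (s * θ)) * F ((1 - s) * θ) + G (s * θ) * (F ((1 - s) * θ) - G ((1 - s) * θ)))) -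
      ((ν * |θ| ^ α : ℝ) : ℂ) * (F θ - G θ) := by
    have : ∫ s in (0 : ℝ)..1,
        ((F (s * θ) - G (s * θ)) * F ((1 - s) * θ) + G (s * θ) * (F ((1 - s) * θ) - G ((1 - s) * θ))) =
        (∫ s in (0 : ℝ)..1, F (s * θ) * F ((1 - s) * θ)) -
          ∫ s in (0 : ℝ)..1, G (s * θ) * G ((1 - s) * θ) := by
      rw [← intervalIntegral.integral_sub (Continuous.intervalIntegrable (by fun_prop) _ _)
        (Continuous.intervalIntegrable (by fun_prop) _ _)]
      refine intervalIntegral.integral_congr fun s _ => ?_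
      ring
    rw [this, fourierField, fourierField]
    ring
  have hint : ‖∫ s in (0 : ℝ)..1,
        ((F (s * θ) - G (s * θ)) * F ((1 - s) * θ) + G (s * θ) * (F ((1 - s) * θ) - G ((1 - s) * θ)))‖ ≤
        2 * M * B := by
    have := intervalIntegral.norm_integral_le_of_norm_le_const (a := 0) (b := 1) (C := 2 * M * B)
      (f := fun s : ℝ => (F (s * θ) - G (s * θ)) * F ((1 - s) * θ) +
        G (s * θ) * (F ((1 - s) * θ) - G ((1 - s) * θ))) ?_
    · simpa using this
    intro s hs
    rw [uIoc_of_le zero_le_one] at hs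
    have h1 : |s * θ| ≤ R := by
      rw [abs_mul, abs_of_nonneg hs.1.le]
      calc s * |θ| ≤ 1 * R := by gcongr; exact hs.2
        _ = R := one_mul R
    have h2 : |(1 - s) * θ| ≤ R := by
      rw [abs_mul, abs_of_nonneg (by linarith [hs.2])]
      calc (1 - s) * |θ| ≤ 1 * R := by gcongr; linarith [hs.1]
        _ = R := one_mul R
    calc _ ≤ ‖F (s * θ) - G (s * θ)‖ * ‖F ((1 - s) * θ)‖ +
          ‖G (s * θ)‖ * ‖F ((1 - s) * θ) - G ((1 - s) * θ)‖ := by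
          rw [← norm_mul, ← norm_mul]; exact norm_add_le _ _
      _ ≤ B * M + M * B := by
          have a1 := hB _ h1
          have a2 := hB _ h2
          have a3 := hFb ((1 - s) * θ)
          have a4 := hGb (s * θ)
          gcongr
      _ = 2 * M * B := by ring
  have hθ2 : θ ^ 2 ≤ R ^ 2 := by rw [← sq_abs]; gcongr
  have hθα : |θ| ^ α ≤ R ^ α := Real.rpow_le_rpow (abs_nonneg _) hθ h0
  have hθα0 : 0 ≤ |θ| ^ α := Real.rpow_nonneg (abs_nonneg _) _
  have hd := hB θ hθ
  rw [e]
  refine (norm_sub_le _ _).trans ?_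
  rw [norm_mul, norm_neg, norm_mul, Complex.norm_real, Complex.norm_real,
    Real.norm_of_nonneg (by positivity), Real.norm_of_nonneg (by positivity)]
  calc _ ≤ R ^ 2 / (2 * Real.pi) * (2 * M * B) + ν * R ^ α * B := by gcongr
    _ = _ := by field_simp

theorem norm_fourierField_le {ν α M : ℝ} (hν : 0 ≤ ν) {F : ℝ → ℂ}
    (hF : F ∈ charFunClass M) (θ : ℝ) :
    ‖fourierField ν α F θ‖ ≤ θ ^ 2 * (M ^ 2 / (2 * Real.pi)) + ν * |θ| ^ α * M := by
  have hpi := Real.pi_pos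
  have hFb := charFunClass.norm_le hF
  have hM : 0 ≤ M := (norm_nonneg _).trans (hFb 0)
  have hint : ‖∫ s in (0 : ℝ)..1, F (s * θ) * F ((1 - s) * θ)‖ ≤ M ^ 2 := by
    have := intervalIntegral.norm_integral_le_of_norm_le_const (a := 0) (b := 1) (C := M ^ 2)
      (f := fun s : ℝ => F (s * θ) * F ((1 - s) * θ)) ?_
    · simpa using this
    intro s hs
    rw [norm_mul, pow_two]
    exact mul_le_mul (hFb _) (hFb _) (norm_nonneg _) hM
  have hθα0 : 0 ≤ |θ| ^ α := Real.rpow_nonneg (abs_nonneg _) _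
  refine (norm_sub_le _ _).trans ?_
  rw [norm_mul, norm_neg, norm_mul, Complex.norm_real, Complex.norm_real,
    Real.norm_of_nonneg (by positivity), Real.norm_of_nonneg (by positivity)]
  have := hFb θ
  calc _ ≤ θ ^ 2 / (2 * Real.pi) * M ^ 2 + ν * |θ| ^ α * M := by gcongr
    _ = _ := by field_simp

theorem norm_fourierField_le_of_abs_le {ν α M R : ℝ} (hν : 0 ≤ ν) (h0 : 0 ≤ α) {F : ℝ → ℂ}
    (hF : F ∈ charFunClass M) {θ : ℝ} (hθ : |θ| ≤ R) :
    ‖fourierField ν α F θ‖ ≤ R ^ 2 * (M ^ 2 / (2 * Real.pi)) + ν * R ^ α * M := by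
  have hpi := Real.pi_pos
  have hM : 0 ≤ M := (norm_nonneg _).trans (charFunClass.norm_le hF 0)
  have hθ2 : θ ^ 2 ≤ R ^ 2 := by rw [← sq_abs]; gcongr
  have hθα : |θ| ^ α ≤ R ^ α := Real.rpow_le_rpow (abs_nonneg _) hθ h0
  refine (norm_fourierField_le hν hF θ).trans ?_
  gcongr

/-- Piecewise constant interpolation of the iterates of a step map. -/
noncomputable def eulerCurve (S : (ℝ → ℂ) → ℝ → ℂ) (τ : ℝ) (F₀ : ℝ → ℂ) (t : ℝ) : ℝ → ℂ :=
  S^[⌊t / τ⌋₊] F₀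

section euler

variable {ν α M R ε τ : ℝ} {S : (ℝ → ℂ) → ℝ → ℂ} {F₀ : ℝ → ℂ}

theorem eulerCurve_mem (hS : ∀ F ∈ charFunClass M, S F ∈ charFunClass M) (hF₀ : F₀ ∈ charFunClass M)
    (t : ℝ) : eulerCurve S τ F₀ t ∈ charFunClass M := by
  unfold eulerCurve
  induction ⌊t / τ⌋₊ with
  | zero => exact hF₀
  | succ n ih => rw [Function.iterate_succ_apply']; exact hS _ ih

theorem measurable_fourierField_eulerCurve (θ : ℝ) :
    Measurable fun s => fourierField ν α (eulerCurve S τ F₀ s) θ := by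
  have : Measurable fun n : ℕ => fourierField ν α (S^[n] F₀) θ := measurable_from_nat
  exact this.comp (Nat.measurable_floor.comp (measurable_id.div_const τ))

theorem intervalIntegrable_fourierField_eulerCurve (hν : 0 ≤ ν)
    (hS : ∀ F ∈ charFunClass M, S F ∈ charFunClass M) (hF₀ : F₀ ∈ charFunClass M) (θ a b : ℝ) :
    IntervalIntegrable (fun s => fourierField ν α (eulerCurve S τ F₀ s) θ) volume a b := by
  refine (intervalIntegrable_const (c := θ ^ 2 * (M ^ 2 / (2 * Real.pi)) + ν * |θ| ^ α * M)).mono_fun'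
    (measurable_fourierField_eulerCurve θ).aestronglyMeasurable (ae_of_all _ fun s => ?_)
  exact norm_fourierField_le hν (eulerCurve_mem hS hF₀ s) θ

/-- Local errors `ετ` accumulate to at most `Tε` over the complete steps; the incomplete last step
costs `τ ≤ ε` times the bound of the field. The field is bounded on the smaller radius `r`, which
keeps the constant independent of `R`. -/
theorem norm_eulerCurve_sub_integral_le (hν : 0 ≤ ν) (h0 : 0 ≤ α) (hτ : 0 < τ) (hτε : τ ≤ ε)
    (hS : ∀ F ∈ charFunClass M, S F ∈ charFunClass M ∧
      ∀ θ, |θ| ≤ R → ‖S F θ - F θ - τ * fourierField ν α F θ‖ ≤ ε * τ)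
    (hF₀ : F₀ ∈ charFunClass M) {t T : ℝ} (ht : t ∈ Icc 0 T) {r θ : ℝ} (hθ : |θ| ≤ r) (hr : r ≤ R) :
    ‖eulerCurve S τ F₀ t θ - F₀ θ - ∫ s in (0 : ℝ)..t, fourierField ν α (eulerCurve S τ F₀ s) θ‖ ≤
      (T + (r ^ 2 * (M ^ 2 / (2 * Real.pi)) + ν * r ^ α * M)) * ε := by
  have hS' : ∀ F ∈ charFunClass M, S F ∈ charFunClass M := fun F hF => (hS F hF).1
  have hii := intervalIntegrable_fourierField_eulerCurve (ν := ν) (α := α) (τ := τ) hν hS' hF₀ θ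
  have hiter : ∀ n : ℕ, S^[n] F₀ ∈ charFunClass M := by
    intro n
    induction n with
    | zero => exact hF₀
    | succ n ih => rw [Function.iterate_succ_apply']; exact hS' _ ih
  have hgrid : ∀ n : ℕ, ‖S^[n] F₀ θ - F₀ θ -
      ∫ s in (0 : ℝ)..(n * τ), fourierField ν α (eulerCurve S τ F₀ s) θ‖ ≤ n * (ε * τ) := by
    intro n
    induction n with
    | zero => simp
    | succ n ih =>
      have hstep : ∫ s in (n * τ)..((n + 1 : ℕ) * τ), fourierField ν α (eulerCurve S τ F₀ s) θ =
          τ * fourierField ν α (S^[n] F₀) θ := by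
        have : ∫ s in (n * τ)..((n + 1 : ℕ) * τ), fourierField ν α (eulerCurve S τ F₀ s) θ =
            ∫ s in (n * τ)..((n + 1 : ℕ) * τ), fourierField ν α (S^[n] F₀) θ := by
          refine intervalIntegral.integral_congr_ae ?_
          -- The curve jumps at the right endpoint, which is a null set.
          have hae : ∀ᵐ s : ℝ, s ≠ (n + 1 : ℕ) * τ := by simp [ae_iff, measure_singleton]
          filter_upwards [hae] with s hs1 hs2
          rw [uIoc_of_le (by push_cast; nlinarith)] at hs2
          have hlt : s < (n + 1 : ℕ) * τ := lt_of_le_of_ne hs2.2 hs1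
          have hfl : ⌊s / τ⌋₊ = n := by
            rw [Nat.floor_eq_iff (by have := hs2.1; have : 0 ≤ n * τ := by positivity
                                     exact div_nonneg (by linarith) hτ.le)]
            constructor
            · rw [le_div_iff₀ hτ]; exact hs2.1.le
            · rw [div_lt_iff₀ hτ]; exact_mod_cast hlt
          rw [eulerCurve, hfl]
        rw [this, intervalIntegral.integral_const, Complex.real_smul]
        congr 1
        push_cast; ring
      rw [← intervalIntegral.integral_add_adjacent_intervals (hii 0 (n * τ)) (hii _ _), hstep,
        Function.iterate_succ_apply']
      have h1 := (hS _ (hiter n)).2 θ (hθ.trans hr)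
      calc _ = ‖(S (S^[n] F₀) θ - S^[n] F₀ θ - τ * fourierField ν α (S^[n] F₀) θ) +
            (S^[n] F₀ θ - F₀ θ - ∫ s in (0 : ℝ)..(n * τ), fourierField ν α (eulerCurve S τ F₀ s) θ)‖ := by
            congr 1; ring
        _ ≤ ε * τ + n * (ε * τ) := (norm_add_le _ _).trans (add_le_add h1 ih)
        _ = _ := by push_cast; ring
  set n := ⌊t / τ⌋₊ with hn
  have hn1 : n * τ ≤ t := by
    rw [← le_div_iff₀ hτ]; exact Nat.floor_le (div_nonneg ht.1 hτ.le)
  have hn2 : t ≤ n * τ + τ := by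
    have := (Nat.lt_floor_add_one (t / τ)).le
    rw [div_le_iff₀ hτ] at this
    linarith
  have hrem : ‖∫ s in (n * τ)..t, fourierField ν α (eulerCurve S τ F₀ s) θ‖ ≤
      (r ^ 2 * (M ^ 2 / (2 * Real.pi)) + ν * r ^ α * M) * ε := by
    have h1 := intervalIntegral.norm_integral_le_of_norm_le_const (a := n * τ) (b := t)
      (f := fun s => fourierField ν α (eulerCurve S τ F₀ s) θ)
      (fun s _ => norm_fourierField_le_of_abs_le hν h0 (eulerCurve_mem hS' hF₀ s) hθ)
    refine h1.trans ?_
    have hC : 0 ≤ r ^ 2 * (M ^ 2 / (2 * Real.pi)) + ν * r ^ α * M :=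
      (norm_nonneg _).trans (norm_fourierField_le_of_abs_le hν h0 hF₀ hθ)
    refine mul_le_mul_of_nonneg_left ?_ hC
    rw [abs_of_nonneg (by linarith)]
    linarith
  rw [← intervalIntegral.integral_add_adjacent_intervals (hii 0 (n * τ)) (hii _ _)]
  have hε : 0 < ε := hτ.trans_le hτε
  calc _ = ‖(S^[n] F₀ θ - F₀ θ - ∫ s in (0 : ℝ)..(n * τ), fourierField ν α (eulerCurve S τ F₀ s) θ) -
        ∫ s in (n * τ)..t, fourierField ν α (eulerCurve S τ F₀ s) θ‖ := by
        congr 1; rw [eulerCurve, ← hn]; ring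
    _ ≤ n * (ε * τ) + (r ^ 2 * (M ^ 2 / (2 * Real.pi)) + ν * r ^ α * M) * ε :=
        (norm_sub_le _ _).trans (add_le_add (hgrid n) hrem)
    _ = (n * τ) * ε + (r ^ 2 * (M ^ 2 / (2 * Real.pi)) + ν * r ^ α * M) * ε := by ring
    _ ≤ T * ε + (r ^ 2 * (M ^ 2 / (2 * Real.pi)) + ν * r ^ α * M) * ε := by
        have := ht.2
        gcongr
        linarith
    _ = _ := by ring

end euler

/-- Existence of a global solution of the equation on the Fourier side, by characteristic functions
of finite measures. -/
theorem exists_charFun_solution {ν α M : ℝ} (hν : 0 ≤ ν) (h0 : 0 ≤ α) (h2 : α ≤ 2) {F₀ : ℝ → ℂ}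
    (hF₀ : F₀ ∈ charFunClass M) :
    ∃ F : ℝ → ℝ → ℂ, (∀ t, F t ∈ charFunClass M) ∧ (∀ t ≤ 0, F t = F₀) ∧
      (∀ θ, Measurable fun s => fourierField ν α (F s) θ) ∧
      ∀ t, 0 ≤ t → ∀ θ, F t θ = F₀ θ + ∫ s in (0 : ℝ)..t, fourierField ν α (F s) θ := by
  have hpi := Real.pi_pos
  have hM : 0 ≤ M := (norm_nonneg _).trans (charFunClass.norm_le hF₀ 0)
  have hpos : ∀ n : ℕ, (0 : ℝ) < 1 / ((n : ℝ) + 1) := fun n => by positivity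
  -- The `n`-th scheme is accurate to `1/(n+1)` on `|θ| ≤ n + 1`, so each fixed frequency range is
  -- eventually covered.
  have hstep : ∀ n : ℕ, _ := fun n : ℕ => exists_euler_step (ν := ν) (α := α) (M := M)
    (R := (n : ℝ) + 1) hν h0 h2 hM (by positivity) (hpos n)
  choose τ hτ hτε S hS using hstep
  have hS' : ∀ n, ∀ F ∈ charFunClass M, S n F ∈ charFunClass M := fun n F hF => (hS n F hF).1
  set A : ℕ → ℝ → ℝ → ℂ := fun n t => eulerCurve (S n) (τ n) F₀ t with hA
  have hAmem : ∀ n t, A n t ∈ charFunClass M := fun n t => eulerCurve_mem (hS' n) hF₀ t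
  have hAii : ∀ n θ a b, IntervalIntegrable (fun s => fourierField ν α (A n s) θ) volume a b :=
    fun n θ a b => intervalIntegrable_fourierField_eulerCurve hν (hS' n) hF₀ θ a b
  -- quantitative Cauchy estimate
  have hcauchy : ∀ T r : ℝ, 0 ≤ T → 0 ≤ r → ∃ C : ℝ, 0 ≤ C ∧ ∀ n m : ℕ, r ≤ n → r ≤ m →
      ∀ t ∈ Icc 0 T, ∀ θ ∈ {θ : ℝ | |θ| ≤ r},
        ‖A n t θ - A m t θ‖ ≤ C * (1 / ((n : ℝ) + 1) + 1 / ((m : ℝ) + 1)) := by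
    intro T r hT hr
    set c := T + (r ^ 2 * (M ^ 2 / (2 * Real.pi)) + ν * r ^ α * M) with hc
    have hc0 : 0 ≤ c := by positivity
    set L := r ^ 2 * M / Real.pi + ν * r ^ α with hL
    have hL0 : 0 ≤ L := by positivity
    refine ⟨c * Real.exp (L * T), by positivity, fun n m hn hm => ?_⟩
    have hg := gronwall_of_improving (S := {θ : ℝ | |θ| ≤ r}) (T := T)
      (D := fun t θ => ‖A n t θ - A m t θ‖) (A := c * (1 / ((n : ℝ) + 1) + 1 / ((m : ℝ) + 1)))
      (L := L) (K := 2 * M) hL0 (by positivity) ?_ (by positivity) ?_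
    · intro t ht θ hθ
      refine (hg t ht θ hθ).trans ?_
      have : Real.exp (L * t) ≤ Real.exp (L * T) := by
        apply Real.exp_le_exp.2
        exact mul_le_mul_of_nonneg_left ht.2 hL0
      calc _ ≤ c * (1 / ((n : ℝ) + 1) + 1 / ((m : ℝ) + 1)) * Real.exp (L * T) := by gcongr
        _ = _ := by ring
    · intro t _ θ _
      have h1 := charFunClass.norm_le (hAmem n t) θ
      have h2 := charFunClass.norm_le (hAmem m t) θ
      exact (norm_sub_le _ _).trans (by linarith)
    · intro b hb hDb t ht θ hθ
      have e1 := norm_eulerCurve_sub_integral_le hν h0 (hτ n) (hτε n) (hS n) hF₀ ht hθ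
        (hn.trans (by linarith))
      have e2 := norm_eulerCurve_sub_integral_le hν h0 (hτ m) (hτε m) (hS m) hF₀ ht hθ
        (hm.trans (by linarith))
      have e3 : ‖∫ s in (0 : ℝ)..t, (fourierField ν α (A n s) θ - fourierField ν α (A m s) θ)‖ ≤
          ∫ s in (0 : ℝ)..t, L * b s := by
        refine intervalIntegral.norm_integral_le_of_norm_le ht.1 ?_
          (Continuous.intervalIntegrable (by fun_prop) _ _)
        refine ae_of_all _ fun s hs => ?_
        have hs' : s ∈ Icc 0 T := ⟨hs.1.le, hs.2.trans ht.2⟩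
        exact norm_fourierField_sub_le hν h0 (hAmem n s) (hAmem m s) (fun θ' hθ' => hDb s hs' θ' hθ') hθ
      rw [intervalIntegral.integral_sub (hAii n θ 0 t) (hAii m θ 0 t),
        intervalIntegral.integral_const_mul] at e3
      calc ‖A n t θ - A m t θ‖ = ‖(A n t θ - F₀ θ - ∫ s in (0 : ℝ)..t, fourierField ν α (A n s) θ) -
            (A m t θ - F₀ θ - ∫ s in (0 : ℝ)..t, fourierField ν α (A m s) θ) +
            ((∫ s in (0 : ℝ)..t, fourierField ν α (A n s) θ) -
              ∫ s in (0 : ℝ)..t, fourierField ν α (A m s) θ)‖ := by congr 1; ring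
        _ ≤ c * (1 / ((n : ℝ) + 1)) + c * (1 / ((m : ℝ) + 1)) + L * ∫ s in (0 : ℝ)..t, b s :=
            (norm_add_le _ _).trans (add_le_add ((norm_sub_le _ _).trans (add_le_add e1 e2)) e3)
        _ = _ := by ring
  have hε0 : Tendsto (fun n : ℕ => 1 / ((n : ℝ) + 1)) atTop (𝓝 0) := tendsto_one_div_add_atTop_nhds_zero_nat
  have hlimex : ∀ t θ, ∃ z, Tendsto (fun n => A n t θ) atTop (𝓝 z) := by
    intro t θ
    rcases le_or_gt t 0 with ht | ht
    · refine ⟨F₀ θ, tendsto_const_nhds.congr fun n => ?_⟩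
      have : ⌊t / τ n⌋₊ = 0 := Nat.floor_of_nonpos (div_nonpos_of_nonpos_of_nonneg ht (hτ n).le)
      simp only [hA, eulerCurve, this]
      rfl
    · obtain ⟨C, hC0, hC⟩ := hcauchy t |θ| ht.le (abs_nonneg _)
      refine cauchySeq_tendsto_of_complete (Metric.cauchySeq_iff.2 fun ε hε => ?_)
      have hsmall : Tendsto (fun n : ℕ => C * (1 / ((n : ℝ) + 1) + 1 / ((n : ℝ) + 1))) atTop (𝓝 0) := by
        simpa using (hε0.add hε0).const_mul C
      obtain ⟨N, hN⟩ := eventually_atTop.1 (hsmall.eventually (gt_mem_nhds hε))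
      obtain ⟨N', hN'⟩ := exists_nat_ge |θ|
      refine ⟨max N N', fun m hm n hn => ?_⟩
      have hmN : (max N N' : ℕ) ≤ (m : ℝ) := by exact_mod_cast hm
      have hnN : (max N N' : ℕ) ≤ (n : ℝ) := by exact_mod_cast hn
      have hN'' : (N' : ℝ) ≤ (max N N' : ℕ) := by exact_mod_cast le_max_right _ _
      rw [dist_eq_norm]
      refine lt_of_le_of_lt (hC m n (by linarith) (by linarith) t ⟨ht.le, le_rfl⟩ θ (le_refl |θ|)) ?_
      refine lt_of_le_of_lt ?_ (hN (max N N') (le_max_left _ _))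
      gcongr
  choose F hF using hlimex
  have hFneg : ∀ t ≤ 0, F t = F₀ := by
    intro t ht
    ext θ
    refine tendsto_nhds_unique (hF t θ) (tendsto_const_nhds.congr fun n => ?_)
    have : ⌊t / τ n⌋₊ = 0 := Nat.floor_of_nonpos (div_nonpos_of_nonpos_of_nonneg ht (hτ n).le)
    simp only [hA, eulerCurve, this]
    rfl
  have hrate : ∀ T r : ℝ, 0 ≤ T → 0 ≤ r → ∃ C : ℝ, 0 ≤ C ∧ ∀ n : ℕ, r ≤ n →
      ∀ t ∈ Icc 0 T, ∀ θ, |θ| ≤ r → ‖A n t θ - F t θ‖ ≤ C * (1 / ((n : ℝ) + 1)) := by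
    intro T r hT hr
    obtain ⟨C, hC0, hC⟩ := hcauchy T r hT hr
    refine ⟨C, hC0, fun n hn t ht θ hθ => ?_⟩
    have l1 : Tendsto (fun m => ‖A n t θ - A m t θ‖) atTop (𝓝 ‖A n t θ - F t θ‖) :=
      (tendsto_const_nhds.sub (hF t θ)).norm
    have l2 : Tendsto (fun m : ℕ => C * (1 / ((n : ℝ) + 1) + 1 / ((m : ℝ) + 1))) atTop
        (𝓝 (C * (1 / ((n : ℝ) + 1) + 0))) := (hε0.const_add _).const_mul C
    rw [add_zero] at l2
    refine le_of_tendsto_of_tendsto l1 l2 ?_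
    obtain ⟨N', hN'⟩ := exists_nat_ge r
    filter_upwards [eventually_ge_atTop N'] with m hm
    have : (N' : ℝ) ≤ m := by exact_mod_cast hm
    exact hC n m hn (by linarith) t ht θ hθ
  have hFmem : ∀ t, F t ∈ charFunClass M := by
    intro t
    rcases le_or_gt t 0 with ht | ht
    · rw [hFneg t ht]; exact hF₀
    obtain ⟨C, hC0, hC⟩ := hrate t 1 ht.le zero_le_one
    -- Convergence is uniform for `|θ| ≤ 1`, which supplies the continuity at 0 required by Lévy's
    -- theorem; no mass escapes to infinity.
    have hcont : ContinuousAt (F t) 0 := by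
      have hu : TendstoUniformlyOn (fun n => A n t) (F t) atTop (Icc (-1) 1) := by
        rw [Metric.tendstoUniformlyOn_iff]
        intro ε hε
        have hsmall : Tendsto (fun n : ℕ => C * (1 / ((n : ℝ) + 1))) atTop (𝓝 0) := by
          simpa using hε0.const_mul C
        filter_upwards [hsmall.eventually (gt_mem_nhds hε), eventually_ge_atTop 1] with n hn hn1 θ hθ
        rw [dist_comm, dist_eq_norm]
        exact lt_of_le_of_lt (hC n (by exact_mod_cast hn1) t ⟨ht.le, le_rfl⟩ θ (abs_le.2 hθ)) hn
      have := hu.continuousOn (Frequently.of_forall fun n => (charFunClass.continuous (hAmem n t)).continuousOn)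
      exact this.continuousAt (Icc_mem_nhds (by norm_num) (by norm_num))
    obtain ⟨μ, hμ, hμF⟩ := exists_charFun_eq_of_tendsto (F := fun n => A n t) (f := F t)
      (fun n => by obtain ⟨μ, h1, -, h2⟩ := hAmem n t; exact ⟨μ, h1, h2⟩) (hF t) hcont
    refine ⟨μ, hμ, ?_, hμF⟩
    have h1 : ‖F t 0‖ ≤ M := le_of_tendsto (hF t 0).norm
      (Eventually.of_forall fun n => charFunClass.norm_le (hAmem n t) 0)
    rwa [← hμF, charFun_zero, Complex.norm_real, Real.norm_of_nonneg measureReal_nonneg] at h1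
  have hVlim : ∀ s, 0 ≤ s → ∀ θ, Tendsto (fun n => fourierField ν α (A n s) θ) atTop
      (𝓝 (fourierField ν α (F s) θ)) := by
    intro s hs θ
    obtain ⟨C, hC0, hC⟩ := hrate s |θ| hs (abs_nonneg _)
    rw [tendsto_iff_norm_sub_tendsto_zero]
    have hsmall : Tendsto (fun n : ℕ => (|θ| ^ 2 * M / Real.pi + ν * |θ| ^ α) * (C * (1 / ((n : ℝ) + 1))))
        atTop (𝓝 0) := by
      have := (hε0.const_mul C).const_mul (|θ| ^ 2 * M / Real.pi + ν * |θ| ^ α)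
      rwa [mul_zero, mul_zero] at this
    refine squeeze_zero' (Eventually.of_forall fun n => norm_nonneg _) ?_ hsmall
    obtain ⟨N', hN'⟩ := exists_nat_ge |θ|
    filter_upwards [eventually_ge_atTop N'] with n hn
    have : (N' : ℝ) ≤ n := by exact_mod_cast hn
    exact norm_fourierField_sub_le hν h0 (hAmem n s) (hFmem s)
      (fun θ' hθ' => hC n (by linarith) s ⟨hs, le_rfl⟩ θ' hθ') le_rfl
  have hVlim' : ∀ s θ, Tendsto (fun n => fourierField ν α (A n s) θ) atTop
      (𝓝 (fourierField ν α (F s) θ)) := by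
    intro s θ
    rcases le_or_gt 0 s with hs | hs
    · exact hVlim s hs θ
    · rw [hFneg s hs.le]
      refine tendsto_const_nhds.congr fun n => ?_
      have : ⌊s / τ n⌋₊ = 0 := Nat.floor_of_nonpos (div_nonpos_of_nonpos_of_nonneg hs.le (hτ n).le)
      simp only [hA, eulerCurve, this]
      rfl
  refine ⟨F, hFmem, hFneg, fun θ => ?_, fun t ht θ => ?_⟩
  · exact measurable_of_tendsto_metrizable (fun n => measurable_fourierField_eulerCurve θ)
      (tendsto_pi_nhds.2 fun s => hVlim' s θ)
  · have l1 : Tendsto (fun n => ∫ s in (0 : ℝ)..t, fourierField ν α (A n s) θ) atTop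
        (𝓝 (∫ s in (0 : ℝ)..t, fourierField ν α (F s) θ)) := by
      refine intervalIntegral.tendsto_integral_filter_of_dominated_convergence
        (fun _ => θ ^ 2 * (M ^ 2 / (2 * Real.pi)) + ν * |θ| ^ α * M) ?_ ?_ ?_ ?_
      · exact Eventually.of_forall fun n => (measurable_fourierField_eulerCurve θ).aestronglyMeasurable
      · exact Eventually.of_forall fun n => ae_of_all _ fun s _ => norm_fourierField_le hν (hAmem n s) θ
      · exact intervalIntegrable_const
      · exact ae_of_all _ fun s _ => hVlim' s θ
    have l2 : Tendsto (fun n => A n t θ - F₀ θ - ∫ s in (0 : ℝ)..t, fourierField ν α (A n s) θ) atTop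
        (𝓝 0) := by
      rw [tendsto_zero_iff_norm_tendsto_zero]
      have hsmall : Tendsto (fun n : ℕ => (t + (|θ| ^ 2 * (M ^ 2 / (2 * Real.pi)) + ν * |θ| ^ α * M)) *
          (1 / ((n : ℝ) + 1))) atTop (𝓝 0) := by simpa using hε0.const_mul _
      refine squeeze_zero' (Eventually.of_forall fun n => norm_nonneg _) ?_ hsmall
      obtain ⟨N', hN'⟩ := exists_nat_ge |θ|
      filter_upwards [eventually_ge_atTop N'] with n hn
      have : (N' : ℝ) ≤ n := by exact_mod_cast hn
      exact norm_eulerCurve_sub_integral_le hν h0 (hτ n) (hτε n) (hS n) hF₀ ⟨ht, le_rfl⟩ le_rfl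
        (by linarith)
    have l3 := tendsto_nhds_unique l2 (((hF t θ).sub_const (F₀ θ)).sub l1)
    linear_combination -l3

/-! ### Sign of the energy production -/

theorem charFunClass.neg {M : ℝ} {F : ℝ → ℂ} (hF : F ∈ charFunClass M) (θ : ℝ) :
    F (-θ) = conj (F θ) := by
  obtain ⟨μ, -, -, rfl⟩ := hF
  exact charFun_neg θ

theorem intervalIntegral_integral_swap_of_bounded {X E : Type*} [TopologicalSpace X]
    [SecondCountableTopology X] [MeasurableSpace X] [BorelSpace X] [NormedAddCommGroup E]
    [NormedSpace ℝ E] {μ : Measure X} [IsFiniteMeasure μ] {f : ℝ → X → E}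
    (hf : Continuous (Function.uncurry f)) {a b C : ℝ} (hab : a ≤ b)
    (hC : ∀ c ∈ Ioc a b, ∀ x, ‖f c x‖ ≤ C) :
    ∫ c in a..b, ∫ x, f c x ∂μ = ∫ x, (∫ c in a..b, f c x) ∂μ := by
  simp only [intervalIntegral.integral_of_le hab]
  refine integral_integral_swap (?_ : Integrable (Function.uncurry f) ((volume.restrict (Ioc a b)).prod μ))
  refine Integrable.of_bound (C := C) (hf.stronglyMeasurable.aestronglyMeasurable) ?_
  have : (volume.restrict (Ioc a b)).prod μ = (volume.prod μ).restrict (Ioc a b ×ˢ univ) := by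
    rw [← Measure.prod_restrict, Measure.restrict_univ]
  rw [this]
  exact ae_restrict_of_forall_mem (measurableSet_Ioc.prod MeasurableSet.univ)
    fun p hp => hC p.1 hp.1 p.2

theorem integral_id_mul_eq_sq_mul (u : ℝ → ℂ) (c : ℝ) :
    ∫ a in (0 : ℝ)..c, (a : ℂ) * u a = (c : ℂ) ^ 2 * ∫ s in (0 : ℝ)..1, (s : ℂ) * u (s * c) := by
  have h := intervalIntegral.smul_integral_comp_mul_right (a := 0) (b := 1)
    (fun a : ℝ => (a : ℂ) * u a) c
  rw [zero_mul, one_mul] at h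
  rw [← h, Complex.real_smul, sq, mul_assoc]
  congr 1
  rw [← intervalIntegral.integral_const_mul (μ := volume) (c : ℂ)]
  refine intervalIntegral.integral_congr fun s _ => ?_
  push_cast
  ring

/-- With `P(c) = ∫₀ᶜ a u(a) da = c² Q(c)` and `P' = c u`, the integrand is `(√(1+c²)/2c) (|P|²)'`.
Integration by parts leaves a nonnegative boundary term at `R` and minus the integral of `|P|²`
against the derivative of a decreasing weight. -/
theorem integral_sqrt_weight_nonneg {u : ℝ → ℂ} (hu : Continuous u) {R : ℝ} (hR : 0 ≤ R) :
    0 ≤ ∫ c in (0 : ℝ)..R, √(1 + c ^ 2) * (c ^ 2 *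
      (conj (u c) * ∫ s in (0 : ℝ)..1, (s : ℂ) * u (s * c)).re) := by
  set Q : ℝ → ℂ := fun c => ∫ s in (0 : ℝ)..1, (s : ℂ) * u (s * c) with hQ
  have hQc : Continuous Q := by
    refine intervalIntegral.continuous_parametric_intervalIntegral_of_continuous' ?_ _ _
    simp only [Function.uncurry_def]
    fun_prop
  have hw : ∀ c : ℝ, 0 < 1 + c ^ 2 := fun c => by positivity
  set P : ℝ → ℂ := fun c => ∫ a in (0 : ℝ)..c, (a : ℂ) * u a with hP
  have hPQ : ∀ c, P c = (c : ℂ) ^ 2 * Q c := fun c => integral_id_mul_eq_sq_mul u c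
  have hPd : ∀ c : ℝ, HasDerivAt P ((c : ℂ) * u c) c := fun c : ℝ =>
    (by fun_prop : Continuous fun a : ℝ => (a : ℂ) * u a).integral_hasStrictDerivAt 0 c |>.hasDerivAt
  have hwd : ∀ c : ℝ, HasDerivAt (fun c : ℝ => √(1 + c ^ 2)) (c / √(1 + c ^ 2)) c := fun c => by
    have h1 : HasDerivAt (fun c : ℝ => 1 + c ^ 2) (2 * c) c := by
      simpa using (hasDerivAt_pow 2 c).const_add 1
    convert h1.sqrt (hw c).ne' using 1
    field_simp
  -- This is `|P|² √(1+c²)/(2c)` in a form that is continuous at 0, where it vanishes.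
  set g : ℝ → ℝ := fun c => c ^ 3 * √(1 + c ^ 2) * ‖Q c‖ ^ 2 / 2 with hg
  have key := intervalIntegral.sub_le_integral_of_hasDeriv_right_of_le (g := g)
    (g' := fun c => (2 * inner ℝ (P c) ((c : ℂ) * u c)) * (√(1 + c ^ 2) / (2 * c)) +
      ‖P c‖ ^ 2 * (((c / √(1 + c ^ 2)) * (2 * c) - √(1 + c ^ 2) * 2) / (2 * c) ^ 2))
    (φ := fun c => √(1 + c ^ 2) * (c ^ 2 * (conj (u c) * Q c).re)) hR
    (by fun_prop) ?_ ?_ ?_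
  · refine le_trans ?_ key
    simp only [hg]
    have : 0 ≤ R ^ 3 * √(1 + R ^ 2) * ‖Q R‖ ^ 2 / 2 := by positivity
    simpa using this
  · intro c hc
    have h2c : HasDerivAt (fun c : ℝ => 2 * c) 2 c := by simpa using (hasDerivAt_id c).const_mul 2
    have h := (hPd c).norm_sq.mul ((hwd c).div h2c (by have := hc.1; positivity))
    refine (h.congr_of_eventuallyEq ?_).hasDerivWithinAt
    filter_upwards [lt_mem_nhds hc.1] with y hy
    simp only [hg, hPQ, Pi.mul_apply, Pi.div_apply, norm_mul, norm_pow, Complex.norm_real, Real.norm_eq_abs, abs_of_pos hy]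
    field_simp
  · refine Continuous.integrableOn_Icc ?_
    fun_prop
  · intro c hc
    have hc0 := hc.1
    have e1 : inner ℝ (P c) ((c : ℂ) * u c) = c ^ 3 * (conj (u c) * Q c).re := by
      rw [Complex.inner, hPQ]
      simp only [map_mul, Complex.conj_ofReal, Complex.mul_re, Complex.mul_im,
        Complex.conj_re, Complex.conj_im, ← Complex.ofReal_pow, Complex.ofReal_re, Complex.ofReal_im]
      ring
    have hs : 0 < √(1 + c ^ 2) := Real.sqrt_pos.2 (hw c)
    have hs2 : √(1 + c ^ 2) ^ 2 = 1 + c ^ 2 := Real.sq_sqrt (hw c).le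
    have e2 : ((c / √(1 + c ^ 2)) * (2 * c) - √(1 + c ^ 2) * 2) / (2 * c) ^ 2 ≤ 0 := by
      apply div_nonpos_of_nonpos_of_nonneg _ (by positivity)
      have : (c / √(1 + c ^ 2)) * (2 * c) - √(1 + c ^ 2) * 2 =
          (2 * c ^ 2 - 2 * √(1 + c ^ 2) ^ 2) / √(1 + c ^ 2) := by field_simp
      rw [this, hs2]
      apply div_nonpos_of_nonpos_of_nonneg _ hs.le
      linarith
    have e3 : ‖P c‖ ^ 2 * (((c / √(1 + c ^ 2)) * (2 * c) - √(1 + c ^ 2) * 2) / (2 * c) ^ 2) ≤ 0 :=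
      mul_nonpos_of_nonneg_of_nonpos (by positivity) e2
    have e4 : (2 * (c ^ 3 * (conj (u c) * Q c).re)) * (√(1 + c ^ 2) / (2 * c)) =
        √(1 + c ^ 2) * (c ^ 2 * (conj (u c) * Q c).re) := by field_simp
    rw [e1, e4]
    linarith

/-- Positivity of the measure enters here: writing `F((1-s)c) = ∫ e^{i(1-s)cx} dμ(x)` and absorbing
the phases in `u_x(c) = F(c)e^{-icx}` exhibits the integral as a `μ`-average of expressions covered
by `integral_sqrt_weight_nonneg`. Symmetry in `s` supplies the weight `s` needed there. -/
theorem integral_weight_nonlinear_nonneg {M : ℝ} {F : ℝ → ℂ} (hF : F ∈ charFunClass M) {R : ℝ}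
    (hR : 0 ≤ R) :
    0 ≤ ∫ c in (0 : ℝ)..R, √(1 + c ^ 2) * (c ^ 2 *
      (conj (F c) * ∫ s in (0 : ℝ)..1, F (s * c) * F ((1 - s) * c)).re) := by
  have hFc := charFunClass.continuous hF
  have hFM := charFunClass.norm_le hF
  have hM : 0 ≤ M := (norm_nonneg _).trans (hFM 0)
  obtain ⟨μ, hμ, hμM, rfl⟩ := hF
  set F := charFun μ with hFdef
  set u : ℝ → ℝ → ℂ := fun x c => F c * Complex.exp (-(c * x * Complex.I)) with hu
  have huc : ∀ x, Continuous (u x) := fun x => by simp only [hu]; fun_prop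
  have hexp : ∀ y : ℝ, ‖Complex.exp (-(y * Complex.I))‖ = 1 := fun y => by
    rw [← neg_mul, ← Complex.ofReal_neg, Complex.norm_exp_ofReal_mul_I]
  have huM : ∀ x c, ‖u x c‖ ≤ M := fun x c => by
    simp only [hu, norm_mul]
    rw [← Complex.ofReal_mul, hexp, mul_one]
    exact hFM c
  have key : ∀ c : ℝ, conj (F c) * ∫ s in (0 : ℝ)..1, F (s * c) * F ((1 - s) * c) =
      2 * ∫ x : ℝ, conj (u x c) * (∫ s in (0 : ℝ)..1, (s : ℂ) * u x (s * c)) ∂μ := by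
    intro c
    have h1 := integral_id_mul_of_symm (g := fun s => F (s * c) * F ((1 - s) * c)) (by fun_prop)
      (fun s => by rw [sub_sub_cancel, mul_comm])
    have h2 : ∫ s in (0 : ℝ)..1, F (s * c) * F ((1 - s) * c) =
        2 * ∫ s in (0 : ℝ)..1, (s : ℂ) * (F (s * c) * F ((1 - s) * c)) := by
      rw [h1]; ring
    have h3 : ∫ s in (0 : ℝ)..1, (s : ℂ) * (F (s * c) * F ((1 - s) * c)) =
        ∫ x : ℝ, (∫ s in (0 : ℝ)..1, (s : ℂ) * F (s * c) *
          Complex.exp (((1 - s) * c : ℝ) * x * Complex.I)) ∂μ := by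
      rw [← intervalIntegral_integral_swap_of_bounded (C := M)
        (f := fun (s x : ℝ) => (s : ℂ) * F (s * c) * Complex.exp (((1 - s) * c : ℝ) * x * Complex.I))
        (by fun_prop) zero_le_one]
      · refine intervalIntegral.integral_congr fun s _ => ?_
        rw [integral_const_mul, mul_assoc, ← charFun_apply_real]
      · intro s hs x
        rw [← Complex.ofReal_mul, norm_mul, Complex.norm_exp_ofReal_mul_I, mul_one, norm_mul,
          Complex.norm_real, Real.norm_of_nonneg hs.1.le]
        exact (mul_le_of_le_one_left (norm_nonneg _) hs.2).trans (hFM _)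
    rw [h2, h3, mul_left_comm, ← integral_const_mul]
    congr 1
    refine integral_congr_ae (ae_of_all _ fun x => ?_)
    simp only [← intervalIntegral.integral_const_mul]
    refine intervalIntegral.integral_congr fun s _ => ?_
    simp only [hu, map_mul, ← Complex.exp_conj, map_neg, Complex.conj_ofReal, Complex.conj_I]
    have : Complex.exp (((1 - s) * c : ℝ) * x * Complex.I) =
        Complex.exp (-(c * x * -Complex.I)) * Complex.exp (-(((s * c : ℝ) : ℂ) * x * Complex.I)) := by
      rw [← Complex.exp_add]; congr 1; push_cast; ring
    rw [this]; ring
  have hexN : ∃ N : ℝ → ℝ → ℂ, ∀ x c, ∫ s in (0 : ℝ)..1, (s : ℂ) * u x (s * c) = N x c :=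
    ⟨_, fun _ _ => rfl⟩
  obtain ⟨N, hN⟩ := hexN
  simp only [hN] at key
  set f : ℝ → ℝ → ℝ := fun c x => √(1 + c ^ 2) * (c ^ 2 * (conj (u x c) * N x c).re) with hf
  have hucont : Continuous fun p : ℝ × ℝ => u p.2 p.1 := by simp only [hu]; fun_prop
  have hQcont : Continuous fun p : ℝ × ℝ => N p.2 p.1 := by
    simp only [← hN]
    refine intervalIntegral.continuous_parametric_intervalIntegral_of_continuous' ?_ _ _
    simp only [Function.uncurry_def, hu]
    fun_prop
  have hfcont : Continuous (Function.uncurry f) := by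
    simp only [hf, Function.uncurry_def]
    have := Complex.continuous_re.comp ((Complex.continuous_conj.comp hucont).mul hQcont)
    exact (by fun_prop : Continuous fun p : ℝ × ℝ => √(1 + p.1 ^ 2)).mul
      ((by fun_prop : Continuous fun p : ℝ × ℝ => p.1 ^ 2).mul this)
  have hQM : ∀ x c, ‖N x c‖ ≤ M := fun x c => by
    rw [← hN]
    have := intervalIntegral.norm_integral_le_of_norm_le_const (a := (0 : ℝ)) (b := 1) (C := M)
      (f := fun s : ℝ => (s : ℂ) * u x (s * c)) fun s hs => ?_
    · simpa using this
    · rw [uIoc_of_le zero_le_one] at hs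
      rw [norm_mul, Complex.norm_real, Real.norm_of_nonneg hs.1.le]
      exact (mul_le_of_le_one_left (norm_nonneg _) hs.2).trans (huM _ _)
  have hconjint : ∀ c, Integrable (fun x => conj (u x c) * N x c) μ := by
    intro c
    have h1 : Continuous fun x => u x c := hucont.comp (by fun_prop : Continuous fun x : ℝ => (c, x))
    have h2 : Continuous fun x => N x c := hQcont.comp (by fun_prop : Continuous fun x : ℝ => (c, x))
    have hm : Continuous fun x => conj (u x c) * N x c := (Complex.continuous_conj.comp h1).mul h2
    refine Integrable.of_bound hm.aestronglyMeasurable (M * M) (ae_of_all _ fun x => ?_)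
    rw [norm_mul, RCLike.norm_conj]
    exact mul_le_mul (huM x c) (hQM x c) (norm_nonneg _) hM
  have hmain : ∫ c in (0 : ℝ)..R, √(1 + c ^ 2) * (c ^ 2 *
      (conj (F c) * ∫ s in (0 : ℝ)..1, F (s * c) * F ((1 - s) * c)).re) =
      2 * ∫ x, (∫ c in (0 : ℝ)..R, f c x) ∂μ := by
    rw [← intervalIntegral_integral_swap_of_bounded (C := √(1 + R ^ 2) * (R ^ 2 * (M * M))) hfcont hR,
      ← intervalIntegral.integral_const_mul]
    · refine intervalIntegral.integral_congr fun c _ => ?_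
      simp only [hf]
      rw [key, integral_const_mul, integral_const_mul, show ∀ z : ℂ, (2 * z).re = 2 * z.re from fun z => by simp,
        show (∫ x, (conj (u x c) * N x c).re ∂μ) =
          (∫ x, conj (u x c) * N x c ∂μ).re from
          integral_re (hconjint c)]
      ring
    · intro c hc x
      simp only [hf]
      rw [norm_mul, Real.norm_of_nonneg (Real.sqrt_nonneg _), norm_mul, Real.norm_of_nonneg (sq_nonneg c)]
      have h1 : ‖(conj (u x c) * N x c).re‖ ≤ M * M := by
        refine (Complex.abs_re_le_norm _).trans ?_
        rw [norm_mul, RCLike.norm_conj]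
        exact mul_le_mul (huM x c) (hQM x c) (norm_nonneg _) hM
      have h2 : c ^ 2 ≤ R ^ 2 := pow_le_pow_left₀ hc.1.le hc.2 2
      gcongr
  rw [hmain]
  have : 0 ≤ ∫ x, (∫ c in (0 : ℝ)..R, f c x) ∂μ := integral_nonneg fun x => by
    simp only [hf, ← hN]
    exact integral_sqrt_weight_nonneg (huc x) hR
  positivity

theorem integral_weight_mul_fourierField_nonpos {ν α M : ℝ} (hν : 0 ≤ ν) (h0 : 0 ≤ α) {F : ℝ → ℂ}
    (hF : F ∈ charFunClass M) {R : ℝ} (hR : 0 ≤ R) :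
    ∫ c in (0 : ℝ)..R, √(1 + c ^ 2) * (conj (F c) * fourierField ν α F c).re ≤ 0 := by
  have h := integral_weight_nonlinear_nonneg hF hR
  have hFc := charFunClass.continuous hF
  have hrc : Continuous fun c : ℝ => |c| ^ α := continuous_abs.rpow_const fun _ => Or.inr h0
  have hNc : Continuous fun c : ℝ => ∫ s in (0 : ℝ)..1, F (s * c) * F ((1 - s) * c) := by
    refine intervalIntegral.continuous_parametric_intervalIntegral_of_continuous' ?_ _ _
    simp only [Function.uncurry_def]
    fun_prop
  have hle : ∫ c in (0 : ℝ)..R, √(1 + c ^ 2) * (conj (F c) * fourierField ν α F c).re ≤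
      ∫ c in (0 : ℝ)..R, (-(1 / (2 * Real.pi))) * (√(1 + c ^ 2) * (c ^ 2 *
      (conj (F c) * ∫ s in (0 : ℝ)..1, F (s * c) * F ((1 - s) * c)).re)) := by
    refine intervalIntegral.integral_mono_on hR ?_ ?_ fun c _ => ?_
    · refine Continuous.intervalIntegrable ?_ _ _
      unfold fourierField
      fun_prop
    · refine Continuous.intervalIntegrable ?_ _ _
      fun_prop
    · have e : (conj (F c) * fourierField ν α F c).re = -(1 / (2 * Real.pi)) * (c ^ 2 *
          (conj (F c) * ∫ s in (0 : ℝ)..1, F (s * c) * F ((1 - s) * c)).re) -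
          ν * |c| ^ α * ‖F c‖ ^ 2 := by
        have : conj (F c) * fourierField ν α F c = ((-(1 / (2 * Real.pi)) * c ^ 2 : ℝ) : ℂ) *
            (conj (F c) * ∫ s in (0 : ℝ)..1, F (s * c) * F ((1 - s) * c)) -
            ((ν * |c| ^ α : ℝ) : ℂ) * (conj (F c) * F c) := by
          unfold fourierField; push_cast; ring
        rw [this, Complex.sub_re, Complex.re_ofReal_mul, Complex.conj_mul', ← Complex.ofReal_pow,
          ← Complex.ofReal_mul, Complex.ofReal_re]
        ring
      rw [e]
      have hpos : 0 ≤ √(1 + c ^ 2) * (ν * |c| ^ α * ‖F c‖ ^ 2) := by positivity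
      nlinarith
  refine hle.trans ?_
  rw [intervalIntegral.integral_const_mul]
  have : 0 ≤ 1 / (2 * Real.pi) := by have := Real.pi_pos; positivity
  nlinarith

/-! ### Time regularity and decay of the energy -/

/-- A curve of characteristic functions solving `∂ₜF = fourierField ν α F` for `t ≥ 0`, extended by
a constant to `t ≤ 0`. -/
structure IsCharFunSolution (ν α M : ℝ) (F : ℝ → ℝ → ℂ) : Prop where
  mem : ∀ t, F t ∈ charFunClass M
  of_nonpos : ∀ t ≤ 0, F t = F 0
  measurable_field : ∀ θ, Measurable fun s => fourierField ν α (F s) θ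
  eq_integral : ∀ t, 0 ≤ t → ∀ θ, F t θ = F 0 θ + ∫ s in (0 : ℝ)..t, fourierField ν α (F s) θ

namespace IsCharFunSolution

variable {ν α M : ℝ} {F : ℝ → ℝ → ℂ}

theorem norm_sub_le (h : IsCharFunSolution ν α M F) (hν : 0 ≤ ν) (t t' θ : ℝ) :
    ‖F t θ - F t' θ‖ ≤ (θ ^ 2 * (M ^ 2 / (2 * Real.pi)) + ν * |θ| ^ α * M) * |t - t'| := by
  have hb : ∀ s, ‖fourierField ν α (F s) θ‖ ≤ _ := fun s => norm_fourierField_le hν (h.mem s) θ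
  -- The constant extension to `t ≤ 0` makes `t ↦ max t 0`, which is 1-Lipschitz, transfer the bound
  -- to all real times.
  have hmax : ∀ t, F t = F (max t 0) := fun t => by
    rcases le_total t 0 with ht | ht
    · rw [max_eq_right ht, h.of_nonpos t ht]
    · rw [max_eq_left ht]
  have hii : ∀ a b, IntervalIntegrable (fun s => fourierField ν α (F s) θ) volume a b := fun a b =>
    intervalIntegrable_const.mono_fun' (h.measurable_field θ).aestronglyMeasurable (ae_of_all _ hb)
  have hpos := (norm_nonneg _).trans (hb 0)
  rw [hmax t, hmax t', h.eq_integral _ (le_max_right _ _), h.eq_integral _ (le_max_right _ _),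
    add_sub_add_left_eq_sub, intervalIntegral.integral_interval_sub_left (hii _ _) (hii _ _)]
  refine (intervalIntegral.norm_integral_le_of_norm_le_const fun s _ => hb s).trans ?_
  exact mul_le_mul_of_nonneg_left (abs_max_sub_max_le_abs t t' 0) hpos

theorem continuous_uncurry (h : IsCharFunSolution ν α M F) (hν : 0 ≤ ν) (h0 : 0 ≤ α) :
    Continuous fun p : ℝ × ℝ => F p.1 p.2 := by
  have hrc : Continuous fun c : ℝ => |c| ^ α := continuous_abs.rpow_const fun _ => Or.inr h0
  rw [continuous_iff_continuousAt]
  rintro ⟨t, θ⟩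
  rw [ContinuousAt, tendsto_iff_norm_sub_tendsto_zero]
  have hb : Continuous fun p : ℝ × ℝ => (p.2 ^ 2 * (M ^ 2 / (2 * Real.pi)) + ν * |p.2| ^ α * M) *
      |p.1 - t| + ‖F t p.2 - F t θ‖ := by
    have := charFunClass.continuous (h.mem t)
    fun_prop
  have hlim := hb.tendsto (t, θ)
  simp only [sub_self, abs_zero, mul_zero, norm_zero, add_zero] at hlim
  refine squeeze_zero (fun p => norm_nonneg _) (fun p => ?_) hlim
  refine (norm_sub_le_norm_sub_add_norm_sub _ (F t p.2) _).trans ?_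
  gcongr
  exact h.norm_sub_le hν _ _ _

theorem continuous_field (h : IsCharFunSolution ν α M F) (hν : 0 ≤ ν) (h0 : 0 ≤ α) :
    Continuous fun p : ℝ × ℝ => fourierField ν α (F p.1) p.2 := by
  have hrc : Continuous fun c : ℝ => |c| ^ α := continuous_abs.rpow_const fun _ => Or.inr h0
  have hc := h.continuous_uncurry hν h0
  unfold fourierField
  have hN : Continuous fun p : ℝ × ℝ => ∫ s in (0 : ℝ)..1, F p.1 (s * p.2) * F p.1 ((1 - s) * p.2) := by
    have h3 : Continuous fun q : (ℝ × ℝ) × ℝ =>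
        F q.1.1 (q.2 * q.1.2) * F q.1.1 ((1 - q.2) * q.1.2) :=
      (hc.comp (by fun_prop : Continuous fun q : (ℝ × ℝ) × ℝ => (q.1.1, q.2 * q.1.2))).mul
        (hc.comp (by fun_prop : Continuous fun q : (ℝ × ℝ) × ℝ => (q.1.1, (1 - q.2) * q.1.2)))
    exact intervalIntegral.continuous_parametric_intervalIntegral_of_continuous'
      (f := fun (p : ℝ × ℝ) (s : ℝ) => F p.1 (s * p.2) * F p.1 ((1 - s) * p.2)) h3 0 1
  have h1 : Continuous fun p : ℝ × ℝ => -((p.2 ^ 2 / (2 * Real.pi) : ℝ) : ℂ) := by fun_prop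
  have h2 : Continuous fun p : ℝ × ℝ => ((ν * |p.2| ^ α : ℝ) : ℂ) :=
    Complex.continuous_ofReal.comp ((hrc.comp continuous_snd).const_mul ν)
  exact (h1.mul hN).sub (h2.mul hc)

theorem continuous_left (h : IsCharFunSolution ν α M F) (hν : 0 ≤ ν) (h0 : 0 ≤ α) (θ : ℝ) :
    Continuous fun t => F t θ :=
  (h.continuous_uncurry hν h0).comp (by fun_prop : Continuous fun s : ℝ => (s, θ))

theorem continuous_field_left (h : IsCharFunSolution ν α M F) (hν : 0 ≤ ν) (h0 : 0 ≤ α) (θ : ℝ) :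
    Continuous fun s => fourierField ν α (F s) θ := by
  have key : ∀ G : ℝ × ℝ → ℂ, Continuous G → Continuous fun s => G (s, θ) := fun G hG => by fun_prop
  exact key (fun p => fourierField ν α (F p.1) p.2) (h.continuous_field hν h0)

theorem hasDerivAt (h : IsCharFunSolution ν α M F) (hν : 0 ≤ ν) (h0 : 0 ≤ α) {t : ℝ} (ht : 0 < t)
    (θ : ℝ) : HasDerivAt (fun t => F t θ) (fourierField ν α (F t) θ) t := by
  have hc := h.continuous_field_left hν h0 θ
  have := (hc.integral_hasStrictDerivAt 0 t).hasDerivAt.const_add (F 0 θ)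
  refine this.congr_of_eventuallyEq ?_
  filter_upwards [lt_mem_nhds ht] with s hs
  exact h.eq_integral s hs.le θ

/-- The truncated energy already decreases for each `R`: differentiate `|F|²` at fixed frequency,
integrate over frequency by Fubini on a bounded rectangle, and use the sign of the production on
`[0, R]`. -/
theorem energy_le (h : IsCharFunSolution ν α M F) (hν : 0 ≤ ν) (h0 : 0 ≤ α) {t R : ℝ} (ht : 0 ≤ t)
    (hR : 0 ≤ R) :
    ∫ θ in (0 : ℝ)..R, √(1 + θ ^ 2) * ‖F t θ‖ ^ 2 ≤ ∫ θ in (0 : ℝ)..R, √(1 + θ ^ 2) * ‖F 0 θ‖ ^ 2 := by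
  have hc := h.continuous_uncurry hν h0
  have hV := h.continuous_field hν h0
  have hct : ∀ t, Continuous (F t) := fun t => charFunClass.continuous (h.mem t)
  have hM : 0 ≤ M := (norm_nonneg _).trans (charFunClass.norm_le (h.mem 0) 0)
  set f : ℝ → ℝ → ℝ := fun θ s => √(1 + θ ^ 2) * (conj (F s θ) * fourierField ν α (F s) θ).re with hf
  have hfc : Continuous (Function.uncurry f) := by
    simp only [hf, Function.uncurry_def]
    have h1 := hc.comp continuous_swap
    have h2 := hV.comp continuous_swap
    exact (by fun_prop : Continuous fun p : ℝ × ℝ => √(1 + p.1 ^ 2)).mul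
      (Complex.continuous_re.comp ((Complex.continuous_conj.comp h1).mul h2))
  have hpt : ∀ θ, √(1 + θ ^ 2) * ‖F t θ‖ ^ 2 - √(1 + θ ^ 2) * ‖F 0 θ‖ ^ 2 =
      2 * ∫ s in (0 : ℝ)..t, f θ s := by
    intro θ
    have hcθ : Continuous fun s => F s θ := hc.comp (by fun_prop : Continuous fun s : ℝ => (s, θ))
    have hfθ : Continuous (f θ) := hfc.comp (by fun_prop : Continuous fun s : ℝ => (θ, s))
    have := intervalIntegral.integral_eq_sub_of_hasDeriv_right_of_le
      (f := fun s => √(1 + θ ^ 2) * ‖F s θ‖ ^ 2) (f' := fun s => 2 * f θ s) ht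
      (by fun_prop) (fun s hs => ?_) ((hfθ.const_mul 2).intervalIntegrable _ _)
    · rw [← this, intervalIntegral.integral_const_mul]
    · have hd := ((h.hasDerivAt hν h0 hs.1 θ).norm_sq).const_mul (√(1 + θ ^ 2))
      refine (hd.congr_deriv ?_).hasDerivWithinAt
      simp only [hf, Complex.inner]
      rw [mul_comm (conj _)]
      ring
  have hi : ∀ t, IntervalIntegrable (fun θ => √(1 + θ ^ 2) * ‖F t θ‖ ^ 2) volume 0 R := fun t => by
    have := hct t
    exact Continuous.intervalIntegrable (by fun_prop) _ _
  rw [← sub_nonpos, ← intervalIntegral.integral_sub (hi t) (hi 0)]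
  simp only [hpt, intervalIntegral.integral_const_mul]
  simp only [intervalIntegral.integral_of_le ht]
  rw [intervalIntegral_integral_swap_of_bounded (C := √(1 + R ^ 2) *
    (M * (R ^ 2 * (M ^ 2 / (2 * Real.pi)) + ν * |R| ^ α * M))) hfc hR]
  · have : ∫ s in Ioc 0 t, ∫ θ in (0 : ℝ)..R, f θ s ≤ 0 := integral_nonpos fun s =>
      integral_weight_mul_fourierField_nonpos hν h0 (h.mem s) hR
    linarith
  · intro θ hθ s
    have hpi := Real.pi_pos
    have habs : |θ| ≤ |R| := by rw [abs_of_pos hθ.1, abs_of_nonneg hR]; exact hθ.2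
    have hsq : θ ^ 2 ≤ R ^ 2 := sq_le_sq.2 habs
    simp only [hf]
    rw [norm_mul, Real.norm_of_nonneg (Real.sqrt_nonneg _)]
    refine mul_le_mul (Real.sqrt_le_sqrt (by linarith)) ?_ (norm_nonneg _) (Real.sqrt_nonneg _)
    refine (Complex.abs_re_le_norm _).trans ?_
    rw [norm_mul, RCLike.norm_conj]
    refine mul_le_mul (charFunClass.norm_le (h.mem s) θ) ?_ (norm_nonneg _) hM
    refine (norm_fourierField_le hν (h.mem s) θ).trans ?_
    gcongr

/-- Evenness of `|F|` and the scaling `θ = 2πξ` reduce to `energy_le`; exhaustion by bounded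
intervals gives the full norm, even if it is infinite. -/
theorem lintegral_energy_le (h : IsCharFunSolution ν α M F) (hν : 0 ≤ ν) (h0 : 0 ≤ α) {t : ℝ}
    (ht : 0 ≤ t) :
    ∫⁻ ξ, ‖F t (-(2 * Real.pi * ξ))‖ₑ ^ (2 : ℝ) ∂(sobolevMeasure (1 / 2)) ≤
      ∫⁻ ξ, ‖F 0 (-(2 * Real.pi * ξ))‖ₑ ^ (2 : ℝ) ∂(sobolevMeasure (1 / 2)) := by
  have hpi := Real.pi_pos
  have hwm : Measurable fun ξ : ℝ => ENNReal.ofReal ((1 + (2 * Real.pi * ξ) ^ 2) ^ (1 / 2 : ℝ)) := by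
    fun_prop
  have hcm : ∀ t, Measurable fun ξ => ‖F t (-(2 * Real.pi * ξ))‖ₑ ^ (2 : ℝ) := fun t => by
    have := (charFunClass.continuous (h.mem t)).measurable
    fun_prop
  have hexp : ∀ t, ∫⁻ ξ, ‖F t (-(2 * Real.pi * ξ))‖ₑ ^ (2 : ℝ) ∂(sobolevMeasure (1 / 2)) =
      ∫⁻ ξ, ENNReal.ofReal (√(1 + (2 * Real.pi * ξ) ^ 2) * ‖F t (2 * Real.pi * ξ)‖ ^ 2) := by
    intro t
    rw [sobolevMeasure, lintegral_withDensity_eq_lintegral_mul _ hwm (hcm t)]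
    refine lintegral_congr fun ξ => ?_
    rw [Pi.mul_apply, ENNReal.ofReal_mul (Real.sqrt_nonneg _), ← Real.sqrt_eq_rpow,
      charFunClass.neg (h.mem t), ENNReal.ofReal_pow (norm_nonneg _), ofReal_norm]
    congr 1
    rw [show (2 : ℝ) = ((2 : ℕ) : ℝ) by norm_num, ENNReal.rpow_natCast]
    congr 1
    simp [enorm_eq_nnnorm]
  rw [hexp, hexp]
  set g : ℝ → ℝ → ℝ := fun t ξ => √(1 + (2 * Real.pi * ξ) ^ 2) * ‖F t (2 * Real.pi * ξ)‖ ^ 2 with hg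
  have hgc : ∀ t, Continuous (g t) := fun t => by
    have := charFunClass.continuous (h.mem t)
    simp only [hg]; fun_prop
  have hg0 : ∀ t ξ, 0 ≤ g t ξ := fun t ξ => by positivity
  have hgneg : ∀ t ξ, g t (-ξ) = g t ξ := fun t ξ => by
    simp only [hg, mul_neg, charFunClass.neg (h.mem t), RCLike.norm_conj, neg_sq]
  have hgle : ∀ R, 0 ≤ R → ∫ ξ in (0 : ℝ)..R, g t ξ ≤ ∫ ξ in (0 : ℝ)..R, g 0 ξ := by
    intro R hR
    have hs : ∀ t, ∫ ξ in (0 : ℝ)..R, g t ξ = (2 * Real.pi)⁻¹ *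
        ∫ θ in (0 : ℝ)..2 * Real.pi * R, √(1 + θ ^ 2) * ‖F t θ‖ ^ 2 := fun t => by
      have := intervalIntegral.integral_comp_mul_left (a := 0) (b := R) (c := 2 * Real.pi)
        (fun θ => √(1 + θ ^ 2) * ‖F t θ‖ ^ 2) (by positivity)
      rw [mul_zero, smul_eq_mul] at this
      exact this
    rw [hs, hs]
    have := h.energy_le hν h0 ht (R := 2 * Real.pi * R) (by positivity)
    gcongr
  have hset : ∀ (t : ℝ) (n : ℕ), ∫⁻ ξ in Ioc (-(n : ℝ)) n, ENNReal.ofReal (g t ξ) =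
      ENNReal.ofReal (2 * ∫ ξ in (0 : ℝ)..n, g t ξ) := by
    intro t n
    have hii : ∀ a b, IntervalIntegrable (g t) volume a b := fun a b => (hgc t).intervalIntegrable _ _
    have hn : -(n : ℝ) ≤ n := by have : (0 : ℝ) ≤ n := by positivity
                                 linarith
    rw [← ofReal_integral_eq_lintegral_ofReal ((intervalIntegrable_iff_integrableOn_Ioc_of_le hn).1
      (hii _ _)) (ae_of_all _ (hg0 t)), ← intervalIntegral.integral_of_le hn,
      ← intervalIntegral.integral_add_adjacent_intervals (hii (-n) 0) (hii 0 n)]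
    congr 1
    have := intervalIntegral.integral_comp_neg (a := 0) (b := n) (g t)
    simp only [hgneg, neg_zero] at this
    rw [← this]; ring
  have hlim : ∀ t, ∫⁻ ξ, ENNReal.ofReal (g t ξ) =
      ⨆ n : ℕ, ∫⁻ ξ in Ioc (-(n : ℝ)) n, ENNReal.ofReal (g t ξ) := by
    intro t
    rw [← setLIntegral_iUnion_of_directed, ← setLIntegral_univ]
    · congr 2
      symm
      rw [eq_univ_iff_forall]
      intro x
      obtain ⟨n, hn⟩ := exists_nat_gt |x|
      rw [abs_lt] at hn
      exact mem_iUnion.2 ⟨n, hn.1, hn.2.le⟩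
    · refine Monotone.directed_le fun m n hmn => Ioc_subset_Ioc ?_ ?_
      · have : (m : ℝ) ≤ n := by exact_mod_cast hmn
        linarith
      · exact_mod_cast hmn
  rw [hlim, hlim]
  refine iSup_mono fun n => ?_
  rw [hset, hset]
  have := hgle n (by positivity)
  gcongr

end IsCharFunSolution

/-! ### From characteristic functions to measurable densities -/

theorem integral_fourierInv_eq_integral_mul_charFun {μ : Measure ℝ} [IsFiniteMeasure μ] {h : ℝ → ℂ}
    (hh : Integrable h) :
    ∫ x, 𝓕⁻ h x ∂μ = ∫ ξ, h ξ * charFun μ (2 * Real.pi * ξ) := by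
  have hint : Integrable (Function.uncurry fun x ξ : ℝ =>
      Complex.exp (((2 * Real.pi * ξ : ℝ) : ℂ) * x * Complex.I) * h ξ) (μ.prod volume) := by
    have h1 : Integrable (fun p : ℝ × ℝ => (1 : ℂ) * h p.2) (μ.prod volume) :=
      (integrable_const (1 : ℂ)).mul_prod hh
    refine Integrable.mono h1 ?_ (ae_of_all _ fun p => ?_)
    · refine AEStronglyMeasurable.mul ?_ hh.aestronglyMeasurable.comp_snd
      exact Continuous.aestronglyMeasurable (by fun_prop)
    · simp only [Function.uncurry, norm_mul, one_mul]
      rw [← Complex.ofReal_mul, Complex.norm_exp_ofReal_mul_I, one_mul]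
  have e1 : ∀ x, 𝓕⁻ h x = ∫ ξ : ℝ, Complex.exp (((2 * Real.pi * ξ : ℝ) : ℂ) * x * Complex.I) * h ξ := by
    intro x
    rw [Real.fourierInv_eq']
    refine integral_congr_ae (ae_of_all _ fun ξ => ?_)
    simp only [smul_eq_mul]
    congr 2
    simp only [RCLike.inner_apply, conj_trivial]
    push_cast
    ring
  simp_rw [e1]
  rw [integral_integral_swap hint]
  refine integral_congr_ae (ae_of_all _ fun ξ => ?_)
  simp only
  rw [integral_mul_const, mul_comm, charFun_apply_real]

/-- A real test function as a complex-valued Schwartz function. -/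
noncomputable def HasCompactSupport.toComplexSchwartz {φ : ℝ → ℝ} (h : HasCompactSupport φ)
    (hφ : ContDiff ℝ ∞ φ) : SchwartzMap ℝ ℂ :=
  HasCompactSupport.toSchwartzMap (f := fun x => (φ x : ℂ))
    (h.comp_left (g := fun y : ℝ => (y : ℂ)) Complex.ofReal_zero)
    (Complex.ofRealCLM.contDiff.comp hφ)

theorem integral_eq_integral_fourier_mul_charFun {μ : Measure ℝ} [IsFiniteMeasure μ]
    (φ : SchwartzMap ℝ ℂ) :
    ∫ x, φ x ∂μ = ∫ ξ, 𝓕 φ ξ * charFun μ (2 * Real.pi * ξ) := by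
  have h := integral_fourierInv_eq_integral_mul_charFun (μ := μ) (𝓕 φ).integrable
  rw [← h]
  refine integral_congr_ae (ae_of_all _ fun x => ?_)
  have : 𝓕⁻ (𝓕 φ) = φ := FourierTransform.fourierInv_fourier_eq φ
  rw [← SchwartzMap.fourierInv_coe, this]

theorem HasCompactSupport.toComplexSchwartz_apply {φ : ℝ → ℝ} (h : HasCompactSupport φ)
    (hφ : ContDiff ℝ ∞ φ) (x : ℝ) : h.toComplexSchwartz hφ x = (φ x : ℂ) := rfl

theorem norm_integral_schwartz_le {μ : Measure ℝ} [IsFiniteMeasure μ]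
    (hL2 : MemLp (fun ξ : ℝ => charFun μ (2 * Real.pi * ξ)) 2) (φ : SchwartzMap ℝ ℂ) :
    ‖∫ x, φ x ∂μ‖ ≤ √(∫ x, ‖φ x‖ ^ 2) * √(∫ ξ, ‖charFun μ (2 * Real.pi * ξ)‖ ^ 2) := by
  rw [integral_eq_integral_fourier_mul_charFun φ, ← SchwartzMap.integral_norm_sq_fourier φ,
    Real.sqrt_eq_rpow, Real.sqrt_eq_rpow]
  refine (norm_integral_le_integral_norm _).trans ?_
  simp only [norm_mul, ← Real.rpow_two]
  exact integral_mul_le_Lp_mul_Lq_of_nonneg Real.HolderConjugate.two_two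
    (ae_of_all _ fun _ => norm_nonneg _) (ae_of_all _ fun _ => norm_nonneg _)
    (by simpa using ((𝓕 φ).memLp 2 volume).norm) (by simpa using hL2.norm)

theorem exists_contDiff_cutoff {K U : Set ℝ} (hK : IsCompact K) (hU : IsOpen U) (hKU : K ⊆ U) :
    ∃ χ : ℝ → ℝ, ContDiff ℝ ∞ χ ∧ HasCompactSupport χ ∧ (∀ x, χ x ∈ Icc (0 : ℝ) 1) ∧
      (∀ x ∈ K, χ x = 1) ∧ ∀ x ∉ U, χ x = 0 := by
  obtain ⟨L, hL, hKL, hLU⟩ := exists_compact_between hK hU hKU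
  obtain ⟨χ, hχ0, hχ1, hχ⟩ := exists_contMDiffMap_zero_one_of_isClosed
    (n := ⊤) (modelWithCornersSelf ℝ ℝ) (s := (interior L)ᶜ) (t := K)
    isOpen_interior.isClosed_compl hK.isClosed (disjoint_compl_left_iff_subset.2 hKL)
  exact ⟨χ, χ.contMDiff.contDiff, HasCompactSupport.intro hL fun x hx =>
      hχ0 (fun h => hx (interior_subset h)), hχ, fun x hx => hχ1 hx,
    fun x hx => hχ0 (fun h => hx (hLU (interior_subset h)))⟩

/-- Parseval's formula and Cauchy–Schwarz bound `∫ χ dμ` by the `L²` norm of `χ`. A cutoff equal to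
1 on `K` and supported in a neighbourhood of measure less than `ε²` has `L²` norm at most `ε`. -/
theorem measureReal_le_of_memLp_charFun {μ : Measure ℝ} [IsFiniteMeasure μ]
    (hL2 : MemLp (fun ξ : ℝ => charFun μ (2 * Real.pi * ξ)) 2) {K : Set ℝ} (hK : IsCompact K)
    (hK0 : volume K = 0) {ε : ℝ} (hε : 0 < ε) :
    μ.real K ≤ ε * √(∫ ξ, ‖charFun μ (2 * Real.pi * ξ)‖ ^ 2) := by
  obtain ⟨U, hKU, hU, hUε⟩ := K.exists_isOpen_lt_add (μ := volume) (by rw [hK0]; simp)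
    (show ENNReal.ofReal (ε ^ 2) ≠ 0 by rw [Ne, ENNReal.ofReal_eq_zero]; exact not_le.2 (by positivity))
  rw [hK0, zero_add] at hUε
  obtain ⟨χ, hχs, hχc, hχ, hχ1, hχ0⟩ := exists_contDiff_cutoff hK hU hKU
  have hmain := norm_integral_schwartz_le hL2 (hχc.toComplexSchwartz hχs)
  simp only [HasCompactSupport.toComplexSchwartz_apply] at hmain
  rw [integral_complex_ofReal, Complex.norm_real] at hmain
  have h1 : μ.real K ≤ ∫ x, χ x ∂μ := by
    rw [← integral_indicator_one hK.measurableSet]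
    refine integral_mono ((integrable_const (1 : ℝ)).indicator hK.measurableSet)
      (hχs.continuous.integrable_of_hasCompactSupport hχc) fun x => ?_
    by_cases hx : x ∈ K
    · rw [indicator_of_mem hx, hχ1 x hx]; exact le_rfl
    · rw [indicator_of_notMem hx]; exact (hχ x).1
  have h3 : ∫ x, ‖(χ x : ℂ)‖ ^ 2 ≤ ε ^ 2 := by
    have hU' : volume.real U ≤ ε ^ 2 := ENNReal.toReal_le_of_le_ofReal (by positivity) hUε.le
    refine le_trans ?_ hU'
    simp only [Complex.norm_real, Real.norm_eq_abs, sq_abs]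
    rw [← integral_indicator_one hU.measurableSet]
    refine integral_mono ?_ ?_ fun x => ?_
    · have hc2 : HasCompactSupport fun x => χ x ^ 2 := hχc.comp_left (g := fun y : ℝ => y ^ 2) (by simp)
      exact (hχs.continuous.pow 2).integrable_of_hasCompactSupport hc2
    · have : IntegrableOn (fun _ : ℝ => (1 : ℝ)) U := integrableOn_const (hUε.trans_le le_top).ne
      exact this.integrable_indicator hU.measurableSet
    · by_cases hx : x ∈ U
      · rw [indicator_of_mem hx]
        have := hχ x
        simp only [Pi.one_apply]
        nlinarith [this.1, this.2]
      · rw [indicator_of_notMem hx, hχ0 x hx]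
        simp
  calc μ.real K ≤ _ := h1.trans ((le_abs_self _).trans hmain)
    _ ≤ _ := by
      gcongr
      exact Real.sqrt_le_iff.2 ⟨hε.le, h3⟩

theorem absolutelyContinuous_of_memLp_charFun {μ : Measure ℝ} [IsFiniteMeasure μ]
    (hL2 : MemLp (fun ξ : ℝ => charFun μ (2 * Real.pi * ξ)) 2) : μ ≪ volume := by
  refine Measure.AbsolutelyContinuous.mk fun N hN hN0 => ?_
  rw [hN.measure_eq_iSup_isCompact]
  simp only [ENNReal.iSup_eq_zero]
  intro K hKN hK
  have hle : μ.real K ≤ 0 := by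
    have hlim : Tendsto (fun ε : ℝ => ε * √(∫ ξ, ‖charFun μ (2 * Real.pi * ξ)‖ ^ 2)) (𝓝[>] 0)
        (𝓝 (0 * √(∫ ξ, ‖charFun μ (2 * Real.pi * ξ)‖ ^ 2))) :=
      ((continuous_id.mul continuous_const).tendsto 0).mono_left nhdsWithin_le_nhds
    rw [zero_mul] at hlim
    refine ge_of_tendsto hlim ?_
    filter_upwards [self_mem_nhdsWithin] with ε hε using
      measureReal_le_of_memLp_charFun hL2 hK (measure_mono_null hKN hN0) hε
  exact (measureReal_eq_zero_iff (measure_ne_top μ K)).1 (le_antisymm hle measureReal_nonneg)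

/-- Integrals of test functions are measurable in `t` by Parseval's formula; bump functions
converging to indicators of rational open intervals reach a generating π-system. -/
theorem measurable_of_continuous_charFun {κ : ℝ → Measure ℝ} [∀ t, IsFiniteMeasure (κ t)]
    (hκ : Continuous fun p : ℝ × ℝ => charFun (κ p.1) p.2) : Measurable κ := by
  have hint : ∀ φ : SchwartzMap ℝ ℂ, Measurable fun t => ∫ x, φ x ∂(κ t) := fun φ => by
    simp only [integral_eq_integral_fourier_mul_charFun φ]
    have hc : Continuous fun p : ℝ × ℝ => 𝓕 φ p.2 * charFun (κ p.1) (2 * Real.pi * p.2) :=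
      ((𝓕 φ).continuous.comp continuous_snd).mul
        (hκ.comp (by fun_prop : Continuous fun p : ℝ × ℝ => (p.1, 2 * Real.pi * p.2)))
    exact (hc.stronglyMeasurable.integral_prod_right (ν := volume)).measurable
  refine Measurable.measure_of_isPiSystem (BorelSpace.measurable_eq.trans Real.borel_eq_generateFrom_Ioo_rat)
    Real.isPiSystem_Ioo_rat ?_ ?_
  · intro s hs
    simp only [mem_iUnion, mem_singleton_iff, exists_prop] at hs
    obtain ⟨a, b, hab, rfl⟩ := hs
    have hab' : (a : ℝ) < b := by exact_mod_cast hab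
    set c : ℝ := (a + b) / 2 with hc
    set r : ℝ := (b - a) / 2 with hr
    have hr0 : 0 < r := by rw [hr]; linarith
    have hball : Ioo (a : ℝ) b = Metric.ball c r := by
      rw [Real.ball_eq_Ioo, hc, hr]; congr 1 <;> ring
    have hq : ∀ n : ℕ, (0 : ℝ) < 1 - 1 / ((n : ℝ) + 2) ∧ 1 - 1 / ((n : ℝ) + 2) < 1 := fun n => by
      have h2 : (0 : ℝ) < 1 / ((n : ℝ) + 2) := by positivity
      have h3 : 1 / ((n : ℝ) + 2) < 1 := by
        rw [div_lt_one (by positivity)]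
        have : (0 : ℝ) ≤ n := by positivity
        linarith
      constructor <;> linarith
    -- The shift by 2 keeps the inner radius positive already for `n = 0`.
    set χ : ℕ → ContDiffBump c := fun n =>
      ⟨r * (1 - 1 / ((n : ℝ) + 2)), r, mul_pos hr0 (hq n).1, mul_lt_of_lt_one_right hr0 (hq n).2⟩ with hχ
    have hm : Measurable fun t => (κ t).real (Ioo a b) := by
      refine measurable_of_tendsto_metrizable (f := fun n t => ∫ x, χ n x ∂(κ t)) (fun n => ?_) ?_
      · have := hint ((χ n).hasCompactSupport.toComplexSchwartz (χ n).contDiff)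
        have h2 : (fun t => ∫ x, χ n x ∂(κ t)) = fun t =>
            (∫ x, (χ n).hasCompactSupport.toComplexSchwartz (χ n).contDiff x ∂(κ t)).re := by
          ext t
          simp only [HasCompactSupport.toComplexSchwartz_apply]
          rw [integral_complex_ofReal, Complex.ofReal_re]
        rw [h2]
        exact Complex.measurable_re.comp this
      · refine tendsto_pi_nhds.2 fun t => ?_
        rw [← integral_indicator_one measurableSet_Ioo]
        refine tendsto_integral_of_dominated_convergence (fun _ => (1 : ℝ)) (fun n => ?_)
          (integrable_const _) (fun n => ae_of_all _ fun x => ?_) (ae_of_all _ fun x => ?_)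
        · exact (χ n).continuous.aestronglyMeasurable
        · rw [Real.norm_of_nonneg (χ n).nonneg]; exact (χ n).le_one
        · rw [hball]
          by_cases hx : x ∈ Metric.ball c r
          · rw [indicator_of_mem hx]
            refine tendsto_const_nhds.congr' ?_
            have hlim : Tendsto (fun n : ℕ => r * (1 - 1 / ((n : ℝ) + 2))) atTop (𝓝 (r * (1 - 0))) := by
              refine (tendsto_const_nhds.sub ?_).const_mul r
              refine tendsto_const_nhds.div_atTop ?_
              exact tendsto_atTop_add_const_right _ _ tendsto_natCast_atTop_atTop
            rw [sub_zero, mul_one] at hlim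
            filter_upwards [hlim.eventually (lt_mem_nhds hx)] with n hn
            exact ((χ n).one_of_mem_closedBall hn.le).symm
          · rw [indicator_of_notMem hx]
            refine tendsto_const_nhds.congr fun n => ?_
            exact ((χ n).zero_of_le_dist (not_lt.1 hx)).symm
    have : (fun t => κ t (Ioo a b)) = fun t => ENNReal.ofReal ((κ t).real (Ioo a b)) := by
      ext t; rw [ofReal_measureReal]
    rw [this]
    exact hm.ennreal_ofReal
  · have : (fun t => κ t univ) = fun t => ENNReal.ofReal ((charFun (κ t) 0).re) := by
      ext t; rw [charFun_zero, Complex.ofReal_re, ofReal_measureReal]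
    rw [this]
    have h1 : Continuous fun t => charFun (κ t) 0 := hκ.comp (by fun_prop : Continuous fun t : ℝ => (t, (0 : ℝ)))
    exact (Complex.continuous_re.comp h1).measurable.ennreal_ofReal

open ProbabilityTheory in
/-- A measurable family of absolutely continuous finite measures has a jointly measurable density. -/
theorem exists_measurable_density {k : Kernel ℝ ℝ} [IsFiniteKernel k] (hac : ∀ t, k t ≪ volume) :
    ∃ ρ : ℝ → ℝ → ℝ, Measurable (fun p : ℝ × ℝ => ρ p.1 p.2) ∧ (∀ t x, 0 ≤ ρ t x) ∧
      (∀ t, Integrable (ρ t)) ∧ ∀ t, k t = volume.withDensity fun x => ENNReal.ofReal (ρ t x) := by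
  obtain ⟨γ, hγP, w, hwm, hγd, hvolγ⟩ : ∃ γ : Measure ℝ, IsProbabilityMeasure γ ∧
      ∃ w : ℝ → ℝ≥0∞, Measurable w ∧ γ = volume.withDensity w ∧ volume ≪ γ := by
    -- A finite reference measure equivalent to Lebesgue measure allows the Radon–Nikodym derivative
    -- of finite kernels, jointly measurable in time and space; its density is multiplied back
    -- afterwards.
    refine ⟨gaussianReal 0 1, inferInstance, gaussianPDF 0 1, measurable_gaussianPDF 0 1,
      gaussianReal_of_var_ne_zero 0 one_ne_zero, ?_⟩
    rw [gaussianReal_of_var_ne_zero 0 one_ne_zero]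
    refine withDensity_absolutelyContinuous' (measurable_gaussianPDF 0 1).aemeasurable
      (ae_of_all _ fun x => ?_)
    exact (gaussianPDF_pos 0 one_ne_zero x).ne'
  have hr : ∀ t, k t = γ.withDensity (k.rnDeriv (Kernel.const ℝ γ) t) := fun t => by
    have h1 := Kernel.withDensity_rnDeriv_eq (κ := k) (η := Kernel.const ℝ γ) (a := t)
      ((hac t).trans hvolγ)
    rw [Kernel.withDensity_apply _ (k.measurable_rnDeriv _), Kernel.const_apply] at h1
    exact h1.symm
  have hrm := k.measurable_rnDeriv (Kernel.const ℝ γ)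
  generalize k.rnDeriv (Kernel.const ℝ γ) = r at hr hrm
  have hgm : Measurable fun p : ℝ × ℝ => w p.2 * r p.1 p.2 := (hwm.comp measurable_snd).mul hrm
  have hgmt : ∀ t, Measurable fun x => w x * r t x := fun t => hgm.comp measurable_prodMk_left
  have hκg : ∀ t, k t = volume.withDensity fun x => w x * r t x := fun t => by
    rw [hr t, hγd]
    exact (withDensity_mul _ hwm (hrm.comp measurable_prodMk_left)).symm
  have hgfin : ∀ t, ∫⁻ x, w x * r t x ≠ ⊤ := fun t => by
    have : k t univ = ∫⁻ x, w x * r t x := by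
      rw [hκg t, withDensity_apply _ MeasurableSet.univ, setLIntegral_univ]
    rw [← this]
    exact measure_ne_top _ _
  refine ⟨fun t x => (w x * r t x).toReal, hgm.ennreal_toReal, fun t x => ENNReal.toReal_nonneg,
    fun t => integrable_toReal_of_lintegral_ne_top (hgmt t).aemeasurable (hgfin t), fun t => ?_⟩
  rw [hκg t]
  refine withDensity_congr_ae ?_
  filter_upwards [ae_lt_top (hgmt t) (hgfin t)] with x hx
  rw [ENNReal.ofReal_toReal hx.ne]

/-! ### Curves in `L^p` and weak time derivatives -/

/-- The distance to a fixed element is measurable in `t` by Tonelli's theorem, and in the separable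
space `L^p`, `p < ∞`, every open set is a countable union of balls. -/
theorem stronglyMeasurable_toLp {E : Type*} [NormedAddCommGroup E] [MeasurableSpace E] [BorelSpace E]
    [SecondCountableTopology E] {p : ℝ≥0∞} [Fact (1 ≤ p)] [hp' : Fact (p ≠ ⊤)] {μ : Measure ℝ} [SFinite μ]
    {f : ℝ → ℝ → E} (hf : StronglyMeasurable fun q : ℝ × ℝ => f q.1 q.2) (hp : ∀ t, MemLp (f t) p μ) :
    StronglyMeasurable fun t => (hp t).toLp (f t) := by
  have hp1 : 1 ≤ p := Fact.out
  have hp0 : p ≠ 0 := (zero_lt_one.trans_le hp1).ne'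
  have hdist : ∀ u : Lp E p μ, Measurable fun t => dist ((hp t).toLp (f t)) u := by
    intro u
    have h1 : (fun t => dist ((hp t).toLp (f t)) u) = fun t =>
        ((∫⁻ x, ‖f t x - u x‖ₑ ^ p.toReal ∂μ) ^ (1 / p.toReal)).toReal := by
      ext t
      rw [Lp.dist_def, eLpNorm_congr_ae ((hp t).coeFn_toLp.sub (Filter.EventuallyEq.refl _ _)),
        eLpNorm_eq_lintegral_rpow_enorm_toReal hp0 hp'.out]
      rfl
    rw [h1]
    have h2 : StronglyMeasurable fun q : ℝ × ℝ => f q.1 q.2 - u q.2 :=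
      hf.sub ((Lp.stronglyMeasurable u).comp_measurable measurable_snd)
    have h3 : Measurable fun q : ℝ × ℝ => ‖f q.1 q.2 - u q.2‖ₑ ^ p.toReal := h2.enorm.pow_const _
    exact ((h3.lintegral_prod_right').pow_const _).ennreal_toReal
  borelize ↥(Lp E p μ)
  refine Measurable.stronglyMeasurable (measurable_of_isOpen fun U hU => ?_)
  obtain ⟨T, hTU, hT, hTeq⟩ := TopologicalSpace.isOpen_biUnion_countable
    {q : Lp E p μ × ℝ | Metric.ball q.1 q.2 ⊆ U} (fun q => Metric.ball q.1 q.2)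
    fun q _ => Metric.isOpen_ball
  have hU' : U = ⋃ q ∈ T, Metric.ball q.1 q.2 := by
    rw [hTeq]
    ext u
    simp only [mem_iUnion, Set.mem_ofPred_eq, exists_prop]
    constructor
    · intro hu
      obtain ⟨r, hr, hrU⟩ := Metric.isOpen_iff.1 hU u hu
      exact ⟨(u, r), hrU, Metric.mem_ball_self hr⟩
    · rintro ⟨q, hq, hu⟩
      exact hq hu
  rw [hU', preimage_iUnion₂]
  refine MeasurableSet.biUnion hT fun q _ => ?_
  exact measurableSet_lt (hdist q.1) measurable_const

theorem tendsto_eLpNorm_zero_of_dominated {ι : Type*} {l : Filter ι} [l.IsCountablyGenerated] {μ : Measure ℝ}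
    {p : ℝ≥0∞} (hp0 : p ≠ 0) (hp : p ≠ ⊤) {f : ι → ℝ → ℂ} {D : ℝ → ℝ} (hD : MemLp D p μ)
    (hf : ∀ i, AEStronglyMeasurable (f i) μ) (hb : ∀ᶠ i in l, ∀ᵐ x ∂μ, ‖f i x‖ ≤ D x)
    (hlim : ∀ᵐ x ∂μ, Tendsto (fun i => f i x) l (𝓝 0)) :
    Tendsto (fun i => eLpNorm (f i) p μ) l (𝓝 0) := by
  have hpp : 0 < p.toReal := ENNReal.toReal_pos hp0 hp
  simp only [eLpNorm_eq_lintegral_rpow_enorm_toReal hp0 hp]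
  have key : Tendsto (fun i => ∫⁻ x, ‖f i x‖ₑ ^ p.toReal ∂μ) l (𝓝 (∫⁻ _, 0 ∂μ)) := by
    refine tendsto_lintegral_filter_of_dominated_convergence' (fun x => ‖D x‖ₑ ^ p.toReal)
      (Eventually.of_forall fun i => (hf i).enorm.pow_const _) ?_ ?_ ?_
    · filter_upwards [hb] with i hi
      filter_upwards [hi] with x hx
      refine ENNReal.rpow_le_rpow ?_ hpp.le
      exact enorm_le_iff_norm_le.2 (hx.trans (le_abs_self _))
    · exact (lintegral_rpow_enorm_lt_top_of_eLpNorm_lt_top hp0 hp hD.2).ne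
    · filter_upwards [hlim] with x hx
      have h1 : Tendsto (fun i => ‖f i x‖ₑ) l (𝓝 0) := by simpa using hx.enorm
      have := (ENNReal.continuous_rpow_const (y := p.toReal)).tendsto 0 |>.comp h1
      simpa [ENNReal.zero_rpow_of_pos hpp, Function.comp_def] using this
  rw [lintegral_zero] at key
  have := (ENNReal.continuous_rpow_const (y := 1 / p.toReal)).tendsto 0 |>.comp key
  simpa [ENNReal.zero_rpow_of_pos (inv_pos.2 hpp), Function.comp_def] using this

/-- The difference quotients converge pointwise and, minus the limit, are dominated by `2D`, so they
converge in `L^p`. -/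
theorem hasDerivAt_toLp {μ : Measure ℝ} {p : ℝ≥0∞} [Fact (1 ≤ p)] [hp' : Fact (p ≠ ⊤)]
    {f : ℝ → ℝ → ℂ} {g : ℝ → ℂ} {D : ℝ → ℝ} {t : ℝ} (hf : ∀ t, MemLp (f t) p μ) (hg : MemLp g p μ)
    (hD : MemLp D p μ) (hfD : ∀ t' x, ‖f t' x - f t x‖ ≤ D x * |t' - t|) (hgD : ∀ x, ‖g x‖ ≤ D x)
    (hd : ∀ x, HasDerivAt (fun t => f t x) (g x) t) :
    HasDerivAt (fun t => (hf t).toLp (f t)) (hg.toLp g) t := by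
  have hp0 : p ≠ 0 := (zero_lt_one.trans_le (Fact.out : 1 ≤ p)).ne'
  rw [hasDerivAt_iff_tendsto_slope, tendsto_iff_norm_sub_tendsto_zero]
  have hq : ∀ t', MemLp ((t' - t)⁻¹ • (f t' - f t) - g) p μ := fun t' =>
    (((hf t').sub (hf t)).const_smul _).sub hg
  have he : ∀ t', ‖slope (fun t => (hf t).toLp (f t)) t t' - hg.toLp g‖ =
      (eLpNorm ((t' - t)⁻¹ • (f t' - f t) - g) p μ).toReal := fun t' => by
    rw [← Lp.norm_toLp _ (hq t'), slope_def_module]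
    rfl
  simp only [he]
  have := tendsto_eLpNorm_zero_of_dominated (l := 𝓝[≠] t) hp0 hp'.out
    (f := fun t' => (t' - t)⁻¹ • (f t' - f t) - g) (hD.const_smul (2 : ℝ))
    (fun t' => (hq t').1) ?_ ?_
  · exact (ENNReal.tendsto_toReal ENNReal.zero_ne_top).comp this
  · filter_upwards [self_mem_nhdsWithin] with t' ht'
    refine ae_of_all _ fun x => ?_
    have hne : 0 < |t' - t| := abs_pos.2 (sub_ne_zero.2 ht')
    simp only [Pi.sub_apply, Pi.smul_apply, smul_eq_mul]
    refine (norm_sub_le _ _).trans ?_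
    rw [norm_smul, norm_inv, Real.norm_eq_abs]
    have h1 : |t' - t|⁻¹ * ‖f t' x - f t x‖ ≤ D x := by
      rw [inv_mul_le_iff₀ hne, mul_comm]; exact hfD t' x
    linarith [hgD x]
  · refine ae_of_all _ fun x => ?_
    have := (hasDerivAt_iff_tendsto_slope.1 (hd x)).sub_const (g x)
    rw [sub_self] at this
    refine this.congr fun t' => ?_
    rw [slope_def_module]
    rfl

theorem isWeakTimeDeriv_of_hasDerivAt {X : Type*} [NormedAddCommGroup X] [NormedSpace ℝ X]
    {I : Set ℝ} {h g : ℝ → X} {C : ℝ} (hd : ∀ t ∈ I, HasDerivAt h (g t) t)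
    (hh : Continuous h) (hg : StronglyMeasurable g) (hC : ∀ t, ‖g t‖ ≤ C) : IsWeakTimeDeriv I h g := by
  intro ψ hψ hψc hψI
  have hψ' : Continuous (deriv ψ) := hψ.continuous_deriv (by simp)
  have hψ0 : ∀ t ∉ I, ψ t = 0 := fun t ht => image_eq_zero_of_notMem_tsupport fun h => ht (hψI h)
  have hψ0' : ∀ t ∉ I, deriv ψ t = 0 := fun t ht => by
    have : t ∉ tsupport (deriv ψ) := fun h => ht (hψI (tsupport_deriv_subset h))
    exact image_eq_zero_of_notMem_tsupport this
  rw [setIntegral_eq_integral_of_forall_compl_eq_zero fun t ht => by rw [hψ0' t ht, zero_smul],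
    setIntegral_eq_integral_of_forall_compl_eq_zero fun t ht => by rw [hψ0 t ht, zero_smul]]
  have i1 : Integrable fun t => deriv ψ t • h t :=
    (hψ'.smul hh).integrable_of_hasCompactSupport (hψc.deriv.smul_right)
  have i2 : Integrable fun t => ψ t • g t := by
    have h1 : Integrable fun t => |ψ t| * C :=
      ((hψ.continuous.integrable_of_hasCompactSupport hψc).abs).mul_const C
    refine h1.mono' (hψ.continuous.aestronglyMeasurable.smul hg.aestronglyMeasurable)
      (ae_of_all _ fun t => ?_)
    rw [norm_smul, Real.norm_eq_abs]
    exact mul_le_mul_of_nonneg_left (hC t) (abs_nonneg _)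
  have i3 : Integrable fun t => ψ t • h t :=
    (hψ.continuous.smul hh).integrable_of_hasCompactSupport (hψc.smul_right)
  have hderiv : ∀ t, HasDerivAt (fun t => ψ t • h t) (deriv ψ t • h t + ψ t • g t) t := by
    intro t
    have hψd : HasDerivAt ψ (deriv ψ t) t := (hψ.differentiable (by simp) t).hasDerivAt
    by_cases ht : t ∈ tsupport ψ
    · rw [add_comm]
      exact hψd.smul (hd t (hψI ht))
    · have h0 : ψ =ᶠ[𝓝 t] 0 := notMem_tsupport_iff_eventuallyEq.1 ht
      have e1 : ψ t = 0 := h0.eq_of_nhds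
      have e2 : deriv ψ t = 0 := by rw [h0.deriv_eq]; exact deriv_const t 0
      rw [e1, e2, zero_smul, zero_smul, add_zero]
      refine (hasDerivAt_const t (0 : X)).congr_of_eventuallyEq ?_
      filter_upwards [h0] with s hs
      rw [hs, Pi.zero_apply, zero_smul]
  have := integral_eq_zero_of_hasDerivAt_of_integrable hderiv (i1.add i2) i3
  rw [integral_add i1 i2] at this
  exact eq_neg_of_add_eq_zero_left this

/-! ### Densities of the solution and their function spaces -/

theorem charFun_withDensity_ofReal {f : ℝ → ℝ} (hf : Integrable f) (h0 : ∀ᵐ x, 0 ≤ f x) (ξ : ℝ) :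
    charFun (volume.withDensity fun x => ENNReal.ofReal (f x)) (-(2 * Real.pi * ξ)) = fourierReal f ξ := by
  rw [charFun_apply_real, integral_withDensity_eq_integral_toReal_smul₀
    hf.aestronglyMeasurable.aemeasurable.ennreal_ofReal (ae_of_all _ fun _ => ENNReal.ofReal_lt_top),
    fourierReal, Real.fourier_real_eq_integral_exp_smul]
  refine integral_congr_ae ?_
  filter_upwards [h0] with x hx
  rw [ENNReal.toReal_ofReal hx, Complex.real_smul, smul_eq_mul, mul_comm]
  congr 2
  push_cast
  ring

theorem integrable_withDensity_ofReal_iff {w : ℝ → ℝ} (hw : Measurable w) (h0 : ∀ x, 0 ≤ w x) {g : ℝ → ℝ} :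
    Integrable g (volume.withDensity fun x => ENNReal.ofReal (w x)) ↔ Integrable fun x => w x * g x := by
  rw [integrable_withDensity_iff_integrable_smul' hw.ennreal_ofReal
    (ae_of_all _ fun _ => ENNReal.ofReal_lt_top)]
  simp only [ENNReal.toReal_ofReal (h0 _), smul_eq_mul]

/-- Both symbols in `fourierField` grow at most quadratically. The square of `1 + θ²` against `(1 +
θ²)⁻³` leaves the integrable `(1 + θ²)⁻¹`, so the order `-3` suffices. -/
theorem memLp_sobolevMeasure_neg_three :
    MemLp (fun ξ : ℝ => 1 + (2 * Real.pi * ξ) ^ 2) 2 (sobolevMeasure (-3)) := by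
  have hm : Continuous fun ξ : ℝ => 1 + (2 * Real.pi * ξ) ^ 2 := by fun_prop
  rw [memLp_two_iff_integrable_sq hm.aestronglyMeasurable, sobolevMeasure,
    integrable_withDensity_ofReal_iff (by fun_prop) (fun ξ => by positivity)]
  have h1 := integrable_inv_one_add_sq.comp_mul_left' (R := 2 * Real.pi) (by have := Real.pi_pos; positivity)
  refine h1.congr (ae_of_all _ fun ξ => ?_)
  have hpos : 0 < 1 + (2 * Real.pi * ξ) ^ 2 := by positivity
  simp only
  generalize 1 + (2 * Real.pi * ξ) ^ 2 = y at hpos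
  rw [← Real.rpow_natCast _ 2, ← Real.rpow_add hpos, ← Real.rpow_neg_one]
  norm_num

theorem rpow_abs_le_one_add_sq {α : ℝ} (h0 : 0 ≤ α) (h2 : α ≤ 2) (θ : ℝ) : |θ| ^ α ≤ 1 + θ ^ 2 := by
  rcases le_total |θ| 1 with h | h
  · have := Real.rpow_le_one (abs_nonneg θ) h h0
    nlinarith [sq_nonneg θ]
  · have := Real.rpow_le_rpow_of_exponent_le h h2
    rw [Real.rpow_two, sq_abs] at this
    linarith

theorem norm_fourierField_le_one_add_sq {ν α M : ℝ} (hν : 0 ≤ ν) (h0 : 0 ≤ α) (h2 : α ≤ 2) {F : ℝ → ℂ}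
    (hF : F ∈ charFunClass M) (θ : ℝ) :
    ‖fourierField ν α F θ‖ ≤ (M ^ 2 / (2 * Real.pi) + ν * M) * (1 + θ ^ 2) := by
  have hM : 0 ≤ M := (norm_nonneg _).trans (charFunClass.norm_le hF 0)
  have hpi := Real.pi_pos
  have h3 := rpow_abs_le_one_add_sq h0 h2 θ
  have h4 : ν * |θ| ^ α * M ≤ ν * (1 + θ ^ 2) * M := by gcongr
  have h5 : θ ^ 2 * (M ^ 2 / (2 * Real.pi)) ≤ (1 + θ ^ 2) * (M ^ 2 / (2 * Real.pi)) := by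
    gcongr; linarith
  linarith [norm_fourierField_le (α := α) hν hF θ]

/-- A curve `ρ` of densities whose characteristic functions `F` have finite energy and solve the
equation on the Fourier side. -/
structure IsDensitySolution (ν α M : ℝ) (F : ℝ → ℝ → ℂ) (ρ : ℝ → ℝ → ℝ) : Prop
    extends IsCharFunSolution ν α M F where
  measurable : Measurable fun p : ℝ × ℝ => ρ p.1 p.2
  nonneg : ∀ t x, 0 ≤ ρ t x
  integrable : ∀ t, Integrable (ρ t)
  charFun_eq : ∀ t, charFun (volume.withDensity fun x => ENNReal.ofReal (ρ t x)) = F t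
  energy_lt_top : eLpNorm (fun ξ => F 0 (-(2 * Real.pi * ξ))) 2 (sobolevMeasure (1 / 2)) < ⊤

theorem IsCharFunSolution.eLpNorm_le {ν α M : ℝ} {F : ℝ → ℝ → ℂ} (h : IsCharFunSolution ν α M F)
    (hν : 0 ≤ ν) (h0 : 0 ≤ α) (t : ℝ) :
    eLpNorm (fun ξ => F t (-(2 * Real.pi * ξ))) 2 (sobolevMeasure (1 / 2)) ≤
      eLpNorm (fun ξ => F 0 (-(2 * Real.pi * ξ))) 2 (sobolevMeasure (1 / 2)) := by
  rcases le_total t 0 with ht | ht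
  · rw [h.of_nonpos t ht]
  · simp only [eLpNorm_eq_lintegral_rpow_enorm_toReal two_ne_zero ENNReal.ofNat_ne_top,
      ENNReal.toReal_ofNat]
    gcongr ?_ ^ _
    exact h.lintegral_energy_le hν h0 ht

theorem volume_le_sobolevMeasure {s : ℝ} (hs : 0 ≤ s) : volume ≤ sobolevMeasure s := by
  rw [sobolevMeasure]
  conv_lhs => rw [← withDensity_one (μ := (volume : Measure ℝ))]
  refine withDensity_mono (ae_of_all _ fun ξ => ?_)
  rw [Pi.one_apply, ← ENNReal.ofReal_one]
  exact ENNReal.ofReal_le_ofReal (Real.one_le_rpow (by nlinarith [sq_nonneg (2 * Real.pi * ξ)]) hs)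

theorem exists_isDensitySolution {ν α : ℝ} (hν : 0 ≤ ν) (h0 : 0 ≤ α) (h2 : α ≤ 2) {ρ₀ : ℝ → ℝ}
    (h_nonneg : ∀ᵐ x, 0 ≤ ρ₀ x) (h_L1 : Integrable ρ₀) (h_Sobolev : sobolevNorm (1 / 2) ρ₀ < ⊤) :
    ∃ F ρ, IsDensitySolution ν α (∫ x, ρ₀ x) F ρ ∧
      F 0 = charFun (volume.withDensity fun x => ENNReal.ofReal (ρ₀ x)) := by
  set M := ∫ x, ρ₀ x with hM
  set μ₀ := volume.withDensity fun x => ENNReal.ofReal (ρ₀ x) with hμ₀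
  have hμ₀f : IsFiniteMeasure μ₀ := isFiniteMeasure_withDensity_ofReal h_L1.2
  have hF₀ : charFun μ₀ ∈ charFunClass M := by
    refine ⟨μ₀, hμ₀f, ?_, rfl⟩
    rw [Measure.real, hμ₀, withDensity_apply _ MeasurableSet.univ, setLIntegral_univ,
      ← ofReal_integral_eq_lintegral_ofReal h_L1 h_nonneg,
      ENNReal.toReal_ofReal (integral_nonneg_of_ae h_nonneg)]
  obtain ⟨F, hmem, hneg, hmeas, heq⟩ := exists_charFun_solution (ν := ν) (α := α) hν h0 h2 hF₀
  have hF0 : F 0 = charFun μ₀ := hneg 0 le_rfl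
  have hsol : IsCharFunSolution ν α M F :=
    ⟨hmem, fun t ht => by rw [hneg t ht, hF0], hmeas, fun t ht θ => by rw [hF0]; exact heq t ht θ⟩
  have hen : eLpNorm (fun ξ => F 0 (-(2 * Real.pi * ξ))) 2 (sobolevMeasure (1 / 2)) < ⊤ := by
    simp only [hF0, hμ₀, charFun_withDensity_ofReal h_L1 h_nonneg]
    exact h_Sobolev
  choose κ hκf hκM hκF using hmem
  have hκm : Measurable κ := by
    refine measurable_of_continuous_charFun ?_
    simp only [hκF]
    exact hsol.continuous_uncurry hν h0
  set k : ProbabilityTheory.Kernel ℝ ℝ := ⟨κ, hκm⟩ with hk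
  have hkt : ∀ t, k t = κ t := fun t => rfl
  have : ProbabilityTheory.IsFiniteKernel k := ⟨⟨ENNReal.ofReal M, ENNReal.ofReal_lt_top, fun t => by
    rw [hkt, ← ofReal_measureReal (μ := κ t)]
    exact ENNReal.ofReal_le_ofReal (hκM t)⟩⟩
  have hac : ∀ t, k t ≪ volume := by
    intro t
    rw [hkt]
    refine absolutelyContinuous_of_memLp_charFun ?_
    rw [hκF]
    have hc := charFunClass.continuous (hsol.mem t)
    -- The `H^{1/2}` measure dominates Lebesgue measure, so finite energy gives square
    -- integrability; the opposite sign of frequency only conjugates.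
    have h1 : MemLp (fun ξ => F t (-(2 * Real.pi * ξ))) 2 :=
      MemLp.mono_measure (volume_le_sobolevMeasure (by norm_num))
        ⟨(by fun_prop : Continuous fun ξ => F t (-(2 * Real.pi * ξ))).aestronglyMeasurable,
          (hsol.eLpNorm_le hν h0 t).trans_lt hen⟩
    refine h1.congr_norm (by fun_prop : Continuous fun ξ => F t (2 * Real.pi * ξ)).aestronglyMeasurable
      (ae_of_all _ fun ξ => ?_)
    rw [charFunClass.neg (hsol.mem t), RCLike.norm_conj]
  obtain ⟨ρ, h1, h2, h3, h4⟩ := exists_measurable_density hac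
  exact ⟨F, ρ, ⟨hsol, h1, h2, h3, fun t => by rw [← h4, hkt, hκF], hen⟩, hF0⟩

/-- The single majorant `W` controls the values, the derivative and the time Lipschitz constant at
every frequency, so pointwise differentiability lifts to norm differentiability in `L²`. -/
theorem exists_weakTimeDeriv_toLp {μ : Measure ℝ} [SFinite μ] {W : ℝ → ℝ} (hWL : MemLp W 2 μ)
    (hW0 : ∀ ξ, 0 ≤ W ξ) {f g : ℝ → ℝ → ℂ} {I : Set ℝ} {M A : ℝ}
    (hfc : Continuous fun q : ℝ × ℝ => f q.1 q.2) (hgc : Continuous fun q : ℝ × ℝ => g q.1 q.2)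
    (hfb : ∀ t ξ, ‖f t ξ‖ ≤ M * W ξ) (hgb : ∀ t ξ, ‖g t ξ‖ ≤ A * W ξ)
    (hfD : ∀ t t' ξ, ‖f t' ξ - f t ξ‖ ≤ A * W ξ * |t' - t|)
    (hd : ∀ t ∈ I, ∀ ξ, HasDerivAt (fun t => f t ξ) (g t ξ) t) :
    ∃ h k : ℝ → Lp ℂ 2 μ, (∀ t, h t =ᵐ[μ] f t) ∧ Continuous h ∧ MemLp h ∞ (volume.restrict I) ∧
      MemLp k ∞ (volume.restrict I) ∧ IsWeakTimeDeriv I h k := by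
  have : Fact ((2 : ℝ≥0∞) ≠ ⊤) := ⟨ENNReal.ofNat_ne_top⟩
  have hfct : ∀ t, Continuous (f t) := fun t => hfc.comp (by fun_prop : Continuous fun ξ : ℝ => (t, ξ))
  have hgct : ∀ t, Continuous (g t) := fun t => hgc.comp (by fun_prop : Continuous fun ξ : ℝ => (t, ξ))
  have hfL : ∀ t, MemLp (f t) 2 μ := fun t =>
    (hWL.const_mul M).mono' (hfct t).aestronglyMeasurable (ae_of_all _ (hfb t))
  have hgL : ∀ t, MemLp (g t) 2 μ := fun t =>
    (hWL.const_mul A).mono' (hgct t).aestronglyMeasurable (ae_of_all _ (hgb t))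
  have hbound : ∀ (u : ℝ → ℂ) (hu : MemLp u 2 μ) (c : ℝ), (∀ ξ, ‖u ξ‖ ≤ c * W ξ) →
      ‖hu.toLp u‖ ≤ c * ‖hWL.toLp W‖ := by
    intro u hu c huc
    refine Lp.norm_le_mul_norm_of_ae_le_mul ?_
    filter_upwards [hu.coeFn_toLp, hWL.coeFn_toLp] with ξ h1 h2
    rw [h1, h2]
    exact (huc ξ).trans_eq (by rw [Real.norm_of_nonneg (hW0 ξ)])
  have hmeas_g := stronglyMeasurable_toLp hgc.stronglyMeasurable hgL
  have hcont : Continuous fun t => (hfL t).toLp (f t) := by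
    rw [continuous_iff_continuousAt]
    intro t
    rw [ContinuousAt, tendsto_iff_norm_sub_tendsto_zero]
    have hlim : Tendsto (fun t' : ℝ => A * |t' - t| * ‖hWL.toLp W‖) (𝓝 t) (𝓝 0) := by
      have : Continuous fun t' : ℝ => A * |t' - t| * ‖hWL.toLp W‖ := by fun_prop
      simpa using this.tendsto t
    refine squeeze_zero (fun _ => norm_nonneg _) (fun t' => ?_) hlim
    rw [← MemLp.toLp_sub]
    refine hbound _ _ _ fun ξ => ?_
    rw [Pi.sub_apply]
    exact (hfD t t' ξ).trans_eq (by ring)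
  refine ⟨fun t => (hfL t).toLp (f t), fun t => (hgL t).toLp (g t), fun t => (hfL t).coeFn_toLp,
    hcont, ?_, ?_, ?_⟩
  · exact memLp_top_of_bound hcont.aestronglyMeasurable (M * ‖hWL.toLp W‖)
      (ae_of_all _ fun t => hbound _ _ _ (hfb t))
  · exact memLp_top_of_bound hmeas_g.aestronglyMeasurable (A * ‖hWL.toLp W‖)
      (ae_of_all _ fun t => hbound _ _ _ (hgb t))
  · exact isWeakTimeDeriv_of_hasDerivAt (fun t ht => hasDerivAt_toLp hfL (hgL t) (hWL.const_mul A)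
      (hfD t) (hgb t) (hd t ht)) hcont hmeas_g fun t => hbound _ _ _ (hgb t)

namespace IsDensitySolution

variable {ν α M : ℝ} {F : ℝ → ℝ → ℂ} {ρ : ℝ → ℝ → ℝ}

theorem fourierReal_eq (h : IsDensitySolution ν α M F ρ) (t ξ : ℝ) :
    fourierReal (ρ t) ξ = F t (-(2 * Real.pi * ξ)) := by
  rw [← h.charFun_eq, charFun_withDensity_ofReal (h.integrable t) (ae_of_all _ (h.nonneg t))]

theorem M_nonneg (h : IsDensitySolution ν α M F ρ) : 0 ≤ M :=
  (norm_nonneg _).trans (charFunClass.norm_le (h.mem 0) 0)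

theorem eLpNorm_one_le (h : IsDensitySolution ν α M F ρ) (t : ℝ) :
    eLpNorm (ρ t) 1 volume ≤ ENNReal.ofReal M := by
  have h1 := charFunClass.norm_le (h.mem t) 0
  have hf : IsFiniteMeasure (volume.withDensity fun x => ENNReal.ofReal (ρ t x)) :=
    isFiniteMeasure_withDensity_ofReal (h.integrable t).2
  rw [← h.charFun_eq, charFun_zero, Complex.norm_real, Real.norm_of_nonneg measureReal_nonneg,
    Measure.real, withDensity_apply _ MeasurableSet.univ, setLIntegral_univ] at h1
  rw [eLpNorm_one_eq_lintegral_enorm]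
  have h2 : ∫⁻ x, ‖ρ t x‖ₑ = ∫⁻ x, ENNReal.ofReal (ρ t x) :=
    lintegral_congr fun x => Real.enorm_of_nonneg (h.nonneg t x)
  rw [h2]
  refine ENNReal.le_ofReal_iff_toReal_le ?_ h.M_nonneg |>.2 h1
  rw [← h2]
  exact (h.integrable t).2.ne

theorem memLInftyL1 (h : IsDensitySolution ν α M F ρ) (I : Set ℝ) : MemLInftyL1 I ρ := by
  have hp : ∀ t, MemLp (ρ t) 1 volume := fun t => memLp_one_iff_integrable.2 (h.integrable t)
  have : Fact ((1 : ℝ≥0∞) ≠ ⊤) := ⟨ENNReal.one_ne_top⟩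
  refine ⟨fun t => (hp t).toLp (ρ t), ae_of_all _ fun t => (hp t).coeFn_toLp, ?_⟩
  refine memLp_top_of_bound
    (stronglyMeasurable_toLp h.measurable.stronglyMeasurable hp).aestronglyMeasurable M
    (ae_of_all _ fun t => ?_)
  rw [Lp.norm_toLp]
  exact ENNReal.toReal_le_of_le_ofReal h.M_nonneg (h.eLpNorm_one_le t)

theorem memLInftySobolev (h : IsDensitySolution ν α M F ρ) (hν : 0 ≤ ν) (h0 : 0 ≤ α) (I : Set ℝ) :
    MemLInftySobolev (1 / 2) I ρ := by
  have hc := h.continuous_uncurry hν h0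
  have hp : ∀ t, MemLp (fun ξ => F t (-(2 * Real.pi * ξ))) 2 (sobolevMeasure (1 / 2)) := fun t =>
    ⟨(hc.comp (by fun_prop : Continuous fun ξ : ℝ => (t, -(2 * Real.pi * ξ)))).aestronglyMeasurable,
      (h.eLpNorm_le hν h0 t).trans_lt h.energy_lt_top⟩
  have : Fact ((2 : ℝ≥0∞) ≠ ⊤) := ⟨ENNReal.ofNat_ne_top⟩
  have : SFinite (sobolevMeasure (1 / 2)) := by unfold sobolevMeasure; infer_instance
  refine ⟨fun t => (hp t).toLp _, ae_of_all _ fun t => ⟨h.integrable t, ?_⟩, ?_⟩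
  · filter_upwards [(hp t).coeFn_toLp] with ξ hξ
    rw [hξ, h.fourierReal_eq]
  · refine memLp_top_of_bound (stronglyMeasurable_toLp (f := fun t ξ => F t (-(2 * Real.pi * ξ)))
      (hc.comp (by fun_prop : Continuous fun q : ℝ × ℝ => (q.1, -(2 * Real.pi * q.2)))).stronglyMeasurable
      hp).aestronglyMeasurable
      (eLpNorm (fun ξ => F 0 (-(2 * Real.pi * ξ))) 2 (sobolevMeasure (1 / 2))).toReal
      (ae_of_all _ fun t => ?_)
    rw [Lp.norm_toLp]
    exact ENNReal.toReal_mono h.energy_lt_top.ne (h.eLpNorm_le hν h0 t)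

/-- The majorant is `1 + (2πξ)²`. Positive times are required because the constant extension to `t ≤
0` need not be differentiable at 0. -/
theorem memW1InftySobolev (h : IsDensitySolution ν α M F ρ) (hν : 0 ≤ ν) (h0 : 0 ≤ α) (h2 : α ≤ 2)
    {I : Set ℝ} (hI : I ⊆ Ioi 0) : MemW1InftySobolev (-3) I ρ := by
  have hpi := Real.pi_pos
  have hM := h.M_nonneg
  have hlin : Continuous fun q : ℝ × ℝ => (q.1, -(2 * Real.pi * q.2)) := by fun_prop
  have hW1 : ∀ ξ : ℝ, 1 ≤ 1 + (2 * Real.pi * ξ) ^ 2 := fun ξ => by nlinarith [sq_nonneg (2 * Real.pi * ξ)]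
  have : SFinite (sobolevMeasure (-3)) := by unfold sobolevMeasure; infer_instance
  have hfD : ∀ t t' ξ, ‖F t' (-(2 * Real.pi * ξ)) - F t (-(2 * Real.pi * ξ))‖ ≤
      (M ^ 2 / (2 * Real.pi) + ν * M) * (1 + (2 * Real.pi * ξ) ^ 2) * |t' - t| := by
    intro t t' ξ
    refine (h.norm_sub_le hν t' t (-(2 * Real.pi * ξ))).trans ?_
    gcongr
    have h3 := rpow_abs_le_one_add_sq h0 h2 (-(2 * Real.pi * ξ))
    have h4 : ν * |-(2 * Real.pi * ξ)| ^ α * M ≤ ν * (1 + (-(2 * Real.pi * ξ)) ^ 2) * M := by gcongr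
    have h5 : (-(2 * Real.pi * ξ)) ^ 2 * (M ^ 2 / (2 * Real.pi)) ≤
        (1 + (-(2 * Real.pi * ξ)) ^ 2) * (M ^ 2 / (2 * Real.pi)) := by
      gcongr; linarith
    rw [neg_sq] at h4 h5 ⊢
    linarith
  obtain ⟨V, hVc, hVb, hVd⟩ : ∃ V : ℝ → ℝ → ℂ, (Continuous fun p : ℝ × ℝ => V p.1 p.2) ∧
      (∀ t θ, ‖V t θ‖ ≤ (M ^ 2 / (2 * Real.pi) + ν * M) * (1 + θ ^ 2)) ∧
      ∀ t ∈ I, ∀ θ, HasDerivAt (fun t => F t θ) (V t θ) t :=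
    ⟨fun t θ => fourierField ν α (F t) θ, h.continuous_field hν h0,
      fun t θ => norm_fourierField_le_one_add_sq hν h0 h2 (h.mem t) θ,
      fun t ht θ => h.hasDerivAt hν h0 (hI ht) θ⟩
  obtain ⟨u, k, h3, h4, h5, h6, h7⟩ := exists_weakTimeDeriv_toLp (I := I) (M := M)
    (A := M ^ 2 / (2 * Real.pi) + ν * M) memLp_sobolevMeasure_neg_three
    (fun ξ => zero_le_one.trans (hW1 ξ)) (f := fun t ξ => F t (-(2 * Real.pi * ξ)))
    (g := fun t ξ => V t (-(2 * Real.pi * ξ)))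
    ((h.continuous_uncurry hν h0).comp hlin) (hVc.comp hlin)
    (fun t ξ => (charFunClass.norm_le (h.mem t) _).trans (le_mul_of_one_le_right hM (hW1 ξ)))
    (fun t ξ => by simpa only [neg_sq] using hVb t (-(2 * Real.pi * ξ)))
    hfD (fun t ht ξ => hVd t ht _)
  exact ⟨u, k, fun t _ => ⟨h.integrable t, (h3 t).trans (ae_of_all _ fun ξ => (h.fourierReal_eq t ξ).symm)⟩,
    h4.continuousOn, h5, h6, h7⟩

end IsDensitySolution

/-! ### Fourier transforms of test functions in the space variable -/

/-- The partial derivative in the first variable. -/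
noncomputable def partialFst (φ : ℝ × ℝ → ℝ) (p : ℝ × ℝ) : ℝ := fderiv ℝ φ p (1, 0)

/-- The partial derivative in the second variable. -/
noncomputable def partialSnd (φ : ℝ × ℝ → ℝ) (p : ℝ × ℝ) : ℝ := fderiv ℝ φ p (0, 1)

section TestFunctions

variable {φ : ℝ × ℝ → ℝ}

theorem contDiff_partialFst (hφ : ContDiff ℝ ∞ φ) : ContDiff ℝ ∞ (partialFst φ) :=
  (hφ.fderiv_right (m := ∞) (by simp)).clm_apply contDiff_const

theorem contDiff_partialSnd (hφ : ContDiff ℝ ∞ φ) : ContDiff ℝ ∞ (partialSnd φ) :=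
  (hφ.fderiv_right (m := ∞) (by simp)).clm_apply contDiff_const

theorem hasCompactSupport_partialFst (hc : HasCompactSupport φ) : HasCompactSupport (partialFst φ) :=
  hc.fderiv_apply ℝ _

theorem hasCompactSupport_partialSnd (hc : HasCompactSupport φ) : HasCompactSupport (partialSnd φ) :=
  hc.fderiv_apply ℝ _

theorem hasDerivAt_fst (hφ : ContDiff ℝ ∞ φ) (x t : ℝ) :
    HasDerivAt (fun z => φ (z, t)) (partialFst φ (x, t)) x :=
  ((hφ.differentiable (by simp) (x, t)).hasFDerivAt).comp_hasDerivAt x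
    ((hasDerivAt_id x).prodMk (hasDerivAt_const x t))

theorem hasDerivAt_snd (hφ : ContDiff ℝ ∞ φ) (x t : ℝ) :
    HasDerivAt (fun s => φ (x, s)) (partialSnd φ (x, t)) t :=
  ((hφ.differentiable (by simp) (x, t)).hasFDerivAt).comp_hasDerivAt t
    ((hasDerivAt_const t x).prodMk (hasDerivAt_id t))

theorem exists_eq_zero_of_lt_abs (hc : HasCompactSupport φ) :
    ∃ R : ℝ, 0 < R ∧ ∀ x t, R < |x| → φ (x, t) = 0 := by
  obtain ⟨R, hR⟩ := hc.isCompact.isBounded.subset_closedBall 0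
  refine ⟨max R 1, by positivity, fun x t hx => image_eq_zero_of_notMem_tsupport fun h => ?_⟩
  have h1 := hR h
  rw [mem_closedBall_zero_iff, Prod.norm_def] at h1
  have h2 : |x| ≤ R := (le_max_left _ _).trans h1
  exact absurd ((le_max_left R 1).trans_lt hx) (not_lt.2 h2)

theorem hasCompactSupport_slice (hc : HasCompactSupport φ) (t : ℝ) :
    HasCompactSupport fun x => φ (x, t) := by
  obtain ⟨R, -, hR⟩ := exists_eq_zero_of_lt_abs hc
  refine HasCompactSupport.intro (isCompact_Icc (a := -R) (b := R)) fun x hx => hR x t ?_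
  by_contra h
  exact hx (abs_le.1 (not_lt.1 h))

theorem contDiff_slice (hφ : ContDiff ℝ ∞ φ) (t : ℝ) : ContDiff ℝ ∞ fun x => φ (x, t) :=
  hφ.comp (contDiff_id.prodMk contDiff_const)

theorem fourierReal_slice_eq (hc : HasCompactSupport φ) :
    ∃ R : ℝ, 0 < R ∧ ∀ t ξ, fourierReal (fun x => φ (x, t)) ξ =
      ∫ x in Icc (-R) R, Complex.exp (((-2 * Real.pi * x * ξ : ℝ) : ℂ) * Complex.I) * (φ (x, t) : ℂ) := by
  obtain ⟨R, hR0, hR⟩ := exists_eq_zero_of_lt_abs hc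
  refine ⟨R, hR0, fun t ξ => ?_⟩
  rw [fourierReal, Real.fourier_real_eq_integral_exp_smul]
  symm
  refine setIntegral_eq_integral_of_forall_compl_eq_zero fun x hx => ?_
  rw [hR x t (lt_of_not_ge fun h => hx (abs_le.1 h)), Complex.ofReal_zero, mul_zero]

theorem continuous_fourierReal_slice (hφ : ContDiff ℝ ∞ φ) (hc : HasCompactSupport φ) :
    Continuous fun p : ℝ × ℝ => fourierReal (fun x => φ (x, p.1)) p.2 := by
  obtain ⟨R, -, hR⟩ := fourierReal_slice_eq hc
  simp only [hR]
  have hφc := hφ.continuous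
  refine continuous_parametric_integral_of_continuous (f := fun (p : ℝ × ℝ) (x : ℝ) =>
    Complex.exp (((-2 * Real.pi * x * p.2 : ℝ) : ℂ) * Complex.I) * (φ (x, p.1) : ℂ)) ?_ isCompact_Icc
  simp only [Function.uncurry_def]
  fun_prop

theorem exists_norm_fourierReal_slice_le (hφ : ContDiff ℝ ∞ φ) (hc : HasCompactSupport φ) :
    ∃ C : ℝ, 0 ≤ C ∧ ∀ t ξ, ‖fourierReal (fun x => φ (x, t)) ξ‖ ≤ C := by
  obtain ⟨R, hR0, hR⟩ := fourierReal_slice_eq hc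
  obtain ⟨B, hB⟩ := hc.exists_bound_of_continuous hφ.continuous
  have hB0 : 0 ≤ B := (norm_nonneg _).trans (hB 0)
  refine ⟨B * volume.real (Icc (-R) R), by positivity, fun t ξ => ?_⟩
  rw [hR]
  refine norm_setIntegral_le_of_norm_le_const measure_Icc_lt_top fun x _ => ?_
  rw [norm_mul, Complex.norm_exp_ofReal_mul_I, one_mul, Complex.norm_real]
  exact hB _

theorem hasDerivAt_fourierReal_slice (hφ : ContDiff ℝ ∞ φ) (hc : HasCompactSupport φ) (t ξ : ℝ) :
    HasDerivAt (fun s => fourierReal (fun x => φ (x, s)) ξ)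
      (fourierReal (fun x => partialSnd φ (x, t)) ξ) t := by
  obtain ⟨R, hR0, hR⟩ := exists_eq_zero_of_lt_abs hc
  have hR' : ∀ x s, R < |x| → partialSnd φ (x, s) = 0 := fun x s hx => by
    have h1 : (fun s => φ (x, s)) = fun _ => 0 := funext fun s => hR x s hx
    have h2 := hasDerivAt_snd hφ x s
    rw [h1] at h2
    exact h2.unique (hasDerivAt_const s 0)
  have hφc := hφ.continuous
  have hψ := contDiff_partialSnd hφ
  have hψc := hψ.continuous
  obtain ⟨B, hB⟩ := (hasCompactSupport_partialSnd hc).exists_bound_of_continuous hψc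
  simp only [fourierReal, Real.fourier_real_eq_integral_exp_smul, smul_eq_mul]
  have hexp : ∀ x : ℝ, ‖Complex.exp (((-2 * Real.pi * x * ξ : ℝ) : ℂ) * Complex.I)‖ = 1 := fun x =>
    Complex.norm_exp_ofReal_mul_I _
  refine (hasDerivAt_integral_of_dominated_loc_of_deriv_le (μ := volume) (s := univ)
    (F := fun s x => Complex.exp (((-2 * Real.pi * x * ξ : ℝ) : ℂ) * Complex.I) * (φ (x, s) : ℂ))
    (F' := fun s x => Complex.exp (((-2 * Real.pi * x * ξ : ℝ) : ℂ) * Complex.I) * (partialSnd φ (x, s) : ℂ))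
    (bound := (Icc (-R) R).indicator fun _ => B)
    univ_mem (Eventually.of_forall fun s => ?_) ?_ ?_ ?_ ?_ ?_).2
  · exact Continuous.aestronglyMeasurable (by fun_prop)
  · refine Continuous.integrable_of_hasCompactSupport (by fun_prop) ?_
    exact HasCompactSupport.mul_left ((hasCompactSupport_slice hc t).comp_left
      (g := fun y : ℝ => (y : ℂ)) Complex.ofReal_zero)
  · exact Continuous.aestronglyMeasurable (by fun_prop)
  · refine ae_of_all _ fun x s _ => ?_
    rw [norm_mul, hexp, one_mul, Complex.norm_real]
    by_cases hx : x ∈ Icc (-R) R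
    · rw [indicator_of_mem hx]; exact hB _
    · rw [indicator_of_notMem hx, hR' x s (lt_of_not_ge fun h => hx (abs_le.1 h)), norm_zero]
  · exact (integrable_indicator_iff measurableSet_Icc).2 (integrableOn_const measure_Icc_lt_top.ne)
  · refine ae_of_all _ fun x s _ => ?_
    exact ((hasDerivAt_snd hφ x s).ofReal_comp).const_mul _

theorem fourierReal_deriv {f : ℝ → ℝ} (hf : ContDiff ℝ ∞ f) (hc : HasCompactSupport f) (ξ : ℝ) :
    fourierReal (deriv f) ξ = (2 * Real.pi * Complex.I * ξ) * fourierReal f ξ := by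
  have hd : deriv (fun x => (f x : ℂ)) = fun x => ((deriv f x : ℝ) : ℂ) := by
    ext x
    exact ((hf.differentiable (by simp) x).hasDerivAt.ofReal_comp).deriv
  have h1 : Integrable fun x => (f x : ℂ) :=
    (hf.continuous.integrable_of_hasCompactSupport hc).ofReal
  have h2 : Integrable (deriv fun x => (f x : ℂ)) := by
    rw [hd]
    exact ((hf.continuous_deriv (by simp)).integrable_of_hasCompactSupport hc.deriv).ofReal
  have h3 := Real.fourier_deriv h1 (fun x => ((hf.differentiable (by simp) x).hasDerivAt.ofReal_comp).differentiableAt) h2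
  rw [hd] at h3
  rw [fourierReal, h3, fourierReal]
  rfl

theorem fourierReal_partialFst (hφ : ContDiff ℝ ∞ φ) (hc : HasCompactSupport φ) (t ξ : ℝ) :
    fourierReal (fun x => partialFst φ (x, t)) ξ =
      (2 * Real.pi * Complex.I * ξ) * fourierReal (fun x => φ (x, t)) ξ := by
  rw [← fourierReal_deriv (contDiff_slice hφ t) (hasCompactSupport_slice hc t)]
  congr 1
  ext x
  exact ((hasDerivAt_fst hφ x t).deriv).symm

/-- Zero, two and four space derivatives have bounded transforms, and `(1 + y²)² = 1 + 2y² + y⁴`.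
One factor `1 + y²` pays for the symbols of the equation, the other gives integrability in
frequency, uniformly in time. -/
theorem exists_norm_fourierReal_slice_mul_le (hφ : ContDiff ℝ ∞ φ) (hc : HasCompactSupport φ) :
    ∃ C : ℝ, 0 ≤ C ∧ ∀ t ξ, ‖fourierReal (fun x => φ (x, t)) ξ‖ * (1 + (2 * Real.pi * ξ) ^ 2) ^ 2 ≤ C := by
  have h1 := contDiff_partialFst hφ
  have c1 := hasCompactSupport_partialFst hc
  have h2 := contDiff_partialFst h1
  have c2 := hasCompactSupport_partialFst c1
  have h3 := contDiff_partialFst h2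
  have c3 := hasCompactSupport_partialFst c2
  have h4 := contDiff_partialFst h3
  have c4 := hasCompactSupport_partialFst c3
  obtain ⟨C0, hC0, H0⟩ := exists_norm_fourierReal_slice_le hφ hc
  obtain ⟨C2, hC2, H2⟩ := exists_norm_fourierReal_slice_le h2 c2
  obtain ⟨C4, hC4, H4⟩ := exists_norm_fourierReal_slice_le h4 c4
  refine ⟨C0 + 2 * C2 + C4, by positivity, fun t ξ => ?_⟩
  have hn : ∀ z : ℂ, ‖2 * Real.pi * Complex.I * ξ * z‖ = |2 * Real.pi * ξ| * ‖z‖ := fun z => by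
    simp [abs_mul]
  have e2 : ‖fourierReal (fun x => partialFst (partialFst φ) (x, t)) ξ‖ =
      (2 * Real.pi * ξ) ^ 2 * ‖fourierReal (fun x => φ (x, t)) ξ‖ := by
    rw [fourierReal_partialFst h1 c1, fourierReal_partialFst hφ hc, hn, hn, ← mul_assoc,
      ← sq, sq_abs]
  have e4 : ‖fourierReal (fun x => partialFst (partialFst (partialFst (partialFst φ))) (x, t)) ξ‖ =
      (2 * Real.pi * ξ) ^ 4 * ‖fourierReal (fun x => φ (x, t)) ξ‖ := by
    rw [fourierReal_partialFst h3 c3, fourierReal_partialFst h2 c2, hn, hn, ← mul_assoc,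
      ← sq, sq_abs, e2]
    ring
  have k0 := H0 t ξ
  have k2 := H2 t ξ
  have k4 := H4 t ξ
  rw [e2] at k2
  rw [e4] at k4
  linarith

end TestFunctions

/-! ### The terms of the weak formulation in frequency -/

theorem deriv_sub_div_eq_integral {f : ℝ → ℝ} (hf : ContDiff ℝ ∞ f) {x y : ℝ} (hxy : x ≠ y) :
    (f x - f y) / (x - y) = ∫ s in (0 : ℝ)..1, deriv f (y + (x - y) * s) := by
  have hne : x - y ≠ 0 := sub_ne_zero.2 hxy
  rw [intervalIntegral.integral_comp_add_mul _ hne, mul_zero, add_zero, mul_one, add_sub_cancel,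
    intervalIntegral.integral_deriv_eq_sub (fun z _ => hf.differentiable (by simp) z)
      ((hf.continuous_deriv (by simp)).intervalIntegrable _ _), smul_eq_mul, inv_mul_eq_div]

theorem integral_withDensity_ofReal {E : Type*} [NormedAddCommGroup E] [NormedSpace ℝ E] {r : ℝ → ℝ}
    (hr : Integrable r) (h0 : ∀ x, 0 ≤ r x) (u : ℝ → E) :
    ∫ x, u x ∂(volume.withDensity fun x => ENNReal.ofReal (r x)) = ∫ x, r x • u x := by
  rw [integral_withDensity_eq_integral_toReal_smul₀
    hr.aestronglyMeasurable.aemeasurable.ennreal_ofReal (ae_of_all _ fun _ => ENNReal.ofReal_lt_top)]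
  simp only [ENNReal.toReal_ofReal (h0 _)]

theorem charFun_map_segment {μ : Measure ℝ} [IsFiniteMeasure μ] (s θ : ℝ) :
    charFun ((μ.prod μ).map fun p : ℝ × ℝ => p.2 + (p.1 - p.2) * s) θ =
      charFun μ (s * θ) * charFun μ ((1 - s) * θ) := by
  rw [charFun_apply_real, integral_map (by fun_prop) (by fun_prop), charFun_apply_real,
    charFun_apply_real, ← integral_prod_mul]
  refine integral_congr_ae (ae_of_all _ fun p => ?_)
  simp only
  rw [← Complex.exp_add]
  congr 1
  push_cast
  ring

/-- The difference quotient of `f'` averages `f''` over the points `sx + (1-s)y`. Their law under `μ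
⊗ μ` has characteristic function `G(sθ) G((1-s)θ)`, and Parseval's formula applies for each `s`. -/
theorem integral_hilbert_kernel_eq {f r : ℝ → ℝ} (hf : ContDiff ℝ ∞ f) (hc : HasCompactSupport f)
    (hr : Integrable r) (h0 : ∀ x, 0 ≤ r x) {G : ℝ → ℂ}
    (hG : charFun (volume.withDensity fun x => ENNReal.ofReal (r x)) = G) :
    ((∫ x, ∫ y, (deriv f x - deriv f y) / (x - y) * r x * r y : ℝ) : ℂ) =
      -∫ ξ : ℝ, ((2 * Real.pi * ξ : ℝ) : ℂ) ^ 2 * fourierReal f ξ *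
        ∫ s in (0 : ℝ)..1, G (s * (2 * Real.pi * ξ)) * G ((1 - s) * (2 * Real.pi * ξ)) := by
  set μ := volume.withDensity fun x => ENNReal.ofReal (r x) with hμ
  have hμf : IsFiniteMeasure μ := isFiniteMeasure_withDensity_ofReal hr.2
  have hf1 : ContDiff ℝ ∞ (deriv f) := ((contDiff_infty_iff_deriv).1 hf).2
  have hf2 : ContDiff ℝ ∞ (deriv (deriv f)) := ((contDiff_infty_iff_deriv).1 hf1).2
  have hc2 : HasCompactSupport (deriv (deriv f)) := hc.deriv.deriv
  have hg := hf2.continuous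
  obtain ⟨B, hB⟩ := hc2.exists_bound_of_continuous hg
  set k : ℝ → ℝ → ℝ := fun x y => ∫ s in (0 : ℝ)..1, deriv (deriv f) (y + (x - y) * s) with hk
  have hkc : Continuous fun p : ℝ × ℝ => k p.1 p.2 := by
    refine intervalIntegral.continuous_parametric_intervalIntegral_of_continuous'
      (f := fun (p : ℝ × ℝ) (s : ℝ) => deriv (deriv f) (p.2 + (p.1 - p.2) * s)) ?_ 0 1
    simp only [Function.uncurry_def]
    fun_prop
  have hkB : ∀ x y, ‖k x y‖ ≤ B := fun x y => by
    have := intervalIntegral.norm_integral_le_of_norm_le_const (a := (0 : ℝ)) (b := 1) (C := B)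
      (f := fun s : ℝ => deriv (deriv f) (y + (x - y) * s)) fun s _ => hB _
    simpa using this
  have hki : Integrable (fun p : ℝ × ℝ => k p.1 p.2) (μ.prod μ) :=
    Integrable.of_bound hkc.aestronglyMeasurable B (ae_of_all _ fun p => hkB _ _)
  have e1 : ∫ x, ∫ y, (deriv f x - deriv f y) / (x - y) * r x * r y = ∫ p, k p.1 p.2 ∂(μ.prod μ) := by
    rw [integral_prod _ hki, hμ, integral_withDensity_ofReal hr h0]
    refine integral_congr_ae (ae_of_all _ fun x => ?_)
    simp only
    rw [integral_withDensity_ofReal hr h0, smul_eq_mul, ← integral_const_mul]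
    refine integral_congr_ae ?_
    -- On the diagonal the quotient has the default value 0, not `f''`; for fixed `x` this concerns
    -- a single `y`.
    filter_upwards [compl_mem_ae_iff.2 (measure_singleton x)] with y hy
    rw [deriv_sub_div_eq_integral hf1 (fun h => hy h.symm), smul_eq_mul]
    ring
  have e2 : ∫ p, k p.1 p.2 ∂(μ.prod μ) =
      ∫ s in (0 : ℝ)..1, ∫ p : ℝ × ℝ, deriv (deriv f) (p.2 + (p.1 - p.2) * s) ∂(μ.prod μ) :=
    (intervalIntegral_integral_swap_of_bounded (C := B) (μ := μ.prod μ)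
      (f := fun (s : ℝ) (p : ℝ × ℝ) => deriv (deriv f) (p.2 + (p.1 - p.2) * s))
      (by simp only [Function.uncurry_def]; fun_prop) zero_le_one fun s _ p => hB _).symm
  set g := hc2.toComplexSchwartz hf2 with hgdef
  have hgF : ∀ ξ, 𝓕 g ξ = -(((2 * Real.pi * ξ : ℝ) : ℂ) ^ 2 * fourierReal f ξ) := fun ξ => by
    have h1 : 𝓕 g ξ = fourierReal (deriv (deriv f)) ξ := rfl
    rw [h1, fourierReal_deriv hf1 hc.deriv, fourierReal_deriv hf hc]
    push_cast
    linear_combination (2 * Real.pi * ξ) ^ 2 * fourierReal f ξ * Complex.I_sq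
  have e3 : ∀ s : ℝ, ((∫ p : ℝ × ℝ, deriv (deriv f) (p.2 + (p.1 - p.2) * s) ∂(μ.prod μ) : ℝ) : ℂ) =
      ∫ ξ, 𝓕 g ξ * (G (s * (2 * Real.pi * ξ)) * G ((1 - s) * (2 * Real.pi * ξ))) := by
    intro s
    have hm : Measurable fun p : ℝ × ℝ => p.2 + (p.1 - p.2) * s := by fun_prop
    have h1 := integral_eq_integral_fourier_mul_charFun
      (μ := (μ.prod μ).map fun p : ℝ × ℝ => p.2 + (p.1 - p.2) * s) g
    rw [integral_map hm.aemeasurable g.continuous.aestronglyMeasurable] at h1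
    simp only [charFun_map_segment, hG] at h1
    rw [← h1, ← integral_complex_ofReal]
    rfl
  rw [e1, e2, ← intervalIntegral.integral_ofReal]
  simp only [e3]
  rw [intervalIntegral.integral_of_le zero_le_one]
  have hGc : Continuous G := by rw [← hG]; exact continuous_charFun
  have hGb : ∀ θ, ‖G θ‖ ≤ μ.real univ := fun θ => by rw [← hG]; exact norm_charFun_le θ
  rw [integral_integral_swap]
  · rw [← integral_neg]
    refine integral_congr_ae (ae_of_all _ fun ξ => ?_)
    simp only
    rw [integral_const_mul, hgF, intervalIntegral.integral_of_le zero_le_one]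
    ring
  · have h1 : Integrable (fun q : ℝ × ℝ => (μ.real univ * μ.real univ : ℂ) * 𝓕 g q.2)
        ((volume.restrict (Ioc (0 : ℝ) 1)).prod volume) :=
      (integrable_const (μ.real univ * μ.real univ : ℂ)).mul_prod (𝓕 g).integrable
    have hgc := (𝓕 g).continuous
    refine h1.mono (Continuous.aestronglyMeasurable ?_) (ae_of_all _ fun q => ?_)
    · simp only [Function.uncurry_def]
      exact (hgc.comp continuous_snd).mul
        ((hGc.comp (by fun_prop : Continuous fun q : ℝ × ℝ => q.1 * (2 * Real.pi * q.2))).mul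
        (hGc.comp (by fun_prop : Continuous fun q : ℝ × ℝ => (1 - q.1) * (2 * Real.pi * q.2))))
    · simp only [Function.uncurry_def, norm_mul, Complex.norm_real]
      rw [mul_comm, Real.norm_of_nonneg measureReal_nonneg]
      have := hGb (q.1 * (2 * Real.pi * q.2))
      have := hGb ((1 - q.1) * (2 * Real.pi * q.2))
      gcongr

theorem integral_mul_fracLaplacian_eq {α : ℝ} {f r : ℝ → ℝ}
    (hi : Integrable fun ξ : ℝ => ((|2 * Real.pi * ξ| ^ α : ℝ) : ℂ) * fourierReal f ξ)
    (hr : Integrable r) (h0 : ∀ x, 0 ≤ r x) {G : ℝ → ℂ}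
    (hG : charFun (volume.withDensity fun x => ENNReal.ofReal (r x)) = G) :
    ∫ x, r x * fracLaplacian α f x =
      (∫ ξ : ℝ, ((|2 * Real.pi * ξ| ^ α : ℝ) : ℂ) * fourierReal f ξ * G (2 * Real.pi * ξ)).re := by
  set μ := volume.withDensity fun x => ENNReal.ofReal (r x) with hμ
  have hμf : IsFiniteMeasure μ := isFiniteMeasure_withDensity_ofReal hr.2
  rw [← hG, ← integral_fourierInv_eq_integral_mul_charFun hi]
  have h1 : ∫ x, r x * fracLaplacian α f x = ∫ x, fracLaplacian α f x ∂μ := by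
    rw [hμ, integral_withDensity_ofReal hr h0]
    rfl
  rw [h1]
  have hcont : Continuous (𝓕⁻ fun ξ : ℝ => ((|2 * Real.pi * ξ| ^ α : ℝ) : ℂ) * fourierReal f ξ) := by
    rw [show (𝓕⁻ fun ξ : ℝ => ((|2 * Real.pi * ξ| ^ α : ℝ) : ℂ) * fourierReal f ξ) =
      fun x => 𝓕 (fun ξ : ℝ => ((|2 * Real.pi * ξ| ^ α : ℝ) : ℂ) * fourierReal f ξ) (-x) from
      funext fun x => Real.fourierInv_eq_fourier_neg _ x]
    exact (Real.continuous_fourier hi).comp continuous_neg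
  have hint : Integrable (𝓕⁻ fun ξ : ℝ => ((|2 * Real.pi * ξ| ^ α : ℝ) : ℂ) * fourierReal f ξ) μ := by
    refine Integrable.of_bound hcont.aestronglyMeasurable
      (∫ ξ : ℝ, ‖((|2 * Real.pi * ξ| ^ α : ℝ) : ℂ) * fourierReal f ξ‖) (ae_of_all _ fun x => ?_)
    rw [Real.fourierInv_eq_fourier_neg]
    exact VectorFourier.norm_fourierIntegral_le_integral_norm _ _ _ _ _
  exact integral_re hint

theorem integral_mul_eq_integral_fourierReal_mul {f r : ℝ → ℝ} (hf : ContDiff ℝ ∞ f)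
    (hc : HasCompactSupport f) (hr : Integrable r) (h0 : ∀ᵐ x, 0 ≤ r x) :
    ((∫ x, f x * r x : ℝ) : ℂ) = ∫ ξ, fourierReal f ξ *
      charFun (volume.withDensity fun x => ENNReal.ofReal (r x)) (2 * Real.pi * ξ) := by
  have hμf : IsFiniteMeasure (volume.withDensity fun x => ENNReal.ofReal (r x)) :=
    isFiniteMeasure_withDensity_ofReal hr.2
  have h1 := integral_eq_integral_fourier_mul_charFun
    (μ := volume.withDensity fun x => ENNReal.ofReal (r x)) (hc.toComplexSchwartz hf)
  refine Eq.trans ?_ h1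
  rw [integral_withDensity_eq_integral_toReal_smul₀
    hr.aestronglyMeasurable.aemeasurable.ennreal_ofReal (ae_of_all _ fun _ => ENNReal.ofReal_lt_top),
    ← integral_complex_ofReal]
  refine integral_congr_ae ?_
  filter_upwards [h0] with x hx
  rw [ENNReal.toReal_ofReal hx, HasCompactSupport.toComplexSchwartz_apply, Complex.real_smul, mul_comm,
    Complex.ofReal_mul]

theorem integrable_inv_one_add_two_pi_sq : Integrable fun ξ : ℝ => (1 + (2 * Real.pi * ξ) ^ 2)⁻¹ :=
  integrable_inv_one_add_sq.comp_mul_left' (R := 2 * Real.pi) (by have := Real.pi_pos; positivity)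

theorem integrable_prod_of_norm_le {J : ℝ → ℝ → ℂ} (hJ : Continuous fun q : ℝ × ℝ => J q.1 q.2) {C : ℝ}
    (hb : ∀ t ξ, ‖J t ξ‖ * (1 + (2 * Real.pi * ξ) ^ 2) ≤ C) (T : ℝ) :
    Integrable (Function.uncurry J) ((volume.restrict (Ioo 0 T)).prod volume) := by
  have h1 : Integrable (fun q : ℝ × ℝ => C * (1 + (2 * Real.pi * q.2) ^ 2)⁻¹)
      ((volume.restrict (Ioo 0 T)).prod volume) :=
    (integrable_const C).mul_prod integrable_inv_one_add_two_pi_sq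
  refine h1.mono' hJ.aestronglyMeasurable (ae_of_all _ fun q => ?_)
  rw [← div_eq_mul_inv, le_div_iff₀ (by positivity)]
  exact hb q.1 q.2

theorem IsTestFunction.fourierReal_slice_eq_zero {T : ℝ} {φ : ℝ × ℝ → ℝ} (hφ : IsTestFunction T φ)
    (ξ : ℝ) : fourierReal (fun x => φ (x, T)) ξ = 0 := by
  have : (fun x => ((φ (x, T) : ℝ) : ℂ)) = fun _ => 0 := by
    ext x
    rw [image_eq_zero_of_notMem_tsupport fun h => lt_irrefl T (hφ.2.2 h), Complex.ofReal_zero]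
  rw [fourierReal, this, Real.fourier_eq']
  simp

theorem setIntegral_Ioo_deriv_mul_eq {a a' b b' : ℝ → ℂ} {T : ℝ} (hT : 0 ≤ T) (ha : Continuous a)
    (hb : Continuous b) (ha' : Continuous a') (hb' : Continuous b') (hda : ∀ t, HasDerivAt a (a' t) t)
    (hdb : ∀ t, 0 < t → HasDerivAt b (b' t) t) :
    ∫ t in Ioo 0 T, (a' t * b t + a t * b' t) = a T * b T - a 0 * b 0 := by
  rw [← integral_Ioc_eq_integral_Ioo, ← intervalIntegral.integral_of_le hT]
  exact intervalIntegral.integral_eq_sub_of_hasDeriv_right_of_le hT (ha.mul hb).continuousOn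
    (fun t ht => ((hda t).mul (hdb t ht.1)).hasDerivWithinAt)
    (((ha'.mul hb).add (ha.mul hb')).intervalIntegrable _ _)

theorem continuous_fourierReal_slice_left {φ : ℝ × ℝ → ℝ} (hφ : ContDiff ℝ ∞ φ)
    (hc : HasCompactSupport φ) (ξ : ℝ) : Continuous fun t => fourierReal (fun x => φ (x, t)) ξ :=
  (continuous_fourierReal_slice hφ hc).comp (by fun_prop : Continuous fun t : ℝ => (t, ξ))

/-- Fubini's theorem lets the time integration be carried out at each frequency separately, where
the equation is an ordinary differential equation. -/
theorem integral_prod_balance {m : Measure ℝ} [SFinite m] {f g k : ℝ → ℝ → ℂ} {b : ℝ → ℂ} {c d : ℂ}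
    (hf : Integrable (Function.uncurry f) (m.prod volume))
    (hg : Integrable (Function.uncurry g) (m.prod volume))
    (hk : Integrable (Function.uncurry k) (m.prod volume))
    (h : ∀ ξ, ∫ t, (f t ξ + (-(c * g t ξ) - d * k t ξ)) ∂m = -b ξ) :
    (∫ t, ∫ ξ, f t ξ ∂volume ∂m) + ∫ ξ, b ξ =
      c * (∫ t, ∫ ξ, g t ξ ∂volume ∂m) + d * ∫ t, ∫ ξ, k t ξ ∂volume ∂m := by
  rw [integral_integral_swap hf, integral_integral_swap hg, integral_integral_swap hk]
  have hpt : ∀ᵐ ξ : ℝ, b ξ = c * (∫ t, g t ξ ∂m) + d * (∫ t, k t ξ ∂m) - ∫ t, f t ξ ∂m := by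
    filter_upwards [hf.prod_left_ae, hg.prod_left_ae, hk.prod_left_ae] with ξ j1 j2 j3
    simp only [Function.uncurry_def] at j1 j2 j3
    have h1 := h ξ
    have j4 : Integrable (fun t => -(c * g t ξ)) m := (j2.const_mul c).neg
    have j5 : Integrable (fun t => -(c * g t ξ) - d * k t ξ) m := j4.sub (j3.const_mul d)
    rw [integral_add j1 j5, integral_sub j4 (j3.const_mul d), integral_neg, integral_const_mul,
      integral_const_mul] at h1
    linear_combination h1
  have k1 := hf.integral_prod_right
  have k2 := hg.integral_prod_right.const_mul c
  have k3 := hk.integral_prod_right.const_mul d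
  simp only [Function.uncurry_def] at k1 k2 k3
  have e : ∫ ξ, b ξ = c * (∫ ξ, ∫ t, g t ξ ∂m) + d * (∫ ξ, ∫ t, k t ξ ∂m) - ∫ ξ, ∫ t, f t ξ ∂m := by
    have k4 : Integrable fun ξ => c * (∫ t, g t ξ ∂m) + d * (∫ t, k t ξ ∂m) := k2.add k3
    rw [integral_congr_ae hpt, integral_sub k4 k1, integral_add k2 k3, integral_const_mul,
      integral_const_mul]
  rw [e]
  ring

/-! ### The weak formulation -/

namespace IsDensitySolution

variable {ν α M T : ℝ} {F : ℝ → ℝ → ℂ} {ρ : ℝ → ℝ → ℝ} {φ : ℝ × ℝ → ℝ}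

theorem norm_selfInteraction_le (h : IsDensitySolution ν α M F ρ) (t θ : ℝ) :
    ‖∫ s in (0 : ℝ)..1, F t (s * θ) * F t ((1 - s) * θ)‖ ≤ M ^ 2 := by
  have := intervalIntegral.norm_integral_le_of_norm_le_const (a := (0 : ℝ)) (b := 1) (C := M ^ 2)
    (f := fun s : ℝ => F t (s * θ) * F t ((1 - s) * θ)) fun s _ => by
      rw [norm_mul, sq]
      exact mul_le_mul (charFunClass.norm_le (h.mem t) _) (charFunClass.norm_le (h.mem t) _)
        (norm_nonneg _) h.M_nonneg
  simpa using this

theorem integrable_linear (h : IsDensitySolution ν α M F ρ) (hν : 0 ≤ ν) (h0 : 0 ≤ α)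
    (hφ : ContDiff ℝ ∞ φ) (hc : HasCompactSupport φ) (T : ℝ) :
    Integrable (Function.uncurry fun t ξ => fourierReal (fun x => φ (x, t)) ξ * F t (2 * Real.pi * ξ))
      ((volume.restrict (Ioo 0 T)).prod volume) := by
  obtain ⟨C, hC0, hC⟩ := exists_norm_fourierReal_slice_mul_le hφ hc
  refine integrable_prod_of_norm_le (C := C * M) ((continuous_fourierReal_slice hφ hc).mul
    ((h.continuous_uncurry hν h0).comp
      (by fun_prop : Continuous fun q : ℝ × ℝ => (q.1, 2 * Real.pi * q.2)))) (fun t ξ => ?_) T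
  have h1 := hC t ξ
  have h2 := charFunClass.norm_le (h.mem t) (2 * Real.pi * ξ)
  have h3 : 1 ≤ 1 + (2 * Real.pi * ξ) ^ 2 := by nlinarith [sq_nonneg (2 * Real.pi * ξ)]
  generalize 1 + (2 * Real.pi * ξ) ^ 2 = W at h1 h3
  rw [norm_mul]
  calc ‖fourierReal (fun x => φ (x, t)) ξ‖ * ‖F t (2 * Real.pi * ξ)‖ * W
      = (‖fourierReal (fun x => φ (x, t)) ξ‖ * W) * ‖F t (2 * Real.pi * ξ)‖ := by ring
    _ ≤ (‖fourierReal (fun x => φ (x, t)) ξ‖ * W ^ 2) * M := by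
      gcongr
      exact le_self_pow₀ h3 (by norm_num)
    _ ≤ C * M := by have := h.M_nonneg; gcongr

theorem integrable_quadratic (h : IsDensitySolution ν α M F ρ) (hν : 0 ≤ ν) (h0 : 0 ≤ α)
    (hφ : ContDiff ℝ ∞ φ) (hc : HasCompactSupport φ) (T : ℝ) :
    Integrable (Function.uncurry fun t ξ : ℝ =>
      ((2 * Real.pi * ξ : ℝ) : ℂ) ^ 2 * fourierReal (fun x => φ (x, t)) ξ *
        ∫ s in (0 : ℝ)..1, F t (s * (2 * Real.pi * ξ)) * F t ((1 - s) * (2 * Real.pi * ξ)))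
      ((volume.restrict (Ioo 0 T)).prod volume) := by
  obtain ⟨C, hC0, hC⟩ := exists_norm_fourierReal_slice_mul_le hφ hc
  have hFc := h.continuous_uncurry hν h0
  have hN : Continuous fun q : ℝ × ℝ =>
      ∫ s in (0 : ℝ)..1, F q.1 (s * (2 * Real.pi * q.2)) * F q.1 ((1 - s) * (2 * Real.pi * q.2)) := by
    have h3 : Continuous fun q : (ℝ × ℝ) × ℝ =>
        F q.1.1 (q.2 * (2 * Real.pi * q.1.2)) * F q.1.1 ((1 - q.2) * (2 * Real.pi * q.1.2)) :=
      (hFc.comp (by fun_prop : Continuous fun q : (ℝ × ℝ) × ℝ => (q.1.1, q.2 * (2 * Real.pi * q.1.2)))).mul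
        (hFc.comp (by fun_prop : Continuous fun q : (ℝ × ℝ) × ℝ =>
          (q.1.1, (1 - q.2) * (2 * Real.pi * q.1.2))))
    exact intervalIntegral.continuous_parametric_intervalIntegral_of_continuous'
      (f := fun (p : ℝ × ℝ) (s : ℝ) => F p.1 (s * (2 * Real.pi * p.2)) * F p.1 ((1 - s) * (2 * Real.pi * p.2)))
      h3 0 1
  refine integrable_prod_of_norm_le (C := C * M ^ 2)
    (((by fun_prop : Continuous fun q : ℝ × ℝ => ((2 * Real.pi * q.2 : ℝ) : ℂ) ^ 2).mul
      (continuous_fourierReal_slice hφ hc)).mul hN) (fun t ξ => ?_) T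
  have h1 := hC t ξ
  have h2 := h.norm_selfInteraction_le t (2 * Real.pi * ξ)
  have h3 : (2 * Real.pi * ξ) ^ 2 ≤ 1 + (2 * Real.pi * ξ) ^ 2 := by linarith
  have h4 : 0 ≤ 1 + (2 * Real.pi * ξ) ^ 2 := by positivity
  rw [norm_mul, norm_mul, norm_pow, Complex.norm_real, Real.norm_eq_abs, sq_abs]
  have hN0 := norm_nonneg (∫ s in (0 : ℝ)..1, F t (s * (2 * Real.pi * ξ)) * F t ((1 - s) * (2 * Real.pi * ξ)))
  generalize 1 + (2 * Real.pi * ξ) ^ 2 = W at h1 h3 h4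
  generalize ‖∫ s in (0 : ℝ)..1, F t (s * (2 * Real.pi * ξ)) * F t ((1 - s) * (2 * Real.pi * ξ))‖ = N at h2 hN0
  calc (2 * Real.pi * ξ) ^ 2 * ‖fourierReal (fun x => φ (x, t)) ξ‖ * N * W
      ≤ W * ‖fourierReal (fun x => φ (x, t)) ξ‖ * M ^ 2 * W := by gcongr
    _ = (‖fourierReal (fun x => φ (x, t)) ξ‖ * W ^ 2) * M ^ 2 := by ring
    _ ≤ C * M ^ 2 := by gcongr

theorem norm_rpow_mul_fourierReal_le (h0 : 0 ≤ α) (h2 : α ≤ 2) {C : ℝ} {t ξ : ℝ}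
    (hC : ‖fourierReal (fun x => φ (x, t)) ξ‖ * (1 + (2 * Real.pi * ξ) ^ 2) ^ 2 ≤ C) :
    ‖((|2 * Real.pi * ξ| ^ α : ℝ) : ℂ) * fourierReal (fun x => φ (x, t)) ξ‖ *
      (1 + (2 * Real.pi * ξ) ^ 2) ≤ C := by
  have h3 := rpow_abs_le_one_add_sq h0 h2 (2 * Real.pi * ξ)
  have h4 : 0 ≤ 1 + (2 * Real.pi * ξ) ^ 2 := by positivity
  rw [norm_mul, Complex.norm_real, Real.norm_of_nonneg (by positivity)]
  generalize 1 + (2 * Real.pi * ξ) ^ 2 = W at h3 h4 hC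
  calc |2 * Real.pi * ξ| ^ α * ‖fourierReal (fun x => φ (x, t)) ξ‖ * W
      ≤ W * ‖fourierReal (fun x => φ (x, t)) ξ‖ * W := by gcongr
    _ = ‖fourierReal (fun x => φ (x, t)) ξ‖ * W ^ 2 := by ring
    _ ≤ C := hC

theorem integrable_rpow_mul_fourierReal (h0 : 0 ≤ α) (h2 : α ≤ 2) (hφ : ContDiff ℝ ∞ φ)
    (hc : HasCompactSupport φ) (t : ℝ) :
    Integrable fun ξ : ℝ => ((|2 * Real.pi * ξ| ^ α : ℝ) : ℂ) * fourierReal (fun x => φ (x, t)) ξ := by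
  obtain ⟨C, hC0, hC⟩ := exists_norm_fourierReal_slice_mul_le hφ hc
  have hrc : Continuous fun c : ℝ => |c| ^ α := continuous_abs.rpow_const fun _ => Or.inr h0
  have h1 : Continuous fun ξ => fourierReal (fun x => φ (x, t)) ξ :=
    (continuous_fourierReal_slice hφ hc).comp (by fun_prop : Continuous fun ξ : ℝ => (t, ξ))
  have h3 : Continuous fun ξ : ℝ => ((|2 * Real.pi * ξ| ^ α : ℝ) : ℂ) :=
    Complex.continuous_ofReal.comp (hrc.comp (by fun_prop : Continuous fun ξ : ℝ => 2 * Real.pi * ξ))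
  refine (integrable_inv_one_add_two_pi_sq.const_mul C).mono' (h3.mul h1).aestronglyMeasurable
    (ae_of_all _ fun ξ => ?_)
  rw [← div_eq_mul_inv, le_div_iff₀ (by positivity)]
  exact norm_rpow_mul_fourierReal_le h0 h2 (hC t ξ)

theorem integrable_dissipation (h : IsDensitySolution ν α M F ρ) (hν : 0 ≤ ν) (h0 : 0 ≤ α) (h2 : α ≤ 2)
    (hφ : ContDiff ℝ ∞ φ) (hc : HasCompactSupport φ) (T : ℝ) :
    Integrable (Function.uncurry fun t ξ : ℝ =>
      ((|2 * Real.pi * ξ| ^ α : ℝ) : ℂ) * fourierReal (fun x => φ (x, t)) ξ * F t (2 * Real.pi * ξ))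
      ((volume.restrict (Ioo 0 T)).prod volume) := by
  obtain ⟨C, hC0, hC⟩ := exists_norm_fourierReal_slice_mul_le hφ hc
  have hrc : Continuous fun c : ℝ => |c| ^ α := continuous_abs.rpow_const fun _ => Or.inr h0
  have h3 : Continuous fun q : ℝ × ℝ => ((|2 * Real.pi * q.2| ^ α : ℝ) : ℂ) :=
    Complex.continuous_ofReal.comp (hrc.comp (by fun_prop : Continuous fun q : ℝ × ℝ => 2 * Real.pi * q.2))
  refine integrable_prod_of_norm_le (C := C * M) ((h3.mul (continuous_fourierReal_slice hφ hc)).mul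
    ((h.continuous_uncurry hν h0).comp
      (by fun_prop : Continuous fun q : ℝ × ℝ => (q.1, 2 * Real.pi * q.2)))) (fun t ξ => ?_) T
  have h4 := norm_rpow_mul_fourierReal_le h0 h2 (hC t ξ)
  have h5 := charFunClass.norm_le (h.mem t) (2 * Real.pi * ξ)
  rw [norm_mul, mul_right_comm]
  exact mul_le_mul h4 h5 (norm_nonneg _) hC0

/-- The integrand is the time derivative of the product of the two transforms. The test function
vanishes at `t = T`, so only the initial term survives. -/
theorem integral_time_eq (h : IsDensitySolution ν α M F ρ) (hν : 0 ≤ ν) (h0 : 0 ≤ α)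
    (hT : 0 < T) (hφ : IsTestFunction T φ) (ξ : ℝ) :
    (∫ t in Ioo 0 T, (fourierReal (fun x => partialSnd φ (x, t)) ξ * F t (2 * Real.pi * ξ) +
      fourierReal (fun x => φ (x, t)) ξ * fourierField ν α (F t) (2 * Real.pi * ξ))) =
      -(fourierReal (fun x => φ (x, 0)) ξ * F 0 (2 * Real.pi * ξ)) := by
  have hs := hφ.1
  have hc := hφ.2.1
  refine (setIntegral_Ioo_deriv_mul_eq hT.le (continuous_fourierReal_slice_left hs hc ξ)
    (h.continuous_left hν h0 _) (continuous_fourierReal_slice_left (contDiff_partialSnd hs)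
      (hasCompactSupport_partialSnd hc) ξ) (h.continuous_field_left hν h0 _)
    (fun t => hasDerivAt_fourierReal_slice hs hc t ξ) fun t ht => h.hasDerivAt hν h0 ht _).trans ?_
  rw [hφ.fourierReal_slice_eq_zero, zero_mul, zero_sub]

theorem weak_form (h : IsDensitySolution ν α M F ρ) (hν : 0 ≤ ν) (h0 : 0 ≤ α) (h2 : α ≤ 2)
    {ρ₀ : ℝ → ℝ} (h_nonneg : ∀ᵐ x, 0 ≤ ρ₀ x) (h_L1 : Integrable ρ₀)
    (hF0 : F 0 = charFun (volume.withDensity fun x => ENNReal.ofReal (ρ₀ x)))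
    (hT : 0 < T) (hφ : IsTestFunction T φ) :
    (∫ t in Ioo 0 T, ∫ x, deriv (fun s => φ (x, s)) t * ρ t x) + ∫ x, φ (x, 0) * ρ₀ x =
      -(1 / (2 * Real.pi)) * (∫ t in Ioo 0 T, ∫ x, ∫ y,
          (deriv (fun z => φ (z, t)) x - deriv (fun z => φ (z, t)) y) / (x - y)
            * ρ t x * ρ t y)
        + ν * ∫ t in Ioo 0 T, ∫ x, ρ t x * fracLaplacian α (fun z => φ (z, t)) x := by
  obtain ⟨hs, hc, -⟩ := id hφ
  have hs' := contDiff_partialSnd hs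
  have hc' := hasCompactSupport_partialSnd hc
  have i1 := h.integrable_linear hν h0 hs' hc' T
  have i2 := h.integrable_quadratic hν h0 hs hc T
  have i3 := h.integrable_dissipation hν h0 h2 hs hc T
  have t1 : ((∫ t in Ioo 0 T, ∫ x, deriv (fun s => φ (x, s)) t * ρ t x : ℝ) : ℂ) =
      ∫ t in Ioo 0 T, ∫ ξ, fourierReal (fun x => partialSnd φ (x, t)) ξ * F t (2 * Real.pi * ξ) := by
    rw [← integral_complex_ofReal]
    refine integral_congr_ae (ae_of_all _ fun t => ?_)
    simp only [← h.charFun_eq t]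
    rw [← integral_mul_eq_integral_fourierReal_mul (contDiff_slice hs' t) (hasCompactSupport_slice hc' t)
      (h.integrable t) (ae_of_all _ (h.nonneg t))]
    simp only [(hasDerivAt_snd hs _ t).deriv]
  have t2 : ((∫ x, φ (x, 0) * ρ₀ x : ℝ) : ℂ) =
      ∫ ξ, fourierReal (fun x => φ (x, 0)) ξ * F 0 (2 * Real.pi * ξ) := by
    rw [hF0, ← integral_mul_eq_integral_fourierReal_mul (contDiff_slice hs 0) (hasCompactSupport_slice hc 0)
      h_L1 h_nonneg]
  have t3 : ((∫ t in Ioo 0 T, ∫ x, ∫ y, (deriv (fun z => φ (z, t)) x - deriv (fun z => φ (z, t)) y) / (x - y)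
      * ρ t x * ρ t y : ℝ) : ℂ) = -∫ t in Ioo 0 T, ∫ ξ : ℝ,
      ((2 * Real.pi * ξ : ℝ) : ℂ) ^ 2 * fourierReal (fun x => φ (x, t)) ξ *
        ∫ s in (0 : ℝ)..1, F t (s * (2 * Real.pi * ξ)) * F t ((1 - s) * (2 * Real.pi * ξ)) := by
    rw [← integral_complex_ofReal, ← integral_neg]
    refine integral_congr_ae (ae_of_all _ fun t => ?_)
    exact integral_hilbert_kernel_eq (contDiff_slice hs t) (hasCompactSupport_slice hc t)
      (h.integrable t) (h.nonneg t) (h.charFun_eq t)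
  have t4 : (∫ t in Ioo 0 T, ∫ x, ρ t x * fracLaplacian α (fun z => φ (z, t)) x) =
      (∫ t in Ioo 0 T, ∫ ξ : ℝ, ((|2 * Real.pi * ξ| ^ α : ℝ) : ℂ) * fourierReal (fun x => φ (x, t)) ξ *
        F t (2 * Real.pi * ξ)).re := by
    refine Eq.trans ?_ (integral_re i3.integral_prod_left)
    refine integral_congr_ae (ae_of_all _ fun t => ?_)
    exact integral_mul_fracLaplacian_eq (integrable_rpow_mul_fourierReal h0 h2 hs hc t)
      (h.integrable t) (h.nonneg t) (h.charFun_eq t)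
  -- With `θ = 2πξ` the factor `θ²/2π` of the field becomes the constant `1/2π` of the weak
  -- formulation; the minus sign there comes from `t3`, the transform of a second derivative.
  have balance : (∫ t in Ioo 0 T, ∫ ξ, fourierReal (fun x => partialSnd φ (x, t)) ξ * F t (2 * Real.pi * ξ)) +
      (∫ ξ, fourierReal (fun x => φ (x, 0)) ξ * F 0 (2 * Real.pi * ξ)) =
      (1 / (2 * Real.pi) : ℝ) * (∫ t in Ioo 0 T, ∫ ξ : ℝ,
      ((2 * Real.pi * ξ : ℝ) : ℂ) ^ 2 * fourierReal (fun x => φ (x, t)) ξ *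
        ∫ s in (0 : ℝ)..1, F t (s * (2 * Real.pi * ξ)) * F t ((1 - s) * (2 * Real.pi * ξ))) +
      (ν : ℂ) * ∫ t in Ioo 0 T, ∫ ξ : ℝ, ((|2 * Real.pi * ξ| ^ α : ℝ) : ℂ) *
        fourierReal (fun x => φ (x, t)) ξ * F t (2 * Real.pi * ξ) := by
    refine integral_prod_balance i1 i2 i3 fun ξ => ?_
    rw [← h.integral_time_eq hν h0 hT hφ ξ]
    refine integral_congr_ae (ae_of_all _ fun t => ?_)
    simp only [fourierField]
    push_cast
    ring
  have hre := congrArg Complex.re balance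
  rw [← t1, ← t2, ← Complex.ofReal_add, Complex.ofReal_re, Complex.add_re, Complex.re_ofReal_mul,
    Complex.re_ofReal_mul, ← t4] at hre
  rw [hre, ← neg_eq_iff_eq_neg.2 t3]
  simp
end IsDensitySolution

/-! ### The main theorem -/

theorem theorem1p1 (ν α : ℝ) (hν : 0 < ν) (hα₀ : 0 ≤ α) (hα₂ : α ≤ 2)
    (ρ₀ : ℝ → ℝ) (h_nonneg : ∀ᵐ x, 0 ≤ ρ₀ x) (h_L1 : Integrable ρ₀)
    (h_Sobolev : sobolevNorm (1 / 2) ρ₀ < ⊤) :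
    ∃ ρ : ℝ → ℝ → ℝ,
      (∀ T : ℝ, 0 < T → IsWeakSolution ν α T ρ₀ ρ) ∧
      MemLInftyL1 (Ioi 0) ρ ∧
      MemLInftySobolev (1 / 2) (Ioi 0) ρ ∧
      MemW1InftySobolev (-3) (Ioi 0) ρ ∧
      ∀ t : ℝ, 0 < t →
        (∀ᵐ x, 0 ≤ ρ t x) ∧ Integrable (ρ t) ∧
        eLpNorm (ρ t) 1 volume ≤ eLpNorm ρ₀ 1 volume ∧
        sobolevNorm (1 / 2) (ρ t) ≤ sobolevNorm (1 / 2) ρ₀ := by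
  obtain ⟨F, ρ, h, hF0⟩ := exists_isDensitySolution hν.le hα₀ hα₂ h_nonneg h_L1 h_Sobolev
  have hL1 : ENNReal.ofReal (∫ x, ρ₀ x) = eLpNorm ρ₀ 1 volume := by
    rw [ofReal_integral_eq_lintegral_ofReal h_L1 h_nonneg, eLpNorm_one_eq_lintegral_enorm]
    refine lintegral_congr_ae ?_
    filter_upwards [h_nonneg] with x hx
    exact (Real.enorm_of_nonneg hx).symm
  have hnorm : ∀ t, sobolevNorm (1 / 2) (ρ t) =
      eLpNorm (fun ξ => F t (-(2 * Real.pi * ξ))) 2 (sobolevMeasure (1 / 2)) := fun t =>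
    congrArg (fun u => eLpNorm u 2 (sobolevMeasure (1 / 2))) (funext (h.fourierReal_eq t))
  have hnorm₀ : sobolevNorm (1 / 2) ρ₀ =
      eLpNorm (fun ξ => F 0 (-(2 * Real.pi * ξ))) 2 (sobolevMeasure (1 / 2)) := by
    simp only [hF0, charFun_withDensity_ofReal h_L1 h_nonneg]
    rfl
  refine ⟨ρ, fun T hT => ⟨h.measurable.aestronglyMeasurable, fun t _ => ae_of_all _ (h.nonneg t),
    h.memLInftyL1 _, h.memLInftySobolev hν.le hα₀ _,
    ⟨3, by norm_num, h.memW1InftySobolev hν.le hα₀ hα₂ Ioo_subset_Ioi_self⟩,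
    fun φ hφ => h.weak_form hν.le hα₀ hα₂ h_nonneg h_L1 hF0 hT hφ⟩,
    h.memLInftyL1 _, h.memLInftySobolev hν.le hα₀ _,
    h.memW1InftySobolev hν.le hα₀ hα₂ subset_rfl,
    fun t _ => ⟨ae_of_all _ (h.nonneg t), h.integrable t, ?_, ?_⟩⟩
  · exact hL1 ▸ h.eLpNorm_one_le t
  · rw [hnorm, hnorm₀]
    exact h.eLpNorm_le hν.le hα₀ t
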